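/- Let $\mathbb D$ be the open unit disc in $\mathbb C$ and $dA$ area measure. For a complex Banach space $Y$ and an analytic function $f(z)=\sum_{n\ge 0}\hat f(n)z^n$ from $\mathbb D$ to $Y$, put $D^{\gamma}f(z)=\sum_{n\ge0}(1+n)^{\gamma}\hat f(n)z^n$ for $\gamma\in\mathbb R$. Let $H^2(Y)$ be the space of analytic $f:\mathbb D\to Y$ with $\|f\|_{H^2(Y)}^2=\sup_{0<r<1}\frac1{2\pi}\int_0^{2\pi}\|f(re^{i\theta})\|_Y^2\,d\theta<\infty$, and $H^2=H^2(\mathbb C)$. Let $\mathcal O$ be the set of scalar analytic functions on $\mathbb D$ that extend analytically to a larger disc centered at the origin, and $\mathcal O_1=\{f\in\mathcal O:\|f\|_{H^2}=1\}$. Let $\mathcal H$ be a separable complex Hilbert space. For an analytic function $\phi:\mathbb D\to\mathcal H$ and $f\in\mathcal O$ let $$\Gamma_\phi f(z)=\sum_{n=0}^\infty\Big(\sum_{m=0}^\infty \hat f(m)\,\hat\phi(m+n)\Big)z^n,\qquad z\in\mathbb D,$$ and say that $D^\alpha\Gamma_\phi:H^2\to H^2(\mathcal H)$ is bounded if $f\mapsto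 D^\alpha(\Gamma_\phi f)$, $f\in\mathcal O$, extends to a bounded linear operator from $H^2$ to $H^2(\mathcal H)$. **Corollary.** Let $\alpha>0$ and let $\phi:\mathbb D\to\mathcal H$ be analytic. Then $D^\alpha\Gamma_\phi:H^2\to H^2(\mathcal H)$ is bounded if and only if $$S_\alpha(\phi):=\sup_{f\in\mathcal O_1}\int_{\mathbb D}|f(z)|^2\,\|D^{1+\alpha}\phi(z)\|_{\mathcal H}^2\,(1-|z|^2)\,dA(z)<\infty .$$ Moreover, there are constants $c,C>0$ depending only on $\alpha$ such that, whenever $D^\alpha\Gamma_\phi$ is bounded, $$c\,\|D^\alpha\Gamma_\phi\|_{H^2\to H^2(\mathcal H)}^2\le S_\alpha(\phi)\le C\,\|D^\alpha\Gamma_\phi\|_{H^2\to H^2(\mathcal H)}^2 .$$ -/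

import Mathlib

open MeasureTheory Metric Set
open scoped ENNReal Real

noncomputable section

/-- `m`: normalized Lebesgue measure on the unit circle, in the angular variable. -/
def circleMeasure : Measure ℝ :=
  ENNReal.ofReal (2 * π)⁻¹ • volume.restrict (Ioc 0 (2 * π))

/-- The Hardy quantity `sup_{0 < r < 1} ‖f_r‖_{L²(𝕋, E)}`, where `f_r(ζ) = f(rζ)`. -/
def hardyENorm {E : Type*} [NormedAddCommGroup E] (f : ℂ → E) : ℝ≥0∞ :=
  ⨆ r : Ioo (0 : ℝ) 1, eLpNorm (fun θ : ℝ => f (circleMap 0 r θ)) 2 circleMeasure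

section Hardy

variable {E : Type*} [NormedAddCommGroup E]

theorem circleMap_mem_unit_ball (r : Ioo (0 : ℝ) 1) (θ : ℝ) :
    circleMap 0 (r : ℝ) θ ∈ ball (0 : ℂ) 1 := by
  have h := r.2
  simp [abs_of_pos h.1, h.2]

theorem continuous_comp_circleMap {f : ℂ → E} (hf : ContinuousOn f (ball 0 1))
    (r : Ioo (0 : ℝ) 1) : Continuous (fun θ : ℝ => f (circleMap 0 r θ)) :=
  hf.comp_continuous (continuous_circleMap 0 r) (circleMap_mem_unit_ball r)

theorem hardyENorm_add_le {f g : ℂ → E} (hf : ContinuousOn f (ball 0 1))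
    (hg : ContinuousOn g (ball 0 1)) :
    hardyENorm (f + g) ≤ hardyENorm f + hardyENorm g := by
  refine iSup_le fun r => ?_
  refine (eLpNorm_add_le (continuous_comp_circleMap hf r).aestronglyMeasurable
    (continuous_comp_circleMap hg r).aestronglyMeasurable (by norm_num)).trans ?_
  exact add_le_add (le_iSup (fun r : Ioo (0 : ℝ) 1 =>
      eLpNorm (fun θ : ℝ => f (circleMap 0 r θ)) 2 circleMeasure) r)
    (le_iSup (fun r : Ioo (0 : ℝ) 1 =>
      eLpNorm (fun θ : ℝ => g (circleMap 0 r θ)) 2 circleMeasure) r)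

theorem hardyENorm_smul [NormedSpace ℂ E] (c : ℂ) (f : ℂ → E) :
    hardyENorm (c • f) = ‖c‖ₑ * hardyENorm f := by
  unfold hardyENorm
  rw [ENNReal.mul_iSup]
  refine iSup_congr fun r => ?_
  exact eLpNorm_const_smul c (fun θ : ℝ => f (circleMap 0 r θ)) 2 circleMeasure

theorem hardyENorm_zero : hardyENorm (0 : ℂ → E) = 0 := by
  simp [hardyENorm]

theorem eqOn_zero_of_hardyENorm_eq_zero {f : ℂ → E} (hf : ContinuousOn f (ball 0 1))
    (h : hardyENorm f = 0) : ∀ z ∈ ball (0 : ℂ) 1, f z = 0 := by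
  have key : ∀ z ∈ ball (0 : ℂ) 1, z ≠ 0 → f z = 0 := by
    intro z hz hz0
    have hr : ‖z‖ ∈ Ioo (0 : ℝ) 1 := ⟨norm_pos_iff.2 hz0, by simpa using hz⟩
    have hc := continuous_comp_circleMap hf ⟨‖z‖, hr⟩
    have h1 : eLpNorm (fun θ : ℝ => f (circleMap 0 ‖z‖ θ)) 2 circleMeasure = 0 :=
      ENNReal.iSup_eq_zero.1 h ⟨‖z‖, hr⟩
    rw [eLpNorm_eq_zero_iff hc.aestronglyMeasurable (by norm_num)] at h1
    have hpi : 0 < (2 * π)⁻¹ := by positivity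
    have hne : ENNReal.ofReal (2 * π)⁻¹ ≠ 0 := by simpa using hpi
    have h2 : (fun θ : ℝ => f (circleMap 0 ‖z‖ θ)) =ᵐ[volume.restrict (Ioc 0 (2 * π))]
        (fun _ => 0) := by
      have := h1
      unfold circleMeasure at this
      exact (Measure.ae_ennreal_smul_measure_iff hne).1 this
    have h3 : EqOn (fun θ : ℝ => f (circleMap 0 ‖z‖ θ)) (fun _ => 0) (Icc 0 (2 * π)) := by
      refine Measure.eqOn_Icc_of_ae_eq volume (by positivity) ?_ hc.continuousOn
        continuousOn_const
      rwa [← restrict_Ioc_eq_restrict_Icc]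
    obtain ⟨θ, hθ, hθz⟩ : z ∈ circleMap 0 ‖z‖ '' Ioc 0 (2 * π) := by
      rw [image_circleMap_Ioc]
      simp
    have := h3 (Ioc_subset_Icc_self hθ)
    simpa [hθz] using this
  intro z hz
  by_cases hz0 : z = 0
  · subst hz0
    have hcont : ContinuousAt f 0 := hf.continuousAt (ball_mem_nhds 0 one_pos)
    have ht : Filter.Tendsto f (nhdsWithin 0 {0}ᶜ) (nhds (f 0)) :=
      hcont.tendsto.mono_left nhdsWithin_le_nhds
    refine tendsto_nhds_unique ht (tendsto_const_nhds.congr' ?_)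
    filter_upwards [self_mem_nhdsWithin,
      mem_nhdsWithin_of_mem_nhds (ball_mem_nhds (0 : ℂ) one_pos)] with w hw hw1
    exact (key w hw1 hw).symm
  · exact key z hz hz0

end Hardy

/-- The functions of the Hardy space `H²(E)`: analytic in the unit disc with finite Hardy
norm. A function on the disc is represented by its extension by zero to `ℂ`. -/
def hardySubmodule (E : Type*) [NormedAddCommGroup E] [NormedSpace ℂ E] :
    Submodule ℂ (ℂ → E) where
  carrier := {f | DifferentiableOn ℂ f (ball 0 1) ∧ (∀ z ∉ ball (0 : ℂ) 1, f z = 0) ∧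
    hardyENorm f < ∞}
  add_mem' := by
    rintro f g ⟨hf, hf0, hfn⟩ ⟨hg, hg0, hgn⟩
    refine ⟨hf.add hg, fun z hz => by simp [hf0 z hz, hg0 z hz], ?_⟩
    exact (hardyENorm_add_le hf.continuousOn hg.continuousOn).trans_lt
      (ENNReal.add_lt_top.2 ⟨hfn, hgn⟩)
  zero_mem' := ⟨differentiableOn_const 0, fun _ _ => rfl, by simp [hardyENorm_zero]⟩
  smul_mem' := by
    rintro c f ⟨hf, hf0, hfn⟩
    refine ⟨hf.const_smul c, fun z hz => by simp [hf0 z hz], ?_⟩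
    rw [hardyENorm_smul]
    exact ENNReal.mul_lt_top enorm_lt_top hfn

/-- The Hardy space `H²(E)`. -/
def HardySpace (E : Type*) [NormedAddCommGroup E] [NormedSpace ℂ E] : Type _ :=
  hardySubmodule E

namespace HardySpace

variable {E : Type*} [NormedAddCommGroup E] [NormedSpace ℂ E]

instance : AddCommGroup (HardySpace E) := inferInstanceAs (AddCommGroup (hardySubmodule E))

instance : Module ℂ (HardySpace E) := inferInstanceAs (Module ℂ (hardySubmodule E))

instance : CoeFun (HardySpace E) (fun _ => ℂ → E) := ⟨fun f => f.1⟩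

instance : Norm (HardySpace E) := ⟨fun f => (hardyENorm (f : ℂ → E)).toReal⟩

theorem norm_core : NormedSpace.Core ℂ (HardySpace E) where
  norm_nonneg _ := ENNReal.toReal_nonneg
  norm_smul c f := by
    change (hardyENorm (c • f.1)).toReal = ‖c‖ * (hardyENorm f.1).toReal
    rw [hardyENorm_smul, ENNReal.toReal_mul, toReal_enorm]
  norm_triangle f g := by
    change (hardyENorm (f.1 + g.1)).toReal ≤ (hardyENorm f.1).toReal + (hardyENorm g.1).toReal
    rw [← ENNReal.toReal_add f.2.2.2.ne g.2.2.2.ne]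
    exact ENNReal.toReal_mono (ENNReal.add_lt_top.2 ⟨f.2.2.2, g.2.2.2⟩).ne
      (hardyENorm_add_le f.2.1.continuousOn g.2.1.continuousOn)
  norm_eq_zero_iff f := by
    constructor
    · intro h
      have h0 : hardyENorm f.1 = 0 :=
        ((ENNReal.toReal_eq_zero_iff _).1 h).resolve_right f.2.2.2.ne
      refine Subtype.ext (funext fun z => ?_)
      by_cases hz : z ∈ ball (0 : ℂ) 1
      · exact eqOn_zero_of_hardyENorm_eq_zero f.2.1.continuousOn h0 z hz
      · exact f.2.2.1 z hz
    · rintro rfl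
      change (hardyENorm (0 : ℂ → E)).toReal = 0
      simp [hardyENorm_zero]

instance : NormedAddCommGroup (HardySpace E) := NormedAddCommGroup.ofCore norm_core

instance : NormedSpace ℂ (HardySpace E) := NormedSpace.ofCore norm_core

/-- Membership in `𝒪(E)`: there is an analytic extension to a larger disc about the origin.
Every function with such an extension belongs to `H²(E)`. -/
def ExtendsAnalytically (f : HardySpace E) : Prop :=
  ∃ R > (1 : ℝ), ∃ g : ℂ → E, DifferentiableOn ℂ g (ball 0 R) ∧ EqOn f g (ball 0 1)

end HardySpace

section Operators

variable {E : Type*} [NormedAddCommGroup E] [NormedSpace ℂ E]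

/-- The `n`th Taylor coefficient of `f` at the origin. -/
def taylorCoeff (f : ℂ → E) (n : ℕ) : E :=
  ((n.factorial : ℂ)⁻¹) • iteratedDeriv n f 0

/-- Fractional differentiation: `D^α f(z) = ∑ (1 + n)^α f̂(n) zⁿ`. -/
def fracDiff (α : ℝ) (f : ℂ → E) (z : ℂ) : E :=
  ∑' n : ℕ, ((((1 + n : ℝ) ^ α : ℝ) : ℂ) * z ^ n) • taylorCoeff f n

/-- The Hankel operator with `E`-valued symbol `φ`, acting on scalar functions:
`Γ_φ f(z) = ∑ₙ (∑ₘ f̂(m) φ̂(m + n)) zⁿ`. -/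
def hankel (φ : ℂ → E) (f : ℂ → ℂ) (z : ℂ) : E :=
  ∑' n : ℕ, z ^ n • ∑' m : ℕ, taylorCoeff f m • taylorCoeff φ (m + n)

/-- `T : H² → H²(E)` is a bounded linear extension of `D^α Γ_φ`, initially defined on `𝒪`. -/
def ExtendsFracHankel (α : ℝ) (φ : ℂ → E) (T : HardySpace ℂ →L[ℂ] HardySpace E) : Prop :=
  ∀ f : HardySpace ℂ, f.ExtendsAnalytically →
    EqOn (T f) (fracDiff α (hankel φ f)) (ball 0 1)

/-- The supremum over `H²`-normalized `f ∈ 𝒪` of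
`∫_𝔻 |f(z)|² ‖D^{1+α} φ(z)‖² (1 - |z|²) dA(z)`, with `dA` the area measure. -/
def carlesonSup (α : ℝ) (φ : ℂ → E) : ℝ≥0∞ :=
  ⨆ f ∈ {f : HardySpace ℂ | f.ExtendsAnalytically ∧ ‖f‖ = 1},
    ∫⁻ z in ball (0 : ℂ) 1,
      ENNReal.ofReal (‖f z‖ ^ 2 * ‖fracDiff (1 + α) φ z‖ ^ 2 * (1 - ‖z‖ ^ 2))

end Operators

end

open MeasureTheory Metric Set
open scoped ENNReal Real

/-! The proof compares two quadratic expressions in a scalar function `g` and shows that they differ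
only by an error controlled by a Bloch-type norm of the symbol. Write `G = D^{1+α}φ` and let `f`
have the conjugate Taylor coefficients of `g`, so that `f(w̄)` is the conjugate of `g(w)`. In the
coordinates `w = e^{-y/2 + iψ}`, orthogonality on circles and the Gamma integral give
(`integral_representation`) `Γ(1+α) D^{1+α}Γ_φ f(z) = ∫ y^α e^{-y} ∫ f(w̄) K(z w̄) G(w) dm(ψ) dy`,
with `K(x) = ∑ (1+n)^{1+α} xⁿ`. For a constant `f` the left side is that constant times `Γ(1+α)
G(z)`. Subtracting the formula for `f` from the one for the constant `conj g(z)` writes `conj g(z)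
G(z) - D^{1+α}Γ_φ f(z)` as an integral of `conj (g(z) - g(w)) K(z w̄) G(w)`.

If `‖G(w)‖ (1 - |w|²) ≤ B`, the bound `|K(x)| ≤ C |1 - x|^{-(2+α)}` (`norm_fracKernel_le`) dominates
the error by `B` times an average of `|g(z) - g(w)|` against a positive kernel. Cauchy-Schwarz
reduces its norm in `L²((1-|z|²) dA)` to a double integral of `|g(z) - g(w)|²`. The kernel is
invariant under simultaneous rotation, so Parseval reduces that to monomials `g = zⁿ`, where a bound
uniform in `n` is needed (`lintegral_monomial_le`). The outcome is an error of size at most `C B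
‖g‖` (`lintegral_conj_smul_sub_le`).

The two main terms are the right ones. The norm of `g G` in `L²((1-|z|²) dA)` is the Carleson
integral. That of `D^{1+α}Γ_φ f` is comparable with the Hardy norm of `D^αΓ_φ f`, because the
monomial weights `π/((n+1)(n+2))` nearly cancel `(1+n)²`.

Finally, each side of the equivalence controls `B` by testing on Szegő kernels: the operator through
summation by parts (`norm_powerSum_mul_le_of_hankel`), the Carleson condition through point
evaluation (`norm_mul_le_of_carleson`). All constants depend on `α` alone. -/

noncomputable section

/-! ### Power series with coefficients in a normed space -/

section PowerSeries

variable {E : Type*} [NormedAddCommGroup E]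

/-- The power series `∑ bₙ zⁿ` converges absolutely in the disc of radius `R`. -/
def DiscSummable (R : ℝ) (b : ℕ → E) : Prop :=
  ∀ r : ℝ, 0 ≤ r → r < R → Summable fun n => r ^ n * ‖b n‖

theorem DiscSummable.mono {R R' : ℝ} {b : ℕ → E} (h : DiscSummable R b) (hR : R' ≤ R) :
    DiscSummable R' b := fun r h0 h1 => h r h0 (h1.trans_le hR)

theorem DiscSummable.of_norm_le {F : Type*} [NormedAddCommGroup F] {R : ℝ} {b : ℕ → E}
    {c : ℕ → F} (h : DiscSummable R b) (C : ℝ) (hc : ∀ n, ‖c n‖ ≤ C * ‖b n‖) :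
    DiscSummable R c := fun r h0 h1 =>
  Summable.of_nonneg_of_le (fun n => by positivity)
    (fun n => (mul_le_mul_of_nonneg_left (hc n) (by positivity)).trans_eq (by ring))
    ((h r h0 h1).mul_left C)

theorem DiscSummable.of_bounded {R : ℝ} {b : ℕ → E}
    (h : ∀ r : ℝ, 0 < r → r < R → ∃ C, ∀ n, r ^ n * ‖b n‖ ≤ C) : DiscSummable R b := by
  intro r h0 h1
  obtain ⟨s, hs, hs1⟩ := exists_between h1
  have hs0 : 0 < s := h0.trans_lt hs
  obtain ⟨C, hC⟩ := h s hs0 hs1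
  refine Summable.of_nonneg_of_le (fun n => by positivity) (fun n => ?_)
    ((summable_geometric_of_lt_one (r := r / s) (by positivity)
      ((div_lt_one hs0).2 hs)).mul_right C)
  calc r ^ n * ‖b n‖ = (r / s) ^ n * (s ^ n * ‖b n‖) := by
        rw [div_pow]; field_simp
    _ ≤ _ := mul_le_mul_of_nonneg_left (hC n) (by positivity)

theorem DiscSummable.exists_bound {R : ℝ} {b : ℕ → E} (h : DiscSummable R b) {r : ℝ}
    (h0 : 0 ≤ r) (h1 : r < R) : ∃ C, 0 ≤ C ∧ ∀ n, r ^ n * ‖b n‖ ≤ C :=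
  ⟨∑' n, r ^ n * ‖b n‖, tsum_nonneg fun n => by positivity,
    fun n => (h r h0 h1).le_tsum n fun _ _ => by positivity⟩

theorem exists_polynomial_geometric_bound (β : ℝ) {q : ℝ} (h0 : 0 ≤ q) (h1 : q < 1) :
    ∃ C : ℝ, 0 ≤ C ∧ ∀ n : ℕ, (1 + n : ℝ) ^ β * q ^ n ≤ C := by
  obtain ⟨N, hN⟩ := exists_nat_ge β
  have hs := (summable_nat_add_iff 1).2
    (summable_pow_mul_geometric_of_norm_lt_one (R := ℝ) N (r := q)
      (by rwa [Real.norm_of_nonneg h0]))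
  rcases h0.eq_or_lt with rfl | hq
  · refine ⟨1, zero_le_one, fun n => ?_⟩
    rcases n with _ | n <;> simp
  -- The known summability concerns `n^N qⁿ`; shifting the index by one turns `n` into `1 + n` and
  -- costs the factor `1/q`, hence the separate case `q = 0`.
  refine ⟨(∑' n : ℕ, ((n + 1 : ℕ) : ℝ) ^ N * q ^ (n + 1)) / q,
    div_nonneg (tsum_nonneg fun n => by positivity) h0, fun n => ?_⟩
  rw [le_div_iff₀ hq]
  have h2 := hs.le_tsum n fun _ _ => by positivity
  refine le_trans ?_ h2
  rw [mul_assoc, ← pow_succ]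
  gcongr
  rw [← Real.rpow_natCast, Nat.cast_add, Nat.cast_one, add_comm (n : ℝ)]
  exact Real.rpow_le_rpow_of_exponent_le (by linarith [n.cast_nonneg (α := ℝ)]) hN

/-- Joint absolute convergence of the series defining a Hankel operator. -/
theorem summable_hankel {a : ℕ → E} (ha : DiscSummable 1 a) {R : ℝ} (hR : 1 < R) {f : ℕ → ℂ}
    (hf : DiscSummable R f) {r : ℝ} (h0 : 0 ≤ r) (h1 : r < 1) :
    Summable fun p : ℕ × ℕ => r ^ p.1 * (‖f p.2‖ * ‖a (p.2 + p.1)‖) := by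
  -- Choose `s < 1` with `r < s` and `s⁻¹ < R`: the symbol's coefficients are `O(s^{-(m+n)})`, the
  -- loss `s^{-m}` is absorbed by `f` and the loss `s^{-n}` by `rⁿ`.
  obtain ⟨S, hS, hS1⟩ := exists_between hR
  have hS0 : 0 < S := one_pos.trans hS
  obtain ⟨s, hs, hs1⟩ := exists_between (max_lt h1 (inv_lt_one_of_one_lt₀ hS))
  have hrs : r < s := (le_max_left _ _).trans_lt hs
  have hSs : S⁻¹ < s := (le_max_right _ _).trans_lt hs
  have hs0 : 0 < s := h0.trans_lt hrs
  obtain ⟨C, hC0, hC⟩ := ha.exists_bound hs0.le hs1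
  have hsS' : s⁻¹ < R := (inv_lt_of_inv_lt₀ hS0 hSs).trans hS1
  have hmain := Summable.mul_of_nonneg (summable_geometric_of_lt_one (r := r / s) (by positivity)
      ((div_lt_one hs0).2 hrs)) (hf s⁻¹ (by positivity) hsS') (fun n => by positivity)
      fun n => by positivity
  refine Summable.of_nonneg_of_le (fun p => by positivity) (fun p => ?_) (hmain.mul_right C)
  obtain ⟨n, m⟩ := p
  dsimp only
  calc r ^ n * (‖f m‖ * ‖a (m + n)‖)
      = (r / s) ^ n * (s⁻¹ ^ m * ‖f m‖) * (s ^ (m + n) * ‖a (m + n)‖) := by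
        rw [div_pow, inv_pow, pow_add]; field_simp
    _ ≤ _ := by gcongr; exact hC _

variable [NormedSpace ℂ E]

theorem norm_ofReal_rpow_smul (β : ℝ) (n : ℕ) (x : E) :
    ‖(((1 + n : ℝ) ^ β : ℝ) : ℂ) • x‖ = (1 + n : ℝ) ^ β * ‖x‖ := by
  rw [norm_smul, Complex.norm_real, Real.norm_of_nonneg (by positivity)]

theorem DiscSummable.rpow_smul {R : ℝ} {b : ℕ → E} (h : DiscSummable R b) (β : ℝ) :
    DiscSummable R fun n => (((1 + n : ℝ) ^ β : ℝ) : ℂ) • b n := by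
  refine DiscSummable.of_bounded fun r h0 h1 => ?_
  obtain ⟨s, hs, hs1⟩ := exists_between h1
  have hs0 : 0 < s := h0.trans hs
  obtain ⟨C, hC0, hC⟩ := h.exists_bound hs0.le hs1
  obtain ⟨D, hD0, hD⟩ := exists_polynomial_geometric_bound β (q := r / s) (by positivity)
    ((div_lt_one hs0).2 hs)
  refine ⟨D * C, fun n => ?_⟩
  rw [norm_ofReal_rpow_smul]
  calc r ^ n * ((1 + n : ℝ) ^ β * ‖b n‖)
      = ((1 + n : ℝ) ^ β * (r / s) ^ n) * (s ^ n * ‖b n‖) := by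
        rw [div_pow]; field_simp
    _ ≤ D * C := mul_le_mul (hD n) (hC n) (by positivity) hD0

/-- The sum of the power series `∑ bₙ zⁿ`. -/
def powerSum (b : ℕ → E) (z : ℂ) : E := ∑' n, z ^ n • b n

theorem DiscSummable.summable_norm {R : ℝ} {b : ℕ → E} (h : DiscSummable R b) {z : ℂ}
    (hz : ‖z‖ < R) : Summable fun n => ‖z ^ n • b n‖ := by
  simpa [norm_smul] using h ‖z‖ (norm_nonneg z) hz

theorem fracDiff_eq_powerSum (α : ℝ) (f : ℂ → E) :
    fracDiff α f = powerSum fun n => (((1 + n : ℝ) ^ α : ℝ) : ℂ) • taylorCoeff f n := by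
  funext z
  refine tsum_congr fun n => ?_
  rw [smul_smul, mul_comm]

/-- The `n`th Taylor coefficient of the Hankel operator with symbol `∑ aₖ zᵏ` applied
to `∑ fₘ zᵐ`. -/
def hankelCoeff (a : ℕ → E) (f : ℕ → ℂ) (n : ℕ) : E := ∑' m, f m • a (m + n)

theorem hankel_eq_powerSum (φ : ℂ → E) (f : ℂ → ℂ) :
    hankel φ f = powerSum (hankelCoeff (taylorCoeff φ) (taylorCoeff f)) := rfl

variable [CompleteSpace E]

theorem DiscSummable.hasSum {R : ℝ} {b : ℕ → E} (h : DiscSummable R b) {z : ℂ}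
    (hz : ‖z‖ < R) : HasSum (fun n => z ^ n • b n) (powerSum b z) :=
  (h.summable_norm hz).of_norm.hasSum

theorem DiscSummable.differentiableOn {R : ℝ} {b : ℕ → E} (h : DiscSummable R b) :
    DifferentiableOn ℂ (powerSum b) (ball 0 R) := by
  intro z hz
  rw [mem_ball_zero_iff] at hz
  obtain ⟨s, hs, hs1⟩ := exists_between hz
  have hs0 : 0 ≤ s := (norm_nonneg z).trans hs.le
  have : DifferentiableOn ℂ (fun w : ℂ => ∑' n : ℕ, w ^ n • b n) (ball 0 s) := by
    refine Complex.differentiableOn_tsum_of_summable_norm (h s hs0 hs1) (fun n => ?_) isOpen_ball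
      fun n w hw => ?_
    · exact ((differentiable_id.pow n).smul_const (b n)).differentiableOn
    · rw [norm_smul, norm_pow]
      rw [mem_ball_zero_iff] at hw
      gcongr
  exact (this.differentiableAt (isOpen_ball.mem_nhds (by simpa using hs))).differentiableWithinAt

theorem hasSum_taylorCoeff {R : ℝ} {f : ℂ → E} (hf : DifferentiableOn ℂ f (ball 0 R)) {z : ℂ}
    (hz : z ∈ ball (0 : ℂ) R) : HasSum (fun n => z ^ n • taylorCoeff f n) (f z) := by
  have := Complex.hasSum_taylorSeries_on_ball hf hz
  simp only [sub_zero] at this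
  refine this.congr_fun fun n => ?_
  rw [taylorCoeff, smul_comm]

theorem discSummable_taylorCoeff {R : ℝ} {f : ℂ → E} (hf : DifferentiableOn ℂ f (ball 0 R)) :
    DiscSummable R (taylorCoeff f) := by
  refine DiscSummable.of_bounded fun r h0 h1 => ?_
  have h := (hasSum_taylorCoeff hf (z := (r : ℂ)) (by simpa [abs_of_pos h0])).summable
  obtain ⟨C, hC⟩ := h.tendsto_atTop_zero.norm.bddAbove_range
  refine ⟨C, fun n => ?_⟩
  have := hC ⟨n, rfl⟩
  simpa [norm_smul, abs_of_pos h0] using this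

theorem eqOn_powerSum_taylorCoeff {R : ℝ} {f : ℂ → E} (hf : DifferentiableOn ℂ f (ball 0 R)) :
    EqOn f (powerSum (taylorCoeff f)) (ball 0 R) :=
  fun _ hz => (hasSum_taylorCoeff hf hz).tsum_eq.symm

/-- Uniqueness of power series. It is the passage from functions to coefficient sequences, on which
almost all later identities are proved. -/
theorem taylorCoeff_eq_of_eqOn {R : ℝ} (hR : 0 < R) {f : ℂ → E} {b : ℕ → E}
    (hb : DiscSummable R b) (hf : EqOn f (powerSum b) (ball 0 R)) : taylorCoeff f = b := by
  have hd : DifferentiableOn ℂ f (ball 0 R) := hb.differentiableOn.congr hf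
  let p (c : ℕ → E) : FormalMultilinearSeries ℂ ℂ E :=
    fun n => ContinuousMultilinearMap.mkPiRing ℂ (Fin n) (c n)
  have hp (c : ℕ → E) (n : ℕ) : (p c).coeff n = c n := by
    simp [p, FormalMultilinearSeries.coeff]
  have key (c : ℕ → E) (hc : ∀ z ∈ ball (0 : ℂ) R, HasSum (fun n => z ^ n • c n) (f z)) :
      HasFPowerSeriesAt f (p c) 0 := by
    rw [hasFPowerSeriesAt_iff]
    filter_upwards [ball_mem_nhds (0 : ℂ) hR] with z hz
    simpa [hp] using hc z hz
  have h := (key (taylorCoeff f) fun z hz => hasSum_taylorCoeff hd hz).eq_formalMultilinearSeries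
    (key b fun z hz => by
      rw [hf hz]; exact hb.hasSum (by simpa using hz))
  funext n
  rw [← hp (taylorCoeff f) n, h, hp]

theorem taylorCoeff_powerSum {R : ℝ} (hR : 0 < R) {b : ℕ → E} (hb : DiscSummable R b) :
    taylorCoeff (powerSum b) = b := taylorCoeff_eq_of_eqOn hR hb fun _ _ => rfl

theorem taylorCoeff_congr {f g : ℂ → E} (hg : DifferentiableOn ℂ g (ball 0 1))
    (h : EqOn f g (ball 0 1)) : taylorCoeff f = taylorCoeff g :=
  taylorCoeff_eq_of_eqOn one_pos (discSummable_taylorCoeff hg)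
    (h.trans (eqOn_powerSum_taylorCoeff hg))

theorem HardySpace.ExtendsAnalytically.exists_discSummable {f : HardySpace E}
    (h : f.ExtendsAnalytically) : ∃ R > (1 : ℝ), DiscSummable R (taylorCoeff f) := by
  obtain ⟨R, hR, g, hg, hfg⟩ := h
  refine ⟨R, hR, ?_⟩
  rw [taylorCoeff_congr (hg.mono (ball_subset_ball hR.le)) hfg]
  exact discSummable_taylorCoeff hg

end PowerSeries

/-! ### Fourier analysis on the circle: rotations, orthogonality, Parseval -/

section Circle

instance isProbabilityMeasure_circleMeasure : IsProbabilityMeasure circleMeasure := by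
  constructor
  rw [circleMeasure, Measure.smul_apply, Measure.restrict_apply_univ, Real.volume_Ioc, sub_zero,
    smul_eq_mul, ← ENNReal.ofReal_mul (by positivity),
    inv_mul_cancel₀ (by positivity), ENNReal.ofReal_one]

theorem lintegral_circleMeasure_eq (F : ℝ → ℝ≥0∞) :
    ∫⁻ θ, F θ ∂circleMeasure = ENNReal.ofReal (2 * π)⁻¹ * ∫⁻ θ in Ioc 0 (2 * π), F θ := by
  rw [circleMeasure, lintegral_smul_measure, smul_eq_mul]

/-- Any two half-open intervals of length `2π` are fundamental domains for the same group of
translations. -/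
theorem setLIntegral_Ioc_eq_of_periodic {F : ℝ → ℝ≥0∞} (hF : Function.Periodic F (2 * π))
    (a b : ℝ) : ∫⁻ θ in Ioc a (a + 2 * π), F θ = ∫⁻ θ in Ioc b (b + 2 * π), F θ := by
  have : VAddInvariantMeasure (AddSubgroup.zmultiples (2 * π)) ℝ volume :=
    ⟨fun c s _ => measure_preimage_add _ _ _⟩
  refine IsAddFundamentalDomain.setLIntegral_eq (G := AddSubgroup.zmultiples (2 * π))
    (isAddFundamentalDomain_Ioc Real.two_pi_pos a) (isAddFundamentalDomain_Ioc Real.two_pi_pos b)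
    F fun g x => hF.map_vadd_zmultiples g x

theorem lintegral_circleMeasure_add_right {F : ℝ → ℝ≥0∞} (hF : Function.Periodic F (2 * π))
    (τ : ℝ) : ∫⁻ θ, F (θ + τ) ∂circleMeasure = ∫⁻ θ, F θ ∂circleMeasure := by
  rw [lintegral_circleMeasure_eq, lintegral_circleMeasure_eq]
  congr 1
  have h1 := setLIntegral_Ioc_eq_of_periodic hF τ 0
  rw [zero_add] at h1
  rw [← h1, ← lintegral_indicator measurableSet_Ioc, ← lintegral_indicator measurableSet_Ioc,
    ← lintegral_add_right_eq_self ((Ioc τ (τ + 2 * π)).indicator F) τ]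
  refine lintegral_congr fun θ => ?_
  by_cases h : θ ∈ Ioc 0 (2 * π)
  · rw [indicator_of_mem h, indicator_of_mem (by constructor <;> linarith [h.1, h.2])]
  · rw [indicator_of_notMem h, indicator_of_notMem]
    exact fun h' => h ⟨by linarith [h'.1], by linarith [h'.2]⟩

theorem lintegral_circleMeasure_eq_Ioo {F : ℝ → ℝ≥0∞} (hF : Function.Periodic F (2 * π)) :
    ∫⁻ θ in Ioo (-π) π, F θ = ENNReal.ofReal (2 * π) * ∫⁻ θ, F θ ∂circleMeasure := by
  rw [lintegral_circleMeasure_eq, ← mul_assoc, ← ENNReal.ofReal_mul (by positivity),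
    mul_inv_cancel₀ (by positivity), ENNReal.ofReal_one, one_mul, setLIntegral_congr Ioo_ae_eq_Ioc]
  have := setLIntegral_Ioc_eq_of_periodic hF (-π) 0
  rwa [zero_add, show -π + 2 * π = π by ring] at this

theorem circleMap_zero_periodic (r : ℝ) : Function.Periodic (circleMap 0 r) (2 * π) :=
  periodic_circleMap 0 r

theorem integral_circleMap_pow_mul_conj_pow (j k : ℕ) :
    ∫ θ, (starRingEnd ℂ (circleMap 0 1 θ)) ^ j * circleMap 0 1 θ ^ k ∂circleMeasure =
      if j = k then 1 else 0 := by
  have h (θ : ℝ) : (starRingEnd ℂ (circleMap 0 1 θ)) ^ j * circleMap 0 1 θ ^ k =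
      Complex.exp ((((k : ℝ) - j : ℝ) : ℂ) * Complex.I * θ) := by
    simp only [circleMap, Complex.ofReal_one, one_mul, zero_add, ← Complex.exp_conj,
      ← Complex.exp_nat_mul, ← Complex.exp_add, map_mul, Complex.conj_ofReal, Complex.conj_I]
    congr 1
    push_cast
    ring
  simp_rw [h]
  split_ifs with hjk
  · subst hjk
    simp
  · rw [circleMeasure, integral_smul_measure, ← intervalIntegral.integral_of_le (by positivity),
      integral_exp_mul_complex]
    · have : Complex.exp ((((k : ℝ) - j : ℝ) : ℂ) * Complex.I * ((2 * π : ℝ) : ℂ)) = 1 := by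
        rw [Complex.exp_eq_one_iff]
        exact ⟨(k : ℤ) - j, by push_cast; ring⟩
      rw [this]
      simp
    · have : ((k : ℝ) - j) ≠ 0 := sub_ne_zero.2 (by exact_mod_cast Ne.symm hjk)
      exact mul_ne_zero (by exact_mod_cast this) Complex.I_ne_zero

theorem norm_circleMap_one (θ : ℝ) : ‖circleMap 0 1 θ‖ = 1 := by simp

/-- Angular averages pick out the diagonal of an absolutely convergent double series. -/
theorem integral_circleMeasure_double_series {E : Type*} [NormedAddCommGroup E] [NormedSpace ℂ E]
    [CompleteSpace E] {c : ℕ × ℕ → E} (hc : Summable fun p => ‖c p‖) :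
    ∫ θ, ∑' p : ℕ × ℕ, ((starRingEnd ℂ (circleMap 0 1 θ)) ^ p.1 * circleMap 0 1 θ ^ p.2) • c p
      ∂circleMeasure = ∑' k, c (k, k) := by
  have hcont (p : ℕ × ℕ) : Continuous fun θ =>
      ((starRingEnd ℂ (circleMap 0 1 θ)) ^ p.1 * circleMap 0 1 θ ^ p.2) • c p := by
    have := continuous_circleMap 0 1
    fun_prop
  have hnorm (p : ℕ × ℕ) (θ : ℝ) :
      ‖((starRingEnd ℂ (circleMap 0 1 θ)) ^ p.1 * circleMap 0 1 θ ^ p.2) • c p‖ = ‖c p‖ := by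
    rw [norm_smul, norm_mul, norm_pow, norm_pow, RCLike.norm_conj, norm_circleMap_one]
    simp
  have h := hasSum_integral_of_summable_integral_norm (μ := circleMeasure)
    (F := fun (p : ℕ × ℕ) θ =>
      ((starRingEnd ℂ (circleMap 0 1 θ)) ^ p.1 * circleMap 0 1 θ ^ p.2) • c p)
    (fun p => Integrable.of_bound (hcont p).aestronglyMeasurable ‖c p‖
      (Filter.Eventually.of_forall fun θ => (hnorm p θ).le))
    (by simpa [hnorm] using hc)
  rw [← h.tsum_eq]
  simp_rw [integral_smul_const, integral_circleMap_pow_mul_conj_pow]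
  -- The off-diagonal integrals vanish, so the double sum is supported on the image of the diagonal
  -- embedding.
  have hinj : Function.Injective fun k : ℕ => (k, k) := fun a b h => (Prod.mk.inj h).1
  rw [← hinj.tsum_eq]
  · simp
  · intro p hp
    rw [Function.mem_support] at hp
    refine ⟨p.1, ?_⟩
    by_contra hne
    apply hp
    rw [if_neg, zero_smul]
    intro h12
    exact hne (Prod.ext rfl h12)

theorem tsum_pow_circleMap {E : Type*} [NormedAddCommGroup E] [NormedSpace ℂ E]
    (b : ℕ → E) (r θ : ℝ) :
    powerSum b (circleMap 0 r θ) = ∑' n, circleMap 0 1 θ ^ n • ((r : ℂ) ^ n • b n) := by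
  refine tsum_congr fun n => ?_
  rw [smul_smul, ← mul_pow]
  congr 2
  simp [circleMap, mul_comm]

variable {H : Type*} [NormedAddCommGroup H] [InnerProductSpace ℂ H] [CompleteSpace H]

/-- Parseval's identity on the circle. -/
theorem lintegral_enorm_sq_circle_series {b : ℕ → H} (hb : Summable fun n => ‖b n‖) :
    ∫⁻ θ, ‖∑' n, circleMap 0 1 θ ^ n • b n‖ₑ ^ 2 ∂circleMeasure = ∑' n, ‖b n‖ₑ ^ 2 := by
  have hs (θ : ℝ) : Summable fun n => ‖circleMap 0 1 θ ^ n • b n‖ := by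
    simpa [norm_smul] using hb
  have hprod : Summable fun p : ℕ × ℕ => ‖(inner ℂ (b p.1) (b p.2) : ℂ)‖ :=
    Summable.of_nonneg_of_le (fun _ => norm_nonneg _) (fun p => norm_inner_le_norm _ _)
      (hb.mul_of_nonneg hb (fun _ => norm_nonneg _) fun _ => norm_nonneg _)
  have hinner (θ : ℝ) : ((‖∑' n, circleMap 0 1 θ ^ n • b n‖ ^ 2 : ℝ) : ℂ) =
      ∑' p : ℕ × ℕ, ((starRingEnd ℂ (circleMap 0 1 θ)) ^ p.1 * circleMap 0 1 θ ^ p.2) •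
        (inner ℂ (b p.1) (b p.2) : ℂ) := by
    have h1 : Summable fun p : ℕ × ℕ =>
        ((starRingEnd ℂ (circleMap 0 1 θ)) ^ p.1 * circleMap 0 1 θ ^ p.2) •
        (inner ℂ (b p.1) (b p.2) : ℂ) := by
      refine Summable.of_norm ?_
      simpa [norm_smul, RCLike.norm_conj] using hprod
    rw [h1.tsum_prod]
    have h2 : ((‖∑' n, circleMap 0 1 θ ^ n • b n‖ ^ 2 : ℝ) : ℂ) =
        inner ℂ (∑' n, circleMap 0 1 θ ^ n • b n) (∑' n, circleMap 0 1 θ ^ n • b n) := by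
      rw [inner_self_eq_norm_sq_to_K]; push_cast; rfl
    -- The inner product is expanded one slot at a time; conjugate symmetry moves the first slot
    -- into the linear one.
    rw [h2, ← inner_conj_symm, ← innerSL_apply_apply ℂ,
      ContinuousLinearMap.map_tsum _ (hs θ).of_norm,
      Complex.conj_tsum]
    refine tsum_congr fun j => ?_
    rw [innerSL_apply_apply, inner_conj_symm, ← innerSL_apply_apply ℂ,
      ContinuousLinearMap.map_tsum _ (hs θ).of_norm]
    refine tsum_congr fun k => ?_
    rw [innerSL_apply_apply, inner_smul_left, inner_smul_right, map_pow, smul_eq_mul]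
    ring
  have hcont : Continuous fun θ : ℝ => ∑' n, circleMap 0 1 θ ^ n • b n :=
    continuous_tsum (fun n => ((continuous_circleMap 0 1).pow n).smul continuous_const) hb
      fun n θ => by simp [norm_smul]
  have hint : Integrable (fun θ : ℝ => ‖∑' n, circleMap 0 1 θ ^ n • b n‖ ^ 2) circleMeasure := by
    refine Integrable.of_bound (hcont.norm.pow 2).aestronglyMeasurable ((∑' n, ‖b n‖) ^ 2)
      (Filter.Eventually.of_forall fun θ => ?_)
    rw [norm_pow, norm_norm]
    gcongr
    refine (norm_tsum_le_tsum_norm (hs θ)).trans_eq (tsum_congr fun n => ?_)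
    simp [norm_smul]
  have hmain : ((∫ θ, ‖∑' n, circleMap 0 1 θ ^ n • b n‖ ^ 2 ∂circleMeasure : ℝ) : ℂ) =
      ((∑' n, ‖b n‖ ^ 2 : ℝ) : ℂ) := by
    rw [← integral_complex_ofReal]
    simp_rw [hinner]
    rw [integral_circleMeasure_double_series hprod, Complex.ofReal_tsum]
    refine tsum_congr fun n => ?_
    rw [inner_self_eq_norm_sq_to_K]; push_cast; rfl
  have hmain' := Complex.ofReal_injective hmain
  have hsq : Summable fun n => ‖b n‖ ^ 2 := by
    have : Function.Injective fun k : ℕ => (k, k) := fun a b h => (Prod.mk.inj h).1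
    have h := hprod.comp_injective this
    refine h.congr fun n => ?_
    simp [inner_self_eq_norm_sq_to_K]
  have e1 (x : H) : ‖x‖ₑ ^ 2 = ENNReal.ofReal (‖x‖ ^ 2) := by
    rw [ENNReal.ofReal_pow (norm_nonneg _), ofReal_norm]
  simp_rw [e1]
  rw [← ofReal_integral_eq_lintegral_ofReal hint
    (Filter.Eventually.of_forall fun θ => by positivity), hmain',
    ENNReal.ofReal_tsum_of_nonneg (fun n => by positivity) hsq]

theorem lintegral_enorm_sq_powerSum_circleMap {b : ℕ → H} (hb : DiscSummable 1 b) {r : ℝ}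
    (h0 : 0 ≤ r) (h1 : r < 1) :
    ∫⁻ θ, ‖powerSum b (circleMap 0 r θ)‖ₑ ^ 2 ∂circleMeasure =
      ∑' n, ENNReal.ofReal (r ^ (2 * n)) * ‖b n‖ₑ ^ 2 := by
  simp_rw [tsum_pow_circleMap]
  rw [lintegral_enorm_sq_circle_series]
  · refine tsum_congr fun n => ?_
    rw [enorm_smul, mul_pow, enorm_pow, ← ofReal_norm (r : ℂ), Complex.norm_real,
      Real.norm_of_nonneg h0, ← ENNReal.ofReal_pow h0, ← ENNReal.ofReal_pow (by positivity),
      ← pow_mul, mul_comm n]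
  · simpa [norm_smul, abs_of_nonneg h0] using hb r h0 h1

/-- By Parseval the mean over radius `r` is `∑ r^{2n} ‖bₙ‖²`. It is at most the full sum, and its
finite parts converge to those of the full sum as `r → 1`. -/
theorem hardyENorm_sq_eq_tsum {f : ℂ → H} {b : ℕ → H} (hb : DiscSummable 1 b)
    (hf : EqOn f (powerSum b) (ball 0 1)) : hardyENorm f ^ 2 = ∑' n, ‖b n‖ₑ ^ 2 := by
  have h2 (r : Ioo (0 : ℝ) 1) :
      eLpNorm (fun θ : ℝ => f (circleMap 0 r θ)) 2 circleMeasure ^ 2 =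
        ∑' n, ENNReal.ofReal ((r : ℝ) ^ (2 * n)) * ‖b n‖ₑ ^ 2 := by
    rw [← lintegral_enorm_sq_powerSum_circleMap hb r.2.1.le r.2.2]
    have := eLpNorm_nnreal_pow_eq_lintegral (μ := circleMeasure) (p := 2)
      (f := fun θ : ℝ => f (circleMap 0 r θ)) (by norm_num)
    simp only [ENNReal.coe_ofNat, NNReal.coe_ofNat, ENNReal.rpow_ofNat] at this
    rw [this]
    exact lintegral_congr fun θ => by rw [hf (circleMap_mem_unit_ball r θ)]
  have h3 : hardyENorm f ^ 2 = ⨆ r : Ioo (0 : ℝ) 1,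
      eLpNorm (fun θ : ℝ => f (circleMap 0 r θ)) 2 circleMeasure ^ 2 := by
    rw [hardyENorm, ENNReal.iSup_pow_of_ne_zero two_ne_zero]
  rw [h3]
  simp_rw [h2]
  refine le_antisymm (iSup_le fun r => ENNReal.tsum_le_tsum fun n => ?_) ?_
  · refine mul_le_of_le_one_left' ?_
    rw [ENNReal.ofReal_le_one]
    exact pow_le_one₀ r.2.1.le r.2.2.le
  · rw [ENNReal.tsum_eq_iSup_sum]
    refine iSup_le fun s => ?_
    have ht : Filter.Tendsto
        (fun r : ℝ => ∑ n ∈ s, ENNReal.ofReal (r ^ (2 * n)) * ‖b n‖ₑ ^ 2)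
        (nhdsWithin 1 (Iio 1)) (nhds (∑ n ∈ s, ‖b n‖ₑ ^ 2)) := by
      refine tendsto_finsetSum _ fun n _ => ?_
      have h5 : Filter.Tendsto (fun r : ℝ => ENNReal.ofReal (r ^ (2 * n))) (nhdsWithin 1 (Iio 1))
          (nhds 1) := by
        have : Continuous fun r : ℝ => ENNReal.ofReal (r ^ (2 * n)) :=
          ENNReal.continuous_ofReal.comp (continuous_pow _)
        simpa using (this.tendsto 1).mono_left nhdsWithin_le_nhds
      simpa using ENNReal.Tendsto.mul_const h5 (Or.inl one_ne_zero)
    refine le_of_tendsto ht ?_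
    filter_upwards [Ioo_mem_nhdsLT (zero_lt_one (α := ℝ))] with r hr
    refine le_trans ?_ (le_iSup (fun r : Ioo (0 : ℝ) 1 =>
      ∑' n, ENNReal.ofReal ((r : ℝ) ^ (2 * n)) * ‖b n‖ₑ ^ 2) ⟨r, hr⟩)
    exact ENNReal.sum_le_tsum s

end Circle

/-! ### Linear operations on power series and the subspace `𝒪` -/

section PowerSeriesAlgebra

variable {E : Type*} [NormedAddCommGroup E]

theorem DiscSummable.add {R : ℝ} {b c : ℕ → E} (hb : DiscSummable R b) (hc : DiscSummable R c) :
    DiscSummable R (b + c) := fun r h0 h1 => by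
  refine Summable.of_nonneg_of_le (fun n => by positivity) (fun n => ?_)
    ((hb r h0 h1).add (hc r h0 h1))
  rw [← mul_add]
  exact mul_le_mul_of_nonneg_left (norm_add_le _ _) (by positivity)

theorem DiscSummable.of_summable_sq {b : ℕ → E} (hb : Summable fun n => ‖b n‖ ^ 2) :
    DiscSummable 1 b := by
  refine DiscSummable.of_bounded fun r h0 h1 => ⟨1 + ∑' n, ‖b n‖ ^ 2, fun n => ?_⟩
  have h2 := hb.le_tsum n fun _ _ => by positivity
  have h3 : r ^ n * ‖b n‖ ≤ ‖b n‖ :=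
    mul_le_of_le_one_left (norm_nonneg _) (pow_le_one₀ h0.le h1.le)
  nlinarith [sq_nonneg (‖b n‖ - 1)]

theorem DiscSummable.of_finite_support {b : ℕ → E} {N : ℕ} (hb : ∀ n, N < n → b n = 0) (R : ℝ) :
    DiscSummable R b := fun r _ _ => by
  refine summable_of_ne_finset_zero (s := Finset.range (N + 1)) fun n hn => ?_
  rw [hb n (by simpa using hn)]
  simp

variable [NormedSpace ℂ E]

theorem DiscSummable.const_smul {R : ℝ} {b : ℕ → E} (hb : DiscSummable R b) (c : ℂ) :
    DiscSummable R (c • b) :=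
  hb.of_norm_le ‖c‖ fun n => by simp [norm_smul]

theorem powerSum_smul (c : ℂ) (b : ℕ → E) (z : ℂ) :
    powerSum (c • b) z = c • powerSum b z := by
  rw [powerSum, powerSum, ← tsum_const_smul'']
  exact tsum_congr fun n => smul_comm _ _ _

variable [CompleteSpace E]

theorem powerSum_add {R : ℝ} {b c : ℕ → E} (hb : DiscSummable R b) (hc : DiscSummable R c)
    {z : ℂ} (hz : ‖z‖ < R) : powerSum (b + c) z = powerSum b z + powerSum c z := by
  rw [← ((hb.hasSum hz).add (hc.hasSum hz)).tsum_eq]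
  exact tsum_congr fun n => smul_add _ _ _

theorem taylorCoeff_add {f g : ℂ → E} (hf : DifferentiableOn ℂ f (ball 0 1))
    (hg : DifferentiableOn ℂ g (ball 0 1)) :
    taylorCoeff (f + g) = taylorCoeff f + taylorCoeff g := by
  refine taylorCoeff_eq_of_eqOn one_pos
    ((discSummable_taylorCoeff hf).add (discSummable_taylorCoeff hg)) fun z hz => ?_
  rw [powerSum_add (discSummable_taylorCoeff hf) (discSummable_taylorCoeff hg)
    (by simpa using hz), ← eqOn_powerSum_taylorCoeff hf hz, ← eqOn_powerSum_taylorCoeff hg hz]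
  rfl

theorem taylorCoeff_smul {f : ℂ → E} (hf : DifferentiableOn ℂ f (ball 0 1)) (c : ℂ) :
    taylorCoeff (c • f) = c • taylorCoeff f := by
  refine taylorCoeff_eq_of_eqOn one_pos ((discSummable_taylorCoeff hf).const_smul c)
    fun z hz => ?_
  rw [powerSum_smul, ← eqOn_powerSum_taylorCoeff hf hz]
  rfl

theorem hardySpace_extendsAnalytically_iff {f : HardySpace E} :
    f.ExtendsAnalytically ↔ ∃ R > (1 : ℝ), DiscSummable R (taylorCoeff f) := by
  refine ⟨fun h => h.exists_discSummable, fun ⟨R, hR, h⟩ => ⟨R, hR, _, h.differentiableOn, ?_⟩⟩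
  exact eqOn_powerSum_taylorCoeff f.2.1

/-- The submodule `𝒪` of functions that extend analytically across the circle. -/
def analyticSubmodule (E : Type*) [NormedAddCommGroup E] [NormedSpace ℂ E] [CompleteSpace E] :
    Submodule ℂ (HardySpace E) where
  carrier := {f | f.ExtendsAnalytically}
  add_mem' := by
    intro f g hf hg
    obtain ⟨R, hR, h⟩ := hardySpace_extendsAnalytically_iff.1 hf
    obtain ⟨R', hR', h'⟩ := hardySpace_extendsAnalytically_iff.1 hg
    refine hardySpace_extendsAnalytically_iff.2 ⟨min R R', lt_min hR hR', ?_⟩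
    change DiscSummable _ (taylorCoeff ((f : ℂ → E) + (g : ℂ → E)))
    rw [taylorCoeff_add f.2.1 g.2.1]
    exact (h.mono (min_le_left _ _)).add (h'.mono (min_le_right _ _))
  zero_mem' := ⟨2, by norm_num, 0, differentiableOn_const 0, fun _ _ => rfl⟩
  smul_mem' := by
    intro c f hf
    obtain ⟨R, hR, h⟩ := hardySpace_extendsAnalytically_iff.1 hf
    refine hardySpace_extendsAnalytically_iff.2 ⟨R, hR, ?_⟩
    change DiscSummable _ (taylorCoeff (c • (f : ℂ → E)))
    rw [taylorCoeff_smul f.2.1]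
    exact h.const_smul c

end PowerSeriesAlgebra

/-! ### `H²` as a space of square summable coefficients -/

section HardyCoefficients

theorem summable_sq_of_tsum_enorm_lt_top {E : Type*} [NormedAddCommGroup E]
    {b : ℕ → E} (h : ∑' n, ‖b n‖ₑ ^ 2 < ∞) :
    Summable fun n => ‖b n‖ ^ 2 := by
  have := ENNReal.summable_toReal h.ne
  simpa using this

theorem tsum_enorm_sq_eq {E : Type*} [NormedAddCommGroup E]
    {b : ℕ → E} (h : Summable fun n => ‖b n‖ ^ 2) :
    ∑' n, ‖b n‖ₑ ^ 2 = ENNReal.ofReal (∑' n, ‖b n‖ ^ 2) := by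
  rw [ENNReal.ofReal_tsum_of_nonneg (fun n => by positivity) h]
  exact tsum_congr fun n => by rw [ENNReal.ofReal_pow (norm_nonneg _), ofReal_norm]

theorem memlp_two_iff {E : Type*} [NormedAddCommGroup E]
    {b : ℕ → E} :
    Memℓp b 2 ↔ Summable fun n => ‖b n‖ ^ 2 := by
  rw [memℓp_gen_iff (by norm_num)]
  simp

variable {H : Type*} [NormedAddCommGroup H] [InnerProductSpace ℂ H] [CompleteSpace H]

theorem ofReal_norm_sq_hardySpace (f : HardySpace H) :
    ENNReal.ofReal (‖f‖ ^ 2) = ∑' n, ‖taylorCoeff f n‖ₑ ^ 2 := by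
  rw [← hardyENorm_sq_eq_tsum (discSummable_taylorCoeff f.2.1) (eqOn_powerSum_taylorCoeff f.2.1),
    ENNReal.ofReal_pow (norm_nonneg _)]
  congr 1
  exact ENNReal.ofReal_toReal f.2.2.2.ne

theorem summable_sq_taylorCoeff (f : HardySpace H) : Summable fun n => ‖taylorCoeff f n‖ ^ 2 :=
  summable_sq_of_tsum_enorm_lt_top (by
    rw [← ofReal_norm_sq_hardySpace]; exact ENNReal.ofReal_lt_top)

theorem norm_sq_hardySpace (f : HardySpace H) : ‖f‖ ^ 2 = ∑' n, ‖taylorCoeff f n‖ ^ 2 := by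
  have h := ofReal_norm_sq_hardySpace f
  rwa [tsum_enorm_sq_eq (summable_sq_taylorCoeff f), ENNReal.ofReal_eq_ofReal_iff (by positivity)
    (tsum_nonneg fun n => by positivity)] at h

/-- The function in `H²(H)` with prescribed square summable Taylor coefficients. -/
def hardyOfCoeff (b : ℕ → H) (hb : Summable fun n => ‖b n‖ ^ 2) : HardySpace H :=
  ⟨(ball (0 : ℂ) 1).indicator (powerSum b), by
    have hE : EqOn ((ball (0 : ℂ) 1).indicator (powerSum b)) (powerSum b) (ball 0 1) :=
      fun z hz => indicator_of_mem hz _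
    refine ⟨(DiscSummable.of_summable_sq hb).differentiableOn.congr hE,
      fun z hz => indicator_of_notMem hz _, ?_⟩
    have h := hardyENorm_sq_eq_tsum (DiscSummable.of_summable_sq hb) hE
    rw [tsum_enorm_sq_eq hb] at h
    by_contra htop
    rw [not_lt, top_le_iff] at htop
    rw [htop] at h
    simp at h⟩

theorem eqOn_hardyOfCoeff (b : ℕ → H) (hb : Summable fun n => ‖b n‖ ^ 2) :
    EqOn (hardyOfCoeff b hb) (powerSum b) (ball 0 1) := fun _ hz => indicator_of_mem hz _

theorem taylorCoeff_hardyOfCoeff (b : ℕ → H) (hb : Summable fun n => ‖b n‖ ^ 2) :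
    taylorCoeff (hardyOfCoeff b hb) = b :=
  taylorCoeff_eq_of_eqOn one_pos (DiscSummable.of_summable_sq hb) (eqOn_hardyOfCoeff b hb)

theorem hardySpace_ext {f g : HardySpace H} (h : taylorCoeff f = taylorCoeff g) : f = g := by
  refine Subtype.ext (funext fun z => ?_)
  by_cases hz : z ∈ ball (0 : ℂ) 1
  · rw [eqOn_powerSum_taylorCoeff f.2.1 hz, eqOn_powerSum_taylorCoeff g.2.1 hz, h]
  · rw [f.2.2.1 z hz, g.2.2.1 z hz]

/-- The isometric identification of `H²(H)` with `ℓ²(H)`. -/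
def hardyCoeffIsometry (H : Type*) [NormedAddCommGroup H] [InnerProductSpace ℂ H]
    [CompleteSpace H] : HardySpace H ≃ₗᵢ[ℂ] lp (fun _ : ℕ => H) 2 where
  toFun f := ⟨taylorCoeff f, memlp_two_iff.2 (summable_sq_taylorCoeff f)⟩
  map_add' f g := Subtype.ext (taylorCoeff_add f.2.1 g.2.1)
  map_smul' c f := Subtype.ext (taylorCoeff_smul f.2.1 c)
  invFun b := hardyOfCoeff b.1 (memlp_two_iff.1 b.2)
  left_inv f := hardySpace_ext (taylorCoeff_hardyOfCoeff _ _)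
  right_inv b := Subtype.ext (taylorCoeff_hardyOfCoeff _ _)
  norm_map' f := by
    refine (pow_left_inj₀ (norm_nonneg _) (norm_nonneg _) two_ne_zero).1 ?_
    rw [norm_sq_hardySpace]
    have := lp.norm_rpow_eq_tsum (p := 2) (E := fun _ : ℕ => H) (by norm_num)
      ⟨taylorCoeff f, memlp_two_iff.2 (summable_sq_taylorCoeff f)⟩
    simpa using this

/-- Needed for extending `D^α Γ_φ` by continuity from `𝒪` to `H²`. -/
instance completeSpace_hardySpace : CompleteSpace (HardySpace H) :=
  (hardyCoeffIsometry H).toIsometryEquiv.completeSpace_iff.2 inferInstance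

theorem taylorCoeff_hardyCoeffIsometry_symm (x : lp (fun _ : ℕ => H) 2) :
    taylorCoeff ((hardyCoeffIsometry H).symm x) = x :=
  taylorCoeff_hardyOfCoeff _ (memlp_two_iff.1 x.2)

theorem hardyCoeffIsometry_symm_single_mem (n : ℕ) (v : H) :
    (hardyCoeffIsometry H).symm (lp.single 2 n v) ∈ analyticSubmodule H := by
  refine hardySpace_extendsAnalytically_iff.2 ⟨2, by norm_num, ?_⟩
  rw [taylorCoeff_hardyCoeffIsometry_symm]
  refine DiscSummable.of_finite_support (N := n) (fun m hm => ?_) 2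
  rw [lp.single_apply_ne _ _ _ hm.ne']

/-- Finite sums of single-coefficient elements are polynomials, hence lie in `𝒪`, and they
approximate every element of `ℓ²`. -/
theorem denseRange_analyticSubmodule :
    DenseRange ((analyticSubmodule H).subtype : analyticSubmodule H → HardySpace H) := by
  intro f
  rw [Submodule.coe_subtype, Subtype.range_coe]
  have h := (lp.hasSum_single (by norm_num) (hardyCoeffIsometry H f)).map
    (hardyCoeffIsometry H).symm (hardyCoeffIsometry H).symm.continuous
  rw [LinearIsometryEquiv.symm_apply_apply] at h
  exact mem_closure_of_tendsto h (Filter.Eventually.of_forall fun s =>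
    Submodule.sum_mem _ fun n _ => hardyCoeffIsometry_symm_single_mem n _)

theorem norm_le_of_extendsAnalytically {F : Type*} [NormedAddCommGroup F] [NormedSpace ℂ F]
    {T : HardySpace ℂ →L[ℂ] F} {M : ℝ} (hM : 0 ≤ M)
    (h : ∀ f : HardySpace ℂ, f.ExtendsAnalytically → ‖T f‖ ≤ M * ‖f‖) : ‖T‖ ≤ M := by
  refine T.opNorm_le_bound hM fun f => ?_
  refine (denseRange_analyticSubmodule (H := ℂ)).induction_on
    (p := fun f => ‖T f‖ ≤ M * ‖f‖) f ?_ fun g => h g.1 g.2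
  exact isClosed_le (by fun_prop) (by fun_prop)

end HardyCoefficients

/-! ### The Hankel operator on coefficients and its bounded extension -/

section HankelOperator

theorem summable_hankel_fiber {E : Type*} [NormedAddCommGroup E]
    {a : ℕ → E} (ha : DiscSummable 1 a) {R : ℝ} (hR : 1 < R)
    {f : ℕ → ℂ} (hf : DiscSummable R f) (n : ℕ) : Summable fun m => ‖f m‖ * ‖a (m + n)‖ := by
  have h := (summable_hankel ha hR hf (r := 1 / 2) (by norm_num) (by norm_num)).prod_factor n
  have h2 : ((1 / 2 : ℝ)) ^ n ≠ 0 := by positivity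
  exact (summable_mul_left_iff h2).1 h

theorem hankelCoeff_smul {E : Type*} [NormedAddCommGroup E] [NormedSpace ℂ E]
    (a : ℕ → E) (c : ℂ) (f : ℕ → ℂ) (n : ℕ) :
    hankelCoeff a (c • f) n = c • hankelCoeff a f n := by
  rw [hankelCoeff, hankelCoeff, ← tsum_const_smul'']
  exact tsum_congr fun m => mul_smul _ _ _

variable {H : Type*} [NormedAddCommGroup H] [InnerProductSpace ℂ H] [CompleteSpace H]

theorem norm_hankelCoeff_le {E : Type*} [NormedAddCommGroup E] [NormedSpace ℂ E]
    {a : ℕ → E} (ha : DiscSummable 1 a) {R : ℝ} (hR : 1 < R)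
    {f : ℕ → ℂ} (hf : DiscSummable R f) (n : ℕ) :
    ‖hankelCoeff a f n‖ ≤ ∑' m, ‖f m‖ * ‖a (m + n)‖ := by
  have h := summable_hankel_fiber ha hR hf n
  simp_rw [← norm_smul] at h ⊢
  exact norm_tsum_le_tsum_norm h

theorem hasSum_hankelCoeff {a : ℕ → H} (ha : DiscSummable 1 a) {R : ℝ} (hR : 1 < R)
    {f : ℕ → ℂ} (hf : DiscSummable R f) (n : ℕ) :
    HasSum (fun m => f m • a (m + n)) (hankelCoeff a f n) := by
  have h := summable_hankel_fiber ha hR hf n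
  simp_rw [← norm_smul] at h
  exact h.of_norm.hasSum

theorem discSummable_hankelCoeff {E : Type*} [NormedAddCommGroup E] [NormedSpace ℂ E]
    {a : ℕ → E} (ha : DiscSummable 1 a) {R : ℝ} (hR : 1 < R)
    {f : ℕ → ℂ} (hf : DiscSummable R f) : DiscSummable 1 (hankelCoeff a f) := by
  intro r h0 h1
  refine Summable.of_nonneg_of_le (fun n => by positivity) (fun n => ?_)
    (summable_hankel ha hR hf h0 h1).prod
  dsimp only
  rw [tsum_mul_left]
  exact mul_le_mul_of_nonneg_left (norm_hankelCoeff_le ha hR hf n) (by positivity)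

theorem hankelCoeff_add {a : ℕ → H} (ha : DiscSummable 1 a) {R : ℝ} (hR : 1 < R)
    {f g : ℕ → ℂ} (hf : DiscSummable R f) (hg : DiscSummable R g) (n : ℕ) :
    hankelCoeff a (f + g) n = hankelCoeff a f n + hankelCoeff a g n := by
  rw [← ((hasSum_hankelCoeff ha hR hf n).add (hasSum_hankelCoeff ha hR hg n)).tsum_eq]
  exact tsum_congr fun m => add_smul _ _ _

/-- The Taylor coefficients of `D^α Γ_φ f`. -/
def fracHankelCoeff (α : ℝ) (a : ℕ → H) (f : ℕ → ℂ) (n : ℕ) : H :=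
  (((1 + n : ℝ) ^ α : ℝ) : ℂ) • hankelCoeff a f n

theorem fracDiff_hankel_eq (α : ℝ) {φ : ℂ → H} (hφ : DifferentiableOn ℂ φ (ball 0 1))
    {f : HardySpace ℂ} (hf : f.ExtendsAnalytically) :
    fracDiff α (hankel φ f) = powerSum (fracHankelCoeff α (taylorCoeff φ) (taylorCoeff f)) := by
  obtain ⟨R, hR, h⟩ := hf.exists_discSummable
  rw [fracDiff_eq_powerSum, hankel_eq_powerSum, taylorCoeff_powerSum one_pos
    (discSummable_hankelCoeff (discSummable_taylorCoeff hφ) hR h)]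
  rfl

theorem discSummable_fracHankelCoeff (α : ℝ) {a : ℕ → H} (ha : DiscSummable 1 a) {R : ℝ}
    (hR : 1 < R) {f : ℕ → ℂ} (hf : DiscSummable R f) :
    DiscSummable 1 (fracHankelCoeff α a f) :=
  (discSummable_hankelCoeff ha hR hf).rpow_smul α

/-- With this and the next result, boundedness of the operator becomes an estimate between sums of
squared coefficients for `f ∈ 𝒪`. -/
theorem ExtendsFracHankel.ofReal_norm_sq {α : ℝ} {φ : ℂ → H}
    (hφ : DifferentiableOn ℂ φ (ball 0 1)) {T : HardySpace ℂ →L[ℂ] HardySpace H}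
    (hT : ExtendsFracHankel α φ T) {f : HardySpace ℂ} (hf : f.ExtendsAnalytically) :
    ENNReal.ofReal (‖T f‖ ^ 2) =
      ∑' n, ‖fracHankelCoeff α (taylorCoeff φ) (taylorCoeff f) n‖ₑ ^ 2 := by
  obtain ⟨R, hR, h⟩ := hf.exists_discSummable
  rw [ofReal_norm_sq_hardySpace]
  have := taylorCoeff_eq_of_eqOn one_pos
    (discSummable_fracHankelCoeff α (discSummable_taylorCoeff hφ) hR h)
    ((hT f hf).trans (fracDiff_hankel_eq α hφ hf ▸ fun _ _ => rfl))
  rw [this]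

/-- The estimate makes `f ↦ D^α Γ_φ f` a bounded linear map from the dense subspace `𝒪` into a
complete space, so it extends. -/
theorem exists_extendsFracHankel {α M : ℝ} (hM : 0 ≤ M) {φ : ℂ → H}
    (hφ : DifferentiableOn ℂ φ (ball 0 1))
    (h : ∀ f : HardySpace ℂ, f.ExtendsAnalytically →
      ∑' n, ‖fracHankelCoeff α (taylorCoeff φ) (taylorCoeff f) n‖ₑ ^ 2 ≤
        ENNReal.ofReal (M ^ 2 * ‖f‖ ^ 2)) :
    ∃ T : HardySpace ℂ →L[ℂ] HardySpace H, ExtendsFracHankel α φ T := by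
  set a := taylorCoeff φ
  have ha : DiscSummable 1 a := discSummable_taylorCoeff hφ
  have hsum (f : analyticSubmodule ℂ) :
      Summable fun n => ‖fracHankelCoeff α a (taylorCoeff (f : HardySpace ℂ)) n‖ ^ 2 :=
    summable_sq_of_tsum_enorm_lt_top ((h f.1 f.2).trans_lt ENNReal.ofReal_lt_top)
  let L : analyticSubmodule ℂ →ₗ[ℂ] HardySpace H :=
    { toFun := fun f => hardyOfCoeff _ (hsum f)
      map_add' := fun f g => by
        obtain ⟨R, hR, hf⟩ := f.2.exists_discSummable
        obtain ⟨R', hR', hg⟩ := g.2.exists_discSummable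
        refine hardySpace_ext ?_
        refine Eq.trans ?_ (taylorCoeff_add (hardyOfCoeff _ (hsum f)).2.1
          (hardyOfCoeff _ (hsum g)).2.1).symm
        rw [taylorCoeff_hardyOfCoeff, taylorCoeff_hardyOfCoeff, taylorCoeff_hardyOfCoeff]
        funext n
        have h1 : taylorCoeff ((f + g : analyticSubmodule ℂ) : HardySpace ℂ) =
            taylorCoeff (f : HardySpace ℂ) + taylorCoeff (g : HardySpace ℂ) :=
          taylorCoeff_add f.1.2.1 g.1.2.1
        rw [Pi.add_apply, fracHankelCoeff, h1, hankelCoeff_add ha (lt_min hR hR')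
          (hf.mono (min_le_left _ _)) (hg.mono (min_le_right _ _)), smul_add]
        rfl
      map_smul' := fun c f => by
        refine hardySpace_ext ?_
        refine Eq.trans ?_ (taylorCoeff_smul (hardyOfCoeff _ (hsum f)).2.1 c).symm
        rw [taylorCoeff_hardyOfCoeff, taylorCoeff_hardyOfCoeff]
        funext n
        have h1 : taylorCoeff ((c • f : analyticSubmodule ℂ) : HardySpace ℂ) =
            c • taylorCoeff (f : HardySpace ℂ) := taylorCoeff_smul f.1.2.1 c
        rw [Pi.smul_apply, fracHankelCoeff, h1, hankelCoeff_smul, smul_comm]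
        rfl }
  have hL : ∀ f : analyticSubmodule ℂ, ‖L f‖ ≤ M * ‖(analyticSubmodule ℂ).subtype f‖ := fun f => by
    refine (pow_le_pow_iff_left₀ (norm_nonneg _) (by positivity) two_ne_zero).1 ?_
    have h1 := h f.1 f.2
    rw [← ENNReal.ofReal_le_ofReal_iff (by positivity), mul_pow, ofReal_norm_sq_hardySpace]
    change ∑' n, ‖taylorCoeff (hardyOfCoeff _ (hsum f)) n‖ₑ ^ 2 ≤ _
    rwa [taylorCoeff_hardyOfCoeff]
  refine ⟨L.extendOfNorm (analyticSubmodule ℂ).subtype, fun f hf => ?_⟩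
  have h1 := LinearMap.extendOfNorm_eq (f := L) denseRange_analyticSubmodule ⟨M, hL⟩ ⟨f, hf⟩
  rw [Submodule.subtype_apply] at h1
  rw [h1, fracDiff_hankel_eq α hφ hf]
  exact eqOn_hardyOfCoeff _ (hsum ⟨f, hf⟩)

end HankelOperator

/-! ### One-variable radial integrals -/

section RadialEstimates

/-- For `Q ≥ 1`, `1 + v ≤ 2Q (1 + v/(2Q)) ≤ 2Q e^{v/(2Q)}`; raising this to the power `Q` gives the
constant `(2Q)^Q` and the rate `1/2`. -/
theorem rpow_le_exp_half (q : ℝ) :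
    ∃ C : ℝ, 1 ≤ C ∧ ∀ v : ℝ, 0 ≤ v → (1 + v) ^ q ≤ C * Real.exp (v / 2) := by
  set Q := max q 1 with hQ
  have hQ1 : 1 ≤ Q := le_max_right _ _
  refine ⟨(2 * Q) ^ Q, Real.one_le_rpow (by linarith) (by linarith), fun v hv => ?_⟩
  calc (1 + v) ^ q ≤ (1 + v) ^ Q :=
        Real.rpow_le_rpow_of_exponent_le (by linarith) (le_max_left _ _)
    _ ≤ (2 * Q * Real.exp (v / (2 * Q))) ^ Q := by
        refine Real.rpow_le_rpow (by linarith) ?_ (by linarith)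
        have h := Real.add_one_le_exp (v / (2 * Q))
        calc 1 + v ≤ 2 * Q * (v / (2 * Q) + 1) := by
              rw [mul_add, mul_div_cancel₀ _ (by positivity)]; linarith
          _ ≤ _ := mul_le_mul_of_nonneg_left h (by positivity)
    _ = _ := by
        rw [Real.mul_rpow (by positivity) (by positivity), ← Real.exp_mul]
        congr 2
        field_simp

theorem div_one_add_le_one_sub_exp_neg {v : ℝ} (hv : 0 < v) :
    v / (1 + v) ≤ 1 - Real.exp (-v) := by
  have h := Real.add_one_le_exp v
  have : Real.exp (-v) ≤ (1 + v)⁻¹ := by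
    rw [Real.exp_neg]
    exact inv_anti₀ (by positivity) (by linarith)
  have h2 : v / (1 + v) = 1 - (1 + v)⁻¹ := by field_simp; ring
  linarith

theorem one_sub_exp_neg_half_pos {y : ℝ} (hy : 0 < y) : 0 < 1 - Real.exp (-y / 2) := by
  have : Real.exp (-y / 2) < 1 := Real.exp_lt_one_iff.2 (by linarith)
  linarith

/-- Here `1 - e^{-y/2}` is comparable with `y` only for bounded `y`. For large `y` one loses a
factor `(1 + y/2)^q`, which `e^{-y/4}` pays for. -/
theorem exp_mul_one_sub_exp_rpow_neg_le {q : ℝ} (hq : 0 ≤ q) :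
    ∃ C : ℝ, 1 ≤ C ∧ ∀ y : ℝ, 0 < y →
      Real.exp (-y / 4) * (1 - Real.exp (-y / 2)) ^ (-q) ≤ C * y ^ (-q) := by
  obtain ⟨C, hC1, hC⟩ := rpow_le_exp_half q
  refine ⟨C * 2 ^ q, one_le_mul_of_one_le_of_one_le hC1
    (Real.one_le_rpow (by norm_num) hq), fun y hy => ?_⟩
  have hv : 0 < y / 2 := by positivity
  have h1 := div_one_add_le_one_sub_exp_neg hv
  rw [← neg_div] at h1
  have h2 : (1 - Real.exp (-y / 2)) ^ (-q) ≤ (y / 2 / (1 + y / 2)) ^ (-q) :=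
    Real.rpow_le_rpow_of_nonpos (by positivity) h1 (by linarith)
  have h3 : (y / 2 / (1 + y / 2)) ^ (-q) = 2 ^ q * y ^ (-q) * (1 + y / 2) ^ q := by
    rw [Real.div_rpow (by positivity) (by positivity), Real.div_rpow hy.le (by norm_num),
      Real.rpow_neg (by norm_num : (0 : ℝ) ≤ 2), Real.rpow_neg (by positivity : 0 ≤ 1 + y / 2)]
    field_simp
  have h4 := hC (y / 2) hv.le
  calc Real.exp (-y / 4) * (1 - Real.exp (-y / 2)) ^ (-q)
      ≤ Real.exp (-y / 4) * (2 ^ q * y ^ (-q) * (C * Real.exp (y / 2 / 2))) := by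
        rw [h3] at h2
        refine mul_le_mul_of_nonneg_left (h2.trans ?_) (Real.exp_pos _).le
        exact mul_le_mul_of_nonneg_left h4 (by positivity)
    _ = C * 2 ^ q * y ^ (-q) * (Real.exp (-y / 4) * Real.exp (y / 2 / 2)) := by ring
    _ = C * 2 ^ q * y ^ (-q) := by
        rw [← Real.exp_add, show -y / 4 + y / 2 / 2 = 0 by ring, Real.exp_zero, mul_one]

/-- Split at `y = δ`: the maximum is `δ` below and `y` above. Convergence at `0` needs `0 < a`, at
infinity `a < p`; both pieces scale like `δ^{a-p}`. -/
theorem lintegral_rpow_mul_max_rpow_neg_le {a p : ℝ} (ha : 0 < a) (hp : a < p) {δ : ℝ}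
    (hδ : 0 < δ) :
    ∫⁻ y in Ioi (0 : ℝ), ENNReal.ofReal (y ^ (a - 1) * max δ y ^ (-p)) ≤
      ENNReal.ofReal ((a⁻¹ + (p - a)⁻¹) * δ ^ (a - p)) := by
  have hsplit : Ioi (0 : ℝ) = Ioc 0 δ ∪ Ioi δ := (Ioc_union_Ioi_eq_Ioi hδ.le).symm
  rw [hsplit, add_mul, ENNReal.ofReal_add (by positivity)
    (mul_nonneg (inv_nonneg.2 (by linarith)) (by positivity))]
  refine (lintegral_union_le _ _ _).trans (add_le_add ?_ ?_)
  · have h1 : IntegrableOn (fun y : ℝ => y ^ (a - 1) * δ ^ (-p)) (Ioc 0 δ) := by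
      refine Integrable.mul_const ?_ _
      exact (intervalIntegrable_iff_integrableOn_Ioc_of_le hδ.le).1
        (intervalIntegral.intervalIntegrable_rpow' (by linarith))
    calc ∫⁻ y in Ioc 0 δ, ENNReal.ofReal (y ^ (a - 1) * max δ y ^ (-p))
        = ∫⁻ y in Ioc 0 δ, ENNReal.ofReal (y ^ (a - 1) * δ ^ (-p)) :=
          setLIntegral_congr_fun measurableSet_Ioc fun y hy => by
            simp only [max_eq_left hy.2]
      _ = ENNReal.ofReal (∫ y in Ioc 0 δ, y ^ (a - 1) * δ ^ (-p)) := by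
          rw [ofReal_integral_eq_lintegral_ofReal h1]
          filter_upwards [ae_restrict_mem measurableSet_Ioc] with y hy
          have := hy.1
          simp only [Pi.zero_apply]; positivity
      _ ≤ _ := by
          refine ENNReal.ofReal_le_ofReal (le_of_eq ?_)
          rw [integral_mul_const, ← intervalIntegral.integral_of_le hδ.le,
            integral_rpow (Or.inl (by linarith)), sub_add_cancel, Real.zero_rpow ha.ne', sub_zero,
            sub_eq_add_neg a p, Real.rpow_add hδ]
          ring
  · have h1 : IntegrableOn (fun y : ℝ => y ^ (a - 1 - p)) (Ioi δ) :=
      integrableOn_Ioi_rpow_of_lt (by linarith) hδ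
    calc ∫⁻ y in Ioi δ, ENNReal.ofReal (y ^ (a - 1) * max δ y ^ (-p))
        = ∫⁻ y in Ioi δ, ENNReal.ofReal (y ^ (a - 1 - p)) :=
          setLIntegral_congr_fun measurableSet_Ioi fun y hy => by
            simp only [max_eq_right (le_of_lt (mem_Ioi.1 hy))]
            rw [← Real.rpow_add (hδ.trans hy), ← sub_eq_add_neg]
      _ = ENNReal.ofReal (∫ y in Ioi δ, y ^ (a - 1 - p)) := by
          rw [ofReal_integral_eq_lintegral_ofReal h1]
          filter_upwards [ae_restrict_mem measurableSet_Ioi] with y hy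
          have := hδ.trans hy
          simp only [Pi.zero_apply]; positivity
      _ ≤ _ := by
          refine ENNReal.ofReal_le_ofReal (le_of_eq ?_)
          rw [integral_Ioi_rpow_of_lt (by linarith) hδ, show a - 1 - p + 1 = -(p - a) by ring,
            show a - p = -(p - a) by ring]
          have : p - a ≠ 0 := by linarith
          field_simp

theorem lintegral_rpow_mul_exp_mul_max_rpow_neg_le {a p : ℝ} (ha : 0 < a) (hp : a < p) :
    ∃ C : ℝ, 0 < C ∧ ∀ δ : ℝ, 0 < δ →
      ∫⁻ y in Ioi (0 : ℝ), ENNReal.ofReal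
          (y ^ (a - 1) * Real.exp (-y / 4) * max δ (1 - Real.exp (-y / 2)) ^ (-p)) ≤
        ENNReal.ofReal (C * δ ^ (a - p)) := by
  obtain ⟨C, hC1, hC⟩ := exp_mul_one_sub_exp_rpow_neg_le (q := p) (by linarith)
  have hpa : 0 < p - a := by linarith
  refine ⟨C * (a⁻¹ + (p - a)⁻¹), by positivity, fun δ hδ => ?_⟩
  rw [mul_assoc, ENNReal.ofReal_mul (by positivity)]
  refine le_trans ?_ (mul_le_mul_right (lintegral_rpow_mul_max_rpow_neg_le ha hp hδ) _)
  rw [← lintegral_const_mul' _ _ ENNReal.ofReal_ne_top]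
  refine setLIntegral_mono' measurableSet_Ioi fun y hy => ?_
  have hy : 0 < y := hy
  rw [← ENNReal.ofReal_mul (by positivity)]
  refine ENNReal.ofReal_le_ofReal ?_
  have key : Real.exp (-y / 4) * max δ (1 - Real.exp (-y / 2)) ^ (-p) ≤ C * max δ y ^ (-p) := by
    rcases le_total y δ with h | h
    · rw [max_eq_left h]
      have h1 : Real.exp (-y / 4) ≤ 1 := Real.exp_le_one_iff.2 (by linarith)
      have h2 : max δ (1 - Real.exp (-y / 2)) ^ (-p) ≤ δ ^ (-p) :=
        Real.rpow_le_rpow_of_nonpos hδ (le_max_left _ _) (by linarith)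
      exact mul_le_mul (h1.trans hC1) h2 (by positivity) (by linarith)
    · rw [max_eq_right h]
      refine le_trans (mul_le_mul_of_nonneg_left ?_ (Real.exp_pos _).le) (hC y hy)
      exact Real.rpow_le_rpow_of_nonpos (one_sub_exp_neg_half_pos hy) (le_max_right _ _)
        (by linarith)
  calc _ = y ^ (a - 1) * (Real.exp (-y / 4) * max δ (1 - Real.exp (-y / 2)) ^ (-p)) := by ring
    _ ≤ y ^ (a - 1) * (C * max δ y ^ (-p)) := mul_le_mul_of_nonneg_left key (by positivity)
    _ = _ := by ring

theorem lintegral_rpow_mul_exp_neg_le {γ : ℝ} (hγ : 0 < γ) {n : ℕ} (hn : 0 < n) :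
    ∫⁻ y in Ioi (0 : ℝ), ENNReal.ofReal (y ^ (γ - 1) * Real.exp (-(n / 4 * y))) =
      ENNReal.ofReal ((1 / (n / 4 : ℝ)) ^ γ * Real.Gamma γ) := by
  have hr : (0 : ℝ) < n / 4 := by positivity
  rw [← Real.integral_rpow_mul_exp_neg_mul_Ioi hγ hr, ofReal_integral_eq_lintegral_ofReal]
  -- A non-integrable function has Bochner integral `0`, whereas the Gamma integral is positive. The
  -- same device gives integrability further on.
  · by_contra h
    have h1 := Real.integral_rpow_mul_exp_neg_mul_Ioi hγ hr
    rw [integral_undef h] at h1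
    have : 0 < (1 / (n / 4 : ℝ)) ^ γ * Real.Gamma γ := by
      have := Real.Gamma_pos_of_pos hγ
      positivity
    linarith
  · filter_upwards [ae_restrict_mem measurableSet_Ioi] with y hy
    have : 0 < y := hy
    simp only [Pi.zero_apply]; positivity

end RadialEstimates

/-! ### Angular integrals of `|1 - ρ e^{iθ}|^{-p}` -/

section CircleEstimates

/-- For `|θ| ≤ π/2` the distance from `1` to the line through `e^{iθ}` is `|sin θ| ≥ 2|θ|/π`. For
larger angles the real part of `1 - ρ e^{iθ}` is already at least `1`. -/
theorem abs_div_pi_le_norm_one_sub {ρ θ : ℝ} (h0 : 0 ≤ ρ) (hθ : |θ| ≤ π) :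
    |θ| / π ≤ ‖1 - circleMap 0 ρ θ‖ := by
  have hre : (1 - circleMap 0 ρ θ).re = 1 - ρ * Real.cos θ := by
    simp [circleMap, Complex.exp_ofReal_mul_I_re]
  have him : (1 - circleMap 0 ρ θ).im = -(ρ * Real.sin θ) := by
    simp [circleMap, Complex.exp_ofReal_mul_I_im]
  rcases le_total |θ| (π / 2) with h | h
  · have h2 : Real.sin θ ^ 2 ≤ ‖1 - circleMap 0 ρ θ‖ ^ 2 := by
      rw [← Complex.normSq_eq_norm_sq, Complex.normSq_apply, hre, him]
      nlinarith [Real.sin_sq_add_cos_sq θ, sq_nonneg (ρ - Real.cos θ)]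
    have h3 := Real.mul_le_sin (abs_nonneg θ) h
    have h4 : |Real.sin θ| ≤ ‖1 - circleMap 0 ρ θ‖ := abs_le_of_sq_le_sq h2 (norm_nonneg _)
    have h5 : Real.sin |θ| ≤ |Real.sin θ| := by
      rcases abs_cases θ with ⟨h, _⟩ | ⟨h, _⟩ <;> rw [h]
      · exact le_abs_self _
      · rw [Real.sin_neg]; exact neg_le_abs _
    calc |θ| / π ≤ 2 / π * |θ| := by
          rw [div_mul_eq_mul_div]
          gcongr
          linarith [abs_nonneg θ]
      _ ≤ _ := h3.trans (h5.trans h4)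
  · have hc : Real.cos θ ≤ 0 := by
      rw [← Real.cos_abs]
      exact Real.cos_nonpos_of_pi_div_two_le_of_le h (by linarith [Real.pi_pos])
    have h6 : 1 ≤ ‖1 - circleMap 0 ρ θ‖ := by
      refine le_trans ?_ ((le_abs_self _).trans (Complex.abs_re_le_norm _))
      rw [hre]
      nlinarith
    exact ((div_le_one Real.pi_pos).2 hθ).trans h6

theorem one_sub_le_norm_one_sub {w : ℂ} : 1 - ‖w‖ ≤ ‖1 - w‖ := by
  simpa using norm_sub_norm_le 1 w

/-- Since `|1 - ρ e^{iθ}| ≥ max(1-ρ, |θ|)/π`, this is the radial estimate with `a = 1`, applied on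
each half of `(-π, π)`. -/
theorem lintegral_norm_one_sub_circleMap_rpow_neg_le {p : ℝ} (hp : 1 < p) :
    ∃ C : ℝ, 0 < C ∧ ∀ ρ : ℝ, 0 ≤ ρ → ρ < 1 →
      ∫⁻ θ, ENNReal.ofReal (‖1 - circleMap 0 ρ θ‖ ^ (-p)) ∂circleMeasure ≤
        ENNReal.ofReal (C * (1 - ρ) ^ (1 - p)) := by
  have hp1 : 0 < p - 1 := by linarith
  refine ⟨(2 * π)⁻¹ * (π ^ p * (2 * ((1 : ℝ)⁻¹ + (p - 1)⁻¹))), by positivity, fun ρ h0 h1 => ?_⟩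
  have hδ : 0 < 1 - ρ := by linarith
  have hper : Function.Periodic (fun θ => ENNReal.ofReal (‖1 - circleMap 0 ρ θ‖ ^ (-p)))
      (2 * π) := fun θ => by simp only [periodic_circleMap 0 ρ θ]
  have h2 : ∫⁻ θ, ENNReal.ofReal (‖1 - circleMap 0 ρ θ‖ ^ (-p)) ∂circleMeasure =
      ENNReal.ofReal (2 * π)⁻¹ *
        ∫⁻ θ in Ioo (-π) π, ENNReal.ofReal (‖1 - circleMap 0 ρ θ‖ ^ (-p)) := by
    rw [lintegral_circleMeasure_eq_Ioo hper, ← mul_assoc, ← ENNReal.ofReal_mul (by positivity),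
      inv_mul_cancel₀ (by positivity), ENNReal.ofReal_one, one_mul]
  rw [h2, mul_assoc (2 * π)⁻¹, ENNReal.ofReal_mul (by positivity)]
  refine mul_le_mul_right ?_ _
  have h3 (θ : ℝ) (hθ : θ ∈ Ioo (-π) π) : ENNReal.ofReal (‖1 - circleMap 0 ρ θ‖ ^ (-p)) ≤
      ENNReal.ofReal (π ^ p) * ENNReal.ofReal (max (1 - ρ) |θ| ^ (-p)) := by
    rw [← ENNReal.ofReal_mul (by positivity)]
    refine ENNReal.ofReal_le_ofReal ?_
    have hmax : max (1 - ρ) |θ| / π ≤ ‖1 - circleMap 0 ρ θ‖ := by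
      rw [← max_div_div_right Real.pi_pos.le]
      refine max_le ?_ (abs_div_pi_le_norm_one_sub h0 (abs_le.2 ⟨hθ.1.le, hθ.2.le⟩))
      refine (div_le_self hδ.le (by linarith [Real.pi_gt_three])).trans ?_
      have := one_sub_le_norm_one_sub (w := circleMap 0 ρ θ)
      simpa [abs_of_nonneg h0] using this
    have hmpos : 0 < max (1 - ρ) |θ| := lt_max_of_lt_left hδ
    refine (Real.rpow_le_rpow_of_nonpos (by positivity) hmax (by linarith)).trans_eq ?_
    rw [Real.div_rpow hmpos.le Real.pi_pos.le, Real.rpow_neg Real.pi_pos.le]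
    field_simp
  refine (setLIntegral_mono' measurableSet_Ioo h3).trans ?_
  rw [lintegral_const_mul' _ _ ENNReal.ofReal_ne_top, mul_assoc, ENNReal.ofReal_mul (by positivity)]
  refine mul_le_mul_right ?_ _
  have h4 : ∫⁻ y in Ioi (0 : ℝ), ENNReal.ofReal (max (1 - ρ) |y| ^ (-p)) ≤
      ENNReal.ofReal (((1 : ℝ)⁻¹ + (p - 1)⁻¹) * (1 - ρ) ^ (1 - p)) := by
    refine le_trans (le_of_eq ?_) (lintegral_rpow_mul_max_rpow_neg_le one_pos hp hδ)
    refine setLIntegral_congr_fun measurableSet_Ioi fun y hy => ?_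
    simp only [abs_of_pos (mem_Ioi.1 hy), sub_self, Real.rpow_zero, one_mul]
  have h5 : ∫⁻ y in Iio (0 : ℝ), ENNReal.ofReal (max (1 - ρ) |y| ^ (-p)) =
      ∫⁻ y in Ioi (0 : ℝ), ENNReal.ofReal (max (1 - ρ) |y| ^ (-p)) := by
    rw [← lintegral_indicator measurableSet_Iio, ← lintegral_indicator measurableSet_Ioi,
      ← lintegral_neg_eq_self]
    refine lintegral_congr fun y => ?_
    by_cases hy : 0 < y
    · rw [indicator_of_mem (by simpa using hy), indicator_of_mem (by simpa using hy), abs_neg]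
    · rw [indicator_of_notMem (by simpa using hy), indicator_of_notMem (by simpa using hy)]
  calc ∫⁻ θ in Ioo (-π) π, ENNReal.ofReal (max (1 - ρ) |θ| ^ (-p))
      ≤ ∫⁻ θ in Iio 0 ∪ Ici 0, ENNReal.ofReal (max (1 - ρ) |θ| ^ (-p)) :=
        lintegral_mono_set (by simp)
    _ ≤ (∫⁻ θ in Iio (0 : ℝ), ENNReal.ofReal (max (1 - ρ) |θ| ^ (-p))) +
        ∫⁻ θ in Ici (0 : ℝ), ENNReal.ofReal (max (1 - ρ) |θ| ^ (-p)) := lintegral_union_le _ _ _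
    _ ≤ _ := by
        rw [h5, setLIntegral_congr Ioi_ae_eq_Ici.symm, mul_assoc, two_mul, ENNReal.ofReal_add]
        · exact add_le_add h4 h4
        all_goals positivity

end CircleEstimates

/-! ### Growth of the kernel `∑ (1 + n)^s xⁿ` near `x = 1` -/

section Kernel

/-- The kernel `∑ (1 + n)^s xⁿ`. -/
def fracKernel (s : ℝ) (x : ℂ) : ℂ := powerSum (fun n => (((1 + n : ℝ) ^ s : ℝ) : ℂ)) x

theorem discSummable_rpow (s : ℝ) : DiscSummable 1 fun n : ℕ => (((1 + n : ℝ) ^ s : ℝ) : ℂ) := by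
  have h : DiscSummable 1 fun _ : ℕ => (1 : ℂ) := fun r h0 h1 => by
    simpa using summable_geometric_of_lt_one h0 h1
  simpa using h.rpow_smul s

/-- Integer exponents, by induction on `N` from the binomial series for `(1-x)^{-(j+1)}`. The step
is `(1+n) C(n+j, j) = (j+1) C(n+j+1, j+1) - j C(n+j, j)`; the lower-order term is raised to the full
power using `|1 - x| ≤ 2`. -/
theorem hasSum_pow_mul_choose_bound (N : ℕ) : ∀ j : ℕ, ∃ C : ℝ, 0 ≤ C ∧ ∀ x : ℂ, ‖x‖ < 1 →
    ∃ S : ℂ, HasSum (fun n : ℕ => (1 + n : ℂ) ^ N * ((n + j).choose j : ℂ) * x ^ n) S ∧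
      ‖S‖ ≤ C * (‖1 - x‖⁻¹) ^ (N + j + 1) := by
  induction N with
  | zero =>
    intro j
    refine ⟨1, zero_le_one, fun x hx => ⟨1 / (1 - x) ^ (j + 1), ?_, ?_⟩⟩
    · simpa using hasSum_choose_mul_geometric_of_norm_lt_one j hx
    · simp
  | succ N ih =>
    intro j
    obtain ⟨C₁, hC₁, h₁⟩ := ih (j + 1)
    obtain ⟨C₂, hC₂, h₂⟩ := ih j
    refine ⟨(j + 1) * C₁ + j * (C₂ * 2), by positivity, fun x hx => ?_⟩
    obtain ⟨S₁, hS₁, hb₁⟩ := h₁ x hx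
    obtain ⟨S₂, hS₂, hb₂⟩ := h₂ x hx
    refine ⟨(j + 1) * S₁ - j * S₂, ?_, ?_⟩
    · refine ((hS₁.mul_left ((j : ℂ) + 1)).sub (hS₂.mul_left (j : ℂ))).congr_fun fun n => ?_
      have h := Nat.add_one_mul_choose_eq (n + j) j
      have h' : ((n : ℂ) + j + 1) * ((n + j).choose j : ℂ) =
          ((n + (j + 1)).choose (j + 1) : ℂ) * (j + 1) := by
        exact_mod_cast h
      rw [pow_succ]
      linear_combination (1 + (n : ℂ)) ^ N * x ^ n * h'
    · have hpos : 0 < ‖1 - x‖ := by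
        have := one_sub_le_norm_one_sub (w := x); linarith
      have hle : ‖1 - x‖ ≤ 2 := by
        refine (norm_sub_le _ _).trans ?_
        rw [norm_one]; linarith
      have h2 : (1 : ℝ) ≤ 2 * ‖1 - x‖⁻¹ := by
        rw [← div_eq_mul_inv, le_div_iff₀ hpos]; linarith
      calc ‖((j : ℂ) + 1) * S₁ - j * S₂‖ ≤ ‖((j : ℂ) + 1) * S₁‖ + ‖(j : ℂ) * S₂‖ :=
            norm_sub_le _ _
        _ = (j + 1) * ‖S₁‖ + j * ‖S₂‖ := by
            rw [norm_mul, norm_mul, Complex.norm_natCast]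
            congr 2
            exact_mod_cast Complex.norm_natCast (j + 1)
        _ ≤ (j + 1) * (C₁ * (‖1 - x‖⁻¹) ^ (N + (j + 1) + 1)) +
            j * (C₂ * (‖1 - x‖⁻¹) ^ (N + j + 1) * (2 * ‖1 - x‖⁻¹)) := by
            gcongr
            exact hb₂.trans (le_mul_of_one_le_right (by positivity) h2)
        _ = _ := by ring

/-- A real exponent is reached from an integer `N > 1+α` by subordination: with `σ = N - (1+α)`,
`Γ(σ) (1+n)^{1+α} = (1+n)^N ∫ y^{σ-1} e^{-(1+n)y} dy`. The kernel is thus an average over `y` of the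
integer kernel at `x e^{-y}`, of size `|1 - x e^{-y}|^{-(N+1)}`, and the radial estimate yields the
exponent `σ - (N+1) = -(2+α)`. -/
theorem norm_fracKernel_le {α : ℝ} (hα : -1 ≤ α) : ∃ C : ℝ, 0 < C ∧ ∀ x : ℂ, ‖x‖ < 1 →
    ‖fracKernel (1 + α) x‖ ≤ C * ‖1 - x‖ ^ (-(2 + α)) := by
  obtain ⟨N, hN⟩ := exists_nat_gt (1 + α)
  obtain ⟨C, hC0, hC⟩ := hasSum_pow_mul_choose_bound N 0
  set σ : ℝ := N - (1 + α) with hσ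
  have hσ0 : 0 < σ := by linarith
  have hΓ : 0 < Real.Gamma σ := Real.Gamma_pos_of_pos hσ0
  obtain ⟨D, hD0, hD⟩ := lintegral_rpow_mul_exp_mul_max_rpow_neg_le (a := σ) (p := N + 1) hσ0
    (by linarith)
  -- `C + 1` keeps the constant positive when `C = 0`; the power of `2` comes from replacing `d` by
  -- `d/2`.
  refine ⟨(Real.Gamma σ)⁻¹ * ((C + 1) * (D * 2 ^ (2 + α))), by positivity, fun x hx => ?_⟩
  set d := ‖1 - x‖ with hd
  have hd0 : 0 < d := by have := one_sub_le_norm_one_sub (w := x); linarith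
  choose L hL hLb using hC
  have hexp (y : ℝ) (hy : 0 < y) : ‖x * (Real.exp (-y) : ℂ)‖ < 1 := by
    rw [norm_mul, Complex.norm_real, Real.norm_of_nonneg (Real.exp_pos _).le]
    have : Real.exp (-y) ≤ 1 := Real.exp_le_one_iff.2 (by linarith)
    nlinarith [norm_nonneg x, Real.exp_pos (-y)]
  -- the subordination formula
  let F (n : ℕ) (y : ℝ) : ℂ := ((y ^ (σ - 1) * Real.exp (-((1 + n : ℝ) * y)) : ℝ) : ℂ) *
    ((1 + n : ℂ) ^ N * x ^ n)
  have hn (n : ℕ) : (0 : ℝ) < 1 + n := by positivity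
  have hGam (n : ℕ) := Real.integral_rpow_mul_exp_neg_mul_Ioi hσ0 (hn n)
  have hint (n : ℕ) : IntegrableOn (fun y : ℝ => y ^ (σ - 1) * Real.exp (-((1 + n : ℝ) * y)))
      (Ioi 0) := by
    by_contra h
    have h1 := hGam n
    rw [integral_undef h] at h1
    have : 0 < (1 / (1 + n : ℝ)) ^ σ * Real.Gamma σ := by have := hn n; positivity
    linarith
  have hFint (n : ℕ) : IntegrableOn (F n) (Ioi 0) := (hint n).ofReal.mul_const _
  have hpow (n : ℕ) : (1 / (1 + n : ℝ)) ^ σ * (1 + n : ℝ) ^ N = (1 + n : ℝ) ^ (1 + α) := by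
    rw [one_div, Real.inv_rpow (hn n).le, ← Real.rpow_neg (hn n).le, ← Real.rpow_natCast,
      ← Real.rpow_add (hn n)]
    congr 1; rw [hσ]; ring
  have hFval (n : ℕ) : ∫ y in Ioi 0, F n y =
      (Real.Gamma σ : ℂ) * (x ^ n * (((1 + n : ℝ) ^ (1 + α) : ℝ) : ℂ)) := by
    simp only [F]
    rw [integral_mul_const, integral_complex_ofReal, hGam n, ← hpow n]
    push_cast
    ring
  have hFnorm (n : ℕ) : ∫ y in Ioi 0, ‖F n y‖ =
      Real.Gamma σ * (‖x‖ ^ n * ‖(((1 + n : ℝ) ^ (1 + α) : ℝ) : ℂ)‖) := by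
    have h1 : ∀ y ∈ Ioi (0 : ℝ), ‖F n y‖ =
        (y ^ (σ - 1) * Real.exp (-((1 + n : ℝ) * y))) * ((1 + n : ℝ) ^ N * ‖x‖ ^ n) := by
      intro y hy
      have hy : 0 < y := hy
      simp only [F]
      rw [norm_mul, Complex.norm_real, Real.norm_of_nonneg (by positivity), norm_mul, norm_pow,
        norm_pow]
      congr 3
      exact_mod_cast Complex.norm_of_nonneg (hn n).le
    rw [setIntegral_congr_fun measurableSet_Ioi h1, integral_mul_const, hGam n,
      Complex.norm_real, Real.norm_of_nonneg (by have := hn n; positivity), ← hpow n]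
    ring
  have hsum := hasSum_integral_of_summable_integral_norm (μ := volume.restrict (Ioi (0 : ℝ)))
    (F := F) hFint (by
      simp_rw [hFnorm]
      exact (discSummable_rpow (1 + α) ‖x‖ (norm_nonneg x) hx).mul_left _)
  simp_rw [hFval] at hsum
  have hK := ((discSummable_rpow (1 + α)).hasSum hx).mul_left (Real.Gamma σ : ℂ)
  simp only [smul_eq_mul] at hK
  have heq := hK.unique hsum
  -- the bound
  have hbound : ∀ y ∈ Ioi (0 : ℝ), ‖∑' n, F n y‖ₑ ≤ ENNReal.ofReal (C + 1) * ENNReal.ofReal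
      (y ^ (σ - 1) * Real.exp (-y / 4) * max (d / 2) (1 - Real.exp (-y / 2)) ^ (-(N + 1 : ℝ))) := by
    intro y hy
    have hy : 0 < y := hy
    have h1 : ∑' n, F n y = ((y ^ (σ - 1) * Real.exp (-y) : ℝ) : ℂ) *
        L (x * (Real.exp (-y) : ℂ)) (hexp y hy) := by
      refine HasSum.tsum_eq (((hL _ (hexp y hy)).mul_left _).congr_fun fun n => ?_)
      simp only [F]
      have : Real.exp (-((1 + n : ℝ) * y)) = Real.exp (-y) * Real.exp (-y) ^ n := by
        rw [← Real.exp_nat_mul, ← Real.exp_add]; congr 1; ring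
      rw [this, mul_pow]
      push_cast
      simp
      ring
    rw [← ofReal_norm, ← ENNReal.ofReal_mul (by positivity), h1]
    refine ENNReal.ofReal_le_ofReal ?_
    rw [norm_mul, Complex.norm_real, Real.norm_of_nonneg (by positivity)]
    have h2 := hLb _ (hexp y hy)
    set w := x * (Real.exp (-y) : ℂ)
    have hyexp : Real.exp (-y) ≤ Real.exp (-y / 2) := Real.exp_le_exp.2 (by linarith)
    have hwn : ‖w‖ ≤ Real.exp (-y) := by
      rw [norm_mul, Complex.norm_real, Real.norm_of_nonneg (Real.exp_pos _).le]
      exact mul_le_of_le_one_left (Real.exp_pos _).le hx.le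
    -- As `|w| ≤ e^{-y}`, both `1 - e^{-y/2}` and `|w - x| ≤ 1 - e^{-y}` are at most `|1 - w|`; the
    -- triangle inequality then gives `d ≤ 2|1 - w|`.
    have h3 : max (d / 2) (1 - Real.exp (-y / 2)) ≤ ‖1 - w‖ := by
      have h31 := one_sub_le_norm_one_sub (w := w)
      refine max_le ?_ (by linarith)
      have h32 : d ≤ ‖1 - w‖ + ‖w - x‖ := by
        rw [hd, show (1 : ℂ) - x = (1 - w) + (w - x) by ring]
        exact norm_add_le _ _
      have h33 : ‖w - x‖ ≤ 1 - Real.exp (-y) := by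
        have : w - x = -(x * ((1 - Real.exp (-y) : ℝ) : ℂ)) := by
          simp only [w]; push_cast; ring
        have h0 : 0 ≤ 1 - Real.exp (-y) := by
          have := Real.exp_le_one_iff.2 (show -y ≤ 0 by linarith); linarith
        rw [this, norm_neg, norm_mul, Complex.norm_real, Real.norm_of_nonneg h0]
        exact mul_le_of_le_one_left h0 hx.le
      linarith
    have hm0 : 0 < max (d / 2) (1 - Real.exp (-y / 2)) := lt_max_of_lt_left (by positivity)
    have h4 : (‖1 - w‖⁻¹) ^ (N + 0 + 1) ≤
        max (d / 2) (1 - Real.exp (-y / 2)) ^ (-(N + 1 : ℝ)) := by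
      rw [Real.rpow_neg hm0.le, add_zero, inv_pow]
      have : max (d / 2) (1 - Real.exp (-y / 2)) ^ (N + 1 : ℝ) =
          max (d / 2) (1 - Real.exp (-y / 2)) ^ (N + 1) :=
            by exact_mod_cast Real.rpow_natCast _ (N + 1)
      rw [this]
      exact inv_anti₀ (by positivity) (pow_le_pow_left₀ hm0.le h3 _)
    calc y ^ (σ - 1) * Real.exp (-y) * ‖L w _‖
        ≤ y ^ (σ - 1) * Real.exp (-y / 4) *
          ((C + 1) * max (d / 2) (1 - Real.exp (-y / 2)) ^ (-(N + 1 : ℝ))) := by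
          gcongr
          · linarith
          · refine h2.trans (mul_le_mul (by linarith) h4 (by positivity) (by positivity))
      _ = _ := by ring
  have hfin : ENNReal.ofReal (Real.Gamma σ * ‖fracKernel (1 + α) x‖) ≤
      ENNReal.ofReal ((C + 1) * (D * (d / 2) ^ (σ - (N + 1)))) := by
    have h1 : ENNReal.ofReal (Real.Gamma σ * ‖fracKernel (1 + α) x‖) =
        ‖∫ y in Ioi 0, ∑' n, F n y‖ₑ := by
      rw [← heq, ← ofReal_norm, norm_mul, Complex.norm_real, Real.norm_of_nonneg hΓ.le]
      rfl
    rw [h1, ENNReal.ofReal_mul (by positivity)]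
    refine (enorm_integral_le_lintegral_enorm _).trans ?_
    refine (setLIntegral_mono' measurableSet_Ioi hbound).trans ?_
    rw [lintegral_const_mul' _ _ ENNReal.ofReal_ne_top]
    exact mul_le_mul_right (hD (d / 2) (by positivity)) _
  rw [ENNReal.ofReal_le_ofReal_iff (by positivity)] at hfin
  have hexpo : σ - (N + 1) = -(2 + α) := by rw [hσ]; ring
  rw [hexpo, Real.div_rpow hd0.le (by norm_num), Real.rpow_neg (by norm_num : (0 : ℝ) ≤ 2),
    div_inv_eq_mul] at hfin
  rw [mul_assoc, ← div_eq_inv_mul (_ * _) , le_div_iff₀ hΓ] 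
  linarith

end Kernel

/-! ### The double integral for monomials, uniformly in the degree -/

section MonomialEstimate

theorem lintegral_norm_one_sub_circleMap_exp_le {p : ℝ} (hp : 1 < p) :
    ∃ C : ℝ, 0 < C ∧ ∀ x y : ℝ, 0 < x → 0 < y →
      ∫⁻ τ, ENNReal.ofReal (‖1 - circleMap 0 (Real.exp (-x / 2) * Real.exp (-y / 2)) τ‖ ^ (-p))
        ∂circleMeasure ≤
        ENNReal.ofReal (C * max (1 - Real.exp (-x / 2)) (1 - Real.exp (-y / 2)) ^ (-(p - 1))) := by
  obtain ⟨C, hC0, hC⟩ := lintegral_norm_one_sub_circleMap_rpow_neg_le hp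
  refine ⟨C, hC0, fun x y hx hy => ?_⟩
  have h1 := one_sub_exp_neg_half_pos hx
  have h2 := one_sub_exp_neg_half_pos hy
  have e1 := Real.exp_pos (-x / 2)
  have e2 := Real.exp_pos (-y / 2)
  refine (hC _ (by positivity) (by nlinarith)).trans (ENNReal.ofReal_le_ofReal ?_)
  rw [neg_sub]
  refine mul_le_mul_of_nonneg_left ?_ hC0.le
  refine Real.rpow_le_rpow_of_nonpos (lt_max_of_lt_left h1) (max_le ?_ ?_) (by linarith) <;>
    nlinarith

/-- The angular integral lowers the exponent `p` by one and leaves `max(1-|z|, 1-|w|)`; the radial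
integral then lowers it by `a`. Convergence is what `a + 1 < p` ensures. -/
theorem lintegral_radial_kernel_le {a p : ℝ} (ha : 0 < a) (hp : a + 1 < p) :
    ∃ C : ℝ, 0 < C ∧ ∀ x : ℝ, 0 < x →
      ∫⁻ y in Ioi (0 : ℝ), ENNReal.ofReal (y ^ (a - 1) * Real.exp (-y / 4)) *
        ∫⁻ τ, ENNReal.ofReal (‖1 - circleMap 0 (Real.exp (-x / 2) * Real.exp (-y / 2)) τ‖ ^ (-p))
          ∂circleMeasure ≤
        ENNReal.ofReal (C * (1 - Real.exp (-x / 2)) ^ (a - (p - 1))) := by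
  obtain ⟨C, hC0, hC⟩ := lintegral_norm_one_sub_circleMap_exp_le (p := p) (by linarith)
  obtain ⟨D, hD0, hD⟩ := lintegral_rpow_mul_exp_mul_max_rpow_neg_le (a := a) (p := p - 1) ha
    (by linarith)
  refine ⟨C * D, by positivity, fun x hx => ?_⟩
  have h1 := one_sub_exp_neg_half_pos hx
  rw [mul_assoc, ENNReal.ofReal_mul hC0.le]
  refine le_trans ?_ (mul_le_mul_right (hD _ h1) _)
  rw [← lintegral_const_mul' _ _ ENNReal.ofReal_ne_top]
  refine setLIntegral_mono' measurableSet_Ioi fun y hy => ?_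
  have hy : 0 < y := hy
  refine (mul_le_mul_right (hC x y hx hy) _).trans_eq ?_
  rw [← ENNReal.ofReal_mul (by positivity), ← ENNReal.ofReal_mul hC0.le]
  congr 1
  ring

theorem norm_pow_sub_pow_le {z w : ℂ} {M : ℝ} (hz : ‖z‖ ≤ M) (hw : ‖w‖ ≤ M) (n : ℕ) :
    ‖z ^ n - w ^ n‖ ≤ M ^ (n - 1) * (n * ‖z - w‖) := by
  have hM : 0 ≤ M := (norm_nonneg z).trans hz
  rw [← geom_sum₂_mul, norm_mul, ← mul_assoc]
  refine mul_le_mul_of_nonneg_right ?_ (norm_nonneg _)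
  refine (norm_sum_le _ _).trans ?_
  calc ∑ i ∈ Finset.range n, ‖z ^ i * w ^ (n - 1 - i)‖ ≤ ∑ i ∈ Finset.range n, M ^ (n - 1) := by
        refine Finset.sum_le_sum fun i hi => ?_
        have hi := Finset.mem_range.1 hi
        rw [norm_mul, norm_pow, norm_pow]
        calc ‖z‖ ^ i * ‖w‖ ^ (n - 1 - i) ≤ M ^ i * M ^ (n - 1 - i) := by gcongr
          _ = M ^ (n - 1) := by rw [← pow_add]; congr 1; omega
    _ = M ^ (n - 1) * n := by simp [mul_comm]

/-- From `|1 - z w̄|² - |z - w|² = (1 - |z|²)(1 - |w|²) ≥ 0`. -/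
theorem norm_sub_le_norm_one_sub_mul_conj {z w : ℂ} (hz : ‖z‖ ≤ 1) (hw : ‖w‖ ≤ 1) :
    ‖z - w‖ ≤ ‖1 - z * starRingEnd ℂ w‖ := by
  refine (pow_le_pow_iff_left₀ (norm_nonneg _) (norm_nonneg _) two_ne_zero).1 ?_
  have hz2 : z.re * z.re + z.im * z.im ≤ 1 := by
    rw [← Complex.normSq_apply, Complex.normSq_eq_norm_sq]; exact pow_le_one₀ (norm_nonneg _) hz
  have hw2 : w.re * w.re + w.im * w.im ≤ 1 := by
    rw [← Complex.normSq_apply, Complex.normSq_eq_norm_sq]; exact pow_le_one₀ (norm_nonneg _) hw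
  rw [← Complex.normSq_eq_norm_sq, ← Complex.normSq_eq_norm_sq, Complex.normSq_apply,
    Complex.normSq_apply]
  simp only [Complex.sub_re, Complex.sub_im, Complex.mul_re, Complex.mul_im, Complex.conj_re,
    Complex.conj_im, Complex.one_re, Complex.one_im]
  nlinarith [mul_nonneg (sub_nonneg.2 hz2) (sub_nonneg.2 hw2)]

/-- Interpolation between the Lipschitz bound `n|z-w|` and the trivial bound `2`, both carrying
`max(|z|,|w|)^{n-1}`: `min(u², 4) ≤ 4 u^γ` for `0 < γ ≤ 2`. The gain `|1 - z w̄|^γ` makes the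
singular kernel integrable, at the price `n^γ`. -/
theorem norm_pow_sub_pow_sq_le {z w : ℂ} (hz : ‖z‖ ≤ 1) (hw : ‖w‖ ≤ 1) {γ : ℝ} (h0 : 0 < γ)
    (h2 : γ ≤ 2) {n : ℕ} (hn : 0 < n) :
    ‖z ^ n - w ^ n‖ ^ 2 ≤ 4 * (n : ℝ) ^ γ * ‖1 - z * starRingEnd ℂ w‖ ^ γ *
      (‖z‖ ^ (2 * (n - 1)) + ‖w‖ ^ (2 * (n - 1))) := by
  set M := max ‖z‖ ‖w‖ with hM
  have hM0 : 0 ≤ M := (norm_nonneg z).trans (le_max_left _ _)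
  have hM1 : M ≤ 1 := max_le hz hw
  set u := n * ‖z - w‖ with hu
  have hu0 : 0 ≤ u := by positivity
  have hA : ‖z ^ n - w ^ n‖ ≤ M ^ (n - 1) * u :=
    norm_pow_sub_pow_le (le_max_left _ _) (le_max_right _ _) n
  have hB : ‖z ^ n - w ^ n‖ ≤ M ^ (n - 1) * 2 := by
    have hMn : M ^ n ≤ M ^ (n - 1) := pow_le_pow_of_le_one hM0 hM1 (Nat.sub_le _ _)
    have h1 : ‖z‖ ^ n ≤ M ^ n := pow_le_pow_left₀ (norm_nonneg _) (le_max_left _ _) n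
    have h2 : ‖w‖ ^ n ≤ M ^ n := pow_le_pow_left₀ (norm_nonneg _) (le_max_right _ _) n
    refine (norm_sub_le _ _).trans ?_
    rw [norm_pow, norm_pow]
    linarith
  have hC : ‖z ^ n - w ^ n‖ ^ 2 ≤ (M ^ (n - 1)) ^ 2 * (4 * u ^ γ) := by
    rcases le_total u 1 with h | h
    · calc ‖z ^ n - w ^ n‖ ^ 2 ≤ (M ^ (n - 1) * u) ^ 2 :=
            pow_le_pow_left₀ (norm_nonneg _) hA 2
        _ = (M ^ (n - 1)) ^ 2 * u ^ 2 := mul_pow _ _ _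
        _ ≤ (M ^ (n - 1)) ^ 2 * (4 * u ^ γ) := by
            refine mul_le_mul_of_nonneg_left ?_ (by positivity)
            have : u ^ 2 ≤ u ^ γ := by
              rcases hu0.eq_or_lt with h' | h'
              · rw [← h']; simp [Real.zero_rpow h0.ne']
              · rw [← Real.rpow_natCast]
                exact Real.rpow_le_rpow_of_exponent_ge h' h (by simpa using h2)
            have : 0 ≤ u ^ γ := by positivity
            linarith
    · calc ‖z ^ n - w ^ n‖ ^ 2 ≤ (M ^ (n - 1) * 2) ^ 2 :=
            pow_le_pow_left₀ (norm_nonneg _) hB 2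
        _ = (M ^ (n - 1)) ^ 2 * 4 := by ring
        _ ≤ (M ^ (n - 1)) ^ 2 * (4 * u ^ γ) := by
            refine mul_le_mul_of_nonneg_left ?_ (by positivity)
            have := Real.one_le_rpow h h0.le
            linarith
  have hD : (M ^ (n - 1)) ^ 2 ≤ ‖z‖ ^ (2 * (n - 1)) + ‖w‖ ^ (2 * (n - 1)) := by
    rw [← pow_mul, mul_comm (n - 1)]
    rcases max_choice ‖z‖ ‖w‖ with h | h <;> rw [hM, h]
    · exact le_add_of_nonneg_right (by positivity)
    · exact le_add_of_nonneg_left (by positivity)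
  have hE : u ^ γ ≤ (n : ℝ) ^ γ * ‖1 - z * starRingEnd ℂ w‖ ^ γ := by
    rw [hu, Real.mul_rpow (by positivity) (norm_nonneg _)]
    refine mul_le_mul_of_nonneg_left ?_ (by positivity)
    exact Real.rpow_le_rpow (norm_nonneg _) (norm_sub_le_norm_one_sub_mul_conj hz hw) h0.le
  calc _ ≤ _ := hC
    _ ≤ (‖z‖ ^ (2 * (n - 1)) + ‖w‖ ^ (2 * (n - 1))) *
        (4 * ((n : ℝ) ^ γ * ‖1 - z * starRingEnd ℂ w‖ ^ γ)) := by gcongr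
    _ = _ := by ring

/-- The weight `y^{a-1} e^{-y/4}` integrated against powers of `1 - e^{-y/2}`. -/
theorem lintegral_exp_mul_one_sub_exp_rpow_le {γ q : ℝ} (hγ : 0 < γ) (hq : 0 ≤ q) :
    ∃ C : ℝ, 0 < C ∧ ∀ n : ℕ, 0 < n →
      ENNReal.ofReal ((n : ℝ) ^ γ) * ∫⁻ y in Ioi (0 : ℝ), ENNReal.ofReal
        (y ^ (γ + q - 1) * Real.exp (-(n * y) / 2) * (1 - Real.exp (-y / 2)) ^ (-q)) ≤
        ENNReal.ofReal C := by
  obtain ⟨C, hC1, hC⟩ := exp_mul_one_sub_exp_rpow_neg_le hq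
  have hΓ := Real.Gamma_pos_of_pos hγ
  refine ⟨C * (4 ^ γ * Real.Gamma γ), by positivity, fun n hn => ?_⟩
  have hn' : (1 : ℝ) ≤ n := by exact_mod_cast hn
  calc _ ≤ ENNReal.ofReal ((n : ℝ) ^ γ) * (ENNReal.ofReal C * ∫⁻ y in Ioi (0 : ℝ),
          ENNReal.ofReal (y ^ (γ - 1) * Real.exp (-(n / 4 * y)))) := by
        refine mul_le_mul_right ?_ _
        rw [← lintegral_const_mul' _ _ ENNReal.ofReal_ne_top]
        refine setLIntegral_mono' measurableSet_Ioi fun y hy => ?_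
        have hy : 0 < y := hy
        rw [← ENNReal.ofReal_mul (by linarith)]
        refine ENNReal.ofReal_le_ofReal ?_
        have h1 : Real.exp (-(n * y) / 2) ≤ Real.exp (-(n / 4 * y)) * Real.exp (-y / 4) := by
          rw [← Real.exp_add]
          refine Real.exp_le_exp.2 ?_
          nlinarith
        have h2 := one_sub_exp_neg_half_pos hy
        calc y ^ (γ + q - 1) * Real.exp (-(n * y) / 2) * (1 - Real.exp (-y / 2)) ^ (-q)
            ≤ y ^ (γ + q - 1) * (Real.exp (-(n / 4 * y)) * Real.exp (-y / 4)) *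
              (1 - Real.exp (-y / 2)) ^ (-q) := by gcongr
          _ = y ^ (γ + q - 1) * Real.exp (-(n / 4 * y)) *
              (Real.exp (-y / 4) * (1 - Real.exp (-y / 2)) ^ (-q)) := by ring
          _ ≤ y ^ (γ + q - 1) * Real.exp (-(n / 4 * y)) * (C * y ^ (-q)) :=
              mul_le_mul_of_nonneg_left (hC y hy) (by positivity)
          _ = C * ((y ^ (γ + q - 1) * y ^ (-q)) * Real.exp (-(n / 4 * y))) := by ring
          _ = _ := by rw [← Real.rpow_add hy]; ring_nf
    _ = ENNReal.ofReal (C * (4 ^ γ * Real.Gamma γ)) := by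
        rw [lintegral_rpow_mul_exp_neg_le hγ hn, ← ENNReal.ofReal_mul (by linarith),
          ← ENNReal.ofReal_mul (by positivity)]
        congr 1
        rw [one_div_div, Real.div_rpow (by norm_num) (by positivity)]
        have : (n : ℝ) ^ γ ≠ 0 := by positivity
        field_simp

theorem measurable_kernel_integral (p : ℝ) : Measurable fun q : ℝ × ℝ =>
    ∫⁻ τ, ENNReal.ofReal (‖1 - circleMap 0 (Real.exp (-q.1 / 2) * Real.exp (-q.2 / 2)) τ‖ ^ (-p))
      ∂circleMeasure := by
  refine Measurable.lintegral_prod_right' (f := fun r : (ℝ × ℝ) × ℝ => ENNReal.ofReal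
    (‖1 - circleMap 0 (Real.exp (-r.1.1 / 2) * Real.exp (-r.1.2 / 2)) r.2‖ ^ (-p))) ?_
  unfold circleMap
  fun_prop

/-- The power `|1 - z w̄|^γ` lowers the kernel exponent to `2+α-γ`, and the two terms decay like
`e^{-nx/2}` and `e^{-ny/2}`. The idle factor `x^{1-1}` gives the second term the shape of
`lintegral_radial_kernel_le` with `a = 1`. -/
theorem monomial_integrand_le {α γ : ℝ} (hγ0 : 0 < γ) (hγ2 : γ ≤ 2) {n : ℕ} (hn : 0 < n)
    {x y : ℝ} (hx : 0 < x) (hy : 0 < y) (τ : ℝ) :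
    ‖circleMap 0 (Real.exp (-x / 2)) τ ^ n - (Real.exp (-y / 2) : ℂ) ^ n‖ ^ 2 *
        (Real.exp (-x) * (y ^ (α - 1) * Real.exp (-y / 2) *
        ‖1 - circleMap 0 (Real.exp (-x / 2) * Real.exp (-y / 2)) τ‖ ^ (-(2 + α)))) ≤
      4 * (n : ℝ) ^ γ * (y ^ (α - 1) * (Real.exp (-(n * x) / 2) * Real.exp (-y / 4)
            + Real.exp (-(n * y) / 2) * (x ^ ((1 : ℝ) - 1) * Real.exp (-x / 4)))) *
        ‖1 - circleMap 0 (Real.exp (-x / 2) * Real.exp (-y / 2)) τ‖ ^ (-(2 + α - γ)) := by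
  have hn' : (1 : ℝ) ≤ n := by exact_mod_cast hn
  set r := Real.exp (-x / 2) with hr
  set s := Real.exp (-y / 2) with hs
  have hr0 : 0 < r := Real.exp_pos _
  have hs0 : 0 < s := Real.exp_pos _
  have hr1 : r < 1 := Real.exp_lt_one_iff.2 (by linarith)
  have hs1 : s < 1 := Real.exp_lt_one_iff.2 (by linarith)
  have hzr : ‖circleMap 0 r τ‖ = r := by simp [abs_of_pos hr0]
  have hws : ‖(s : ℂ)‖ = s := by simp [abs_of_pos hs0]
  have h := norm_pow_sub_pow_sq_le (z := circleMap 0 r τ) (w := (s : ℂ)) (by rw [hzr]; exact hr1.le)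
    (by rw [hws]; exact hs1.le) hγ0 hγ2 hn
  have hmul : circleMap 0 r τ * starRingEnd ℂ (s : ℂ) = circleMap 0 (r * s) τ := by
    simp [circleMap]; ring
  rw [hmul, hzr, hws] at h
  set N := ‖1 - circleMap 0 (r * s) τ‖ with hN
  have hN0 : 0 < N := by
    have := one_sub_le_norm_one_sub (w := circleMap 0 (r * s) τ)
    have h3 : ‖circleMap 0 (r * s) τ‖ = r * s := by simp [abs_of_pos hr0, abs_of_pos hs0]
    rw [h3] at this
    nlinarith
  have hNp : N ^ γ * N ^ (-(2 + α)) = N ^ (-(2 + α - γ)) := by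
    rw [← Real.rpow_add hN0]; congr 1; ring
  have hcast : ((n - 1 : ℕ) : ℝ) = n - 1 := by push_cast [hn]; ring
  have er : r ^ (2 * (n - 1)) * (Real.exp (-x) * Real.exp (-y / 2)) ≤
      Real.exp (-(n * x) / 2) * Real.exp (-y / 4) := by
    rw [hr, ← Real.exp_nat_mul, ← Real.exp_add, ← Real.exp_add, ← Real.exp_add]
    refine Real.exp_le_exp.2 ?_
    push_cast [hcast]
    nlinarith
  have es : s ^ (2 * (n - 1)) * (Real.exp (-x) * Real.exp (-y / 2)) ≤
      Real.exp (-(n * y) / 2) * (x ^ ((1 : ℝ) - 1) * Real.exp (-x / 4)) := by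
    rw [sub_self, Real.rpow_zero, one_mul, hs, ← Real.exp_nat_mul, ← Real.exp_add,
      ← Real.exp_add, ← Real.exp_add]
    refine Real.exp_le_exp.2 ?_
    push_cast [hcast]
    nlinarith
  calc _ ≤ (4 * (n : ℝ) ^ γ * N ^ γ * (r ^ (2 * (n - 1)) + s ^ (2 * (n - 1)))) *
        (Real.exp (-x) * (y ^ (α - 1) * Real.exp (-y / 2) * N ^ (-(2 + α)))) :=
        mul_le_mul_of_nonneg_right h (by positivity)
    _ = 4 * (n : ℝ) ^ γ * (y ^ (α - 1) * (r ^ (2 * (n - 1)) * (Real.exp (-x) * Real.exp (-y / 2))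
          + s ^ (2 * (n - 1)) * (Real.exp (-x) * Real.exp (-y / 2)))) *
          (N ^ γ * N ^ (-(2 + α))) := by ring
    _ ≤ 4 * (n : ℝ) ^ γ * (y ^ (α - 1) * (Real.exp (-(n * x) / 2) * Real.exp (-y / 4)
          + Real.exp (-(n * y) / 2) * (x ^ ((1 : ℝ) - 1) * Real.exp (-x / 4)))) * N ^ (-(2 + α - γ)) := by
        rw [hNp]; gcongr

theorem lintegral_monomial_integrand_le {α γ : ℝ} (hγ0 : 0 < γ) (hγ2 : γ ≤ 2) {n : ℕ}
    (hn : 0 < n) {x y : ℝ} (hx : 0 < x) (hy : 0 < y) :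
    (∫⁻ τ, ENNReal.ofReal
      (‖circleMap 0 (Real.exp (-x / 2)) τ ^ n - (Real.exp (-y / 2) : ℂ) ^ n‖ ^ 2 *
        (Real.exp (-x) * (y ^ (α - 1) * Real.exp (-y / 2) *
        ‖1 - circleMap 0 (Real.exp (-x / 2) * Real.exp (-y / 2)) τ‖ ^ (-(2 + α)))))
        ∂circleMeasure) ≤
      ENNReal.ofReal (4 * (n : ℝ) ^ γ) *
        (ENNReal.ofReal (Real.exp (-(n * x) / 2)) *
          (ENNReal.ofReal (y ^ (α - 1) * Real.exp (-y / 4)) * ∫⁻ τ, ENNReal.ofReal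
            (‖1 - circleMap 0 (Real.exp (-x / 2) * Real.exp (-y / 2)) τ‖ ^ (-(2 + α - γ)))
              ∂circleMeasure) +
        ENNReal.ofReal (y ^ (α - 1) * Real.exp (-(n * y) / 2)) *
          (ENNReal.ofReal (x ^ ((1 : ℝ) - 1) * Real.exp (-x / 4)) * ∫⁻ τ, ENNReal.ofReal
            (‖1 - circleMap 0 (Real.exp (-x / 2) * Real.exp (-y / 2)) τ‖ ^ (-(2 + α - γ)))
              ∂circleMeasure)) := by
  have hsplit : ENNReal.ofReal (4 * (n : ℝ) ^ γ *
      (y ^ (α - 1) * (Real.exp (-(n * x) / 2) * Real.exp (-y / 4)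
            + Real.exp (-(n * y) / 2) * (x ^ ((1 : ℝ) - 1) * Real.exp (-x / 4))))) =
      ENNReal.ofReal (4 * (n : ℝ) ^ γ) * (ENNReal.ofReal (Real.exp (-(n * x) / 2)) *
        ENNReal.ofReal (y ^ (α - 1) * Real.exp (-y / 4)) +
        ENNReal.ofReal (y ^ (α - 1) * Real.exp (-(n * y) / 2)) *
        ENNReal.ofReal (x ^ ((1 : ℝ) - 1) * Real.exp (-x / 4))) := by
    rw [← ENNReal.ofReal_mul (by positivity), ← ENNReal.ofReal_mul (by positivity),
      ← ENNReal.ofReal_add (by positivity) (by positivity), ← ENNReal.ofReal_mul (by positivity)]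
    congr 1
    ring
  calc _ ≤ ∫⁻ τ, ENNReal.ofReal (4 * (n : ℝ) ^ γ *
        (y ^ (α - 1) * (Real.exp (-(n * x) / 2) * Real.exp (-y / 4)
            + Real.exp (-(n * y) / 2) * (x ^ ((1 : ℝ) - 1) * Real.exp (-x / 4))))) *
        ENNReal.ofReal (‖1 - circleMap 0 (Real.exp (-x / 2) * Real.exp (-y / 2)) τ‖ ^
          (-(2 + α - γ))) ∂circleMeasure := by
        refine lintegral_mono fun τ => ?_
        rw [← ENNReal.ofReal_mul (by positivity)]
        exact ENNReal.ofReal_le_ofReal (monomial_integrand_le hγ0 hγ2 hn hx hy τ)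
    _ = _ := by
        rw [lintegral_const_mul' _ _ ENNReal.ofReal_ne_top, hsplit]
        ring

/-- Each of the two terms is integrated first in the radial variable without the factor `n` in its
exponential. What remains has order `n^γ ∫ t^{γ-1} e^{-nt/4} dt`, which does not depend on `n`. -/
theorem lintegral_monomial_le {α : ℝ} (hα : 0 < α) : ∃ C : ℝ, 0 < C ∧ ∀ n : ℕ,
    ∫⁻ x in Ioi (0 : ℝ), ∫⁻ y in Ioi (0 : ℝ), ∫⁻ τ,
      ENNReal.ofReal (‖circleMap 0 (Real.exp (-x / 2)) τ ^ n - (Real.exp (-y / 2) : ℂ) ^ n‖ ^ 2 *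
        (Real.exp (-x) * (y ^ (α - 1) * Real.exp (-y / 2) *
        ‖1 - circleMap 0 (Real.exp (-x / 2) * Real.exp (-y / 2)) τ‖ ^ (-(2 + α)))))
        ∂circleMeasure ≤ ENNReal.ofReal C := by
  -- Integrating in `y` first needs `γ < 1`, integrating in `x` first needs `γ < α`; this is where
  -- positivity of `α` enters.
  obtain ⟨γ, hγ0, hγ1, hγα⟩ : ∃ γ : ℝ, 0 < γ ∧ γ < 1 ∧ γ < α :=
    ⟨min α 1 / 2, by have := lt_min hα one_pos; positivity,
      by have := min_le_right α 1; linarith, by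
      have := min_le_left α 1; linarith⟩
  obtain ⟨C₁, hC₁, h₁⟩ := lintegral_radial_kernel_le (a := α) (p := 2 + α - γ) hα (by linarith)
  obtain ⟨C₂, hC₂, h₂⟩ := lintegral_radial_kernel_le (a := 1) (p := 2 + α - γ) one_pos (by linarith)
  obtain ⟨D₁, hD₁, k₁⟩ := lintegral_exp_mul_one_sub_exp_rpow_le (γ := γ) (q := 1 - γ) hγ0
    (by linarith)
  obtain ⟨D₂, hD₂, k₂⟩ := lintegral_exp_mul_one_sub_exp_rpow_le (γ := γ) (q := α - γ) hγ0
    (by linarith)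
  refine ⟨4 * (C₁ * D₁ + C₂ * D₂), by positivity, fun n => ?_⟩
  rcases Nat.eq_zero_or_pos n with rfl | hn
  · simp
  have hn' : (1 : ℝ) ≤ n := by exact_mod_cast hn
  obtain ⟨J, hJdef⟩ : ∃ J : ℝ → ℝ → ℝ≥0∞, ∀ x y, J x y = ∫⁻ τ, ENNReal.ofReal
    (‖1 - circleMap 0 (Real.exp (-x / 2) * Real.exp (-y / 2)) τ‖ ^ (-(2 + α - γ)))
      ∂circleMeasure := ⟨_, fun _ _ => rfl⟩
  have hJ : Measurable fun q : ℝ × ℝ => J q.1 q.2 := by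
    simp_rw [hJdef]; exact measurable_kernel_integral _
  have hJsymm (x y : ℝ) : J x y = J y x := by rw [hJdef, hJdef, mul_comm]
  simp_rw [← hJdef] at h₁ h₂
  let A (x y : ℝ) : ℝ≥0∞ := ENNReal.ofReal (Real.exp (-(n * x) / 2)) *
    (ENNReal.ofReal (y ^ (α - 1) * Real.exp (-y / 4)) * J x y)
  let B (x y : ℝ) : ℝ≥0∞ := ENNReal.ofReal (y ^ (α - 1) * Real.exp (-(n * y) / 2)) *
    (ENNReal.ofReal (x ^ ((1 : ℝ) - 1) * Real.exp (-x / 4)) * J y x)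
  have hAm : Measurable fun q : ℝ × ℝ => A q.1 q.2 := by
    have m₁ : Measurable fun q : ℝ × ℝ => ENNReal.ofReal (Real.exp (-(n * q.1) / 2)) := by fun_prop
    have m₂ : Measurable fun q : ℝ × ℝ =>
      ENNReal.ofReal (q.2 ^ (α - 1) * Real.exp (-q.2 / 4)) := by fun_prop
    exact m₁.mul (m₂.mul hJ)
  have hBm : Measurable fun q : ℝ × ℝ => B q.1 q.2 := by
    have : Measurable fun q : ℝ × ℝ => J q.2 q.1 := hJ.comp measurable_swap
    have m₁ : Measurable fun q : ℝ × ℝ =>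
      ENNReal.ofReal (q.2 ^ (α - 1) * Real.exp (-(n * q.2) / 2)) := by fun_prop
    have m₂ : Measurable fun q : ℝ × ℝ =>
      ENNReal.ofReal (q.1 ^ ((1 : ℝ) - 1) * Real.exp (-q.1 / 4)) := by fun_prop
    exact m₁.mul (m₂.mul this)
  have hpt : ∀ x ∈ Ioi (0 : ℝ), ∀ y ∈ Ioi (0 : ℝ), (∫⁻ τ,
      ENNReal.ofReal (‖circleMap 0 (Real.exp (-x / 2)) τ ^ n - (Real.exp (-y / 2) : ℂ) ^ n‖ ^ 2 *
        (Real.exp (-x) * (y ^ (α - 1) * Real.exp (-y / 2) *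
        ‖1 - circleMap 0 (Real.exp (-x / 2) * Real.exp (-y / 2)) τ‖ ^ (-(2 + α)))))
        ∂circleMeasure) ≤ ENNReal.ofReal (4 * (n : ℝ) ^ γ) * (A x y + B x y) := fun x hx y hy => by
    have h := lintegral_monomial_integrand_le (α := α) hγ0 (by linarith) hn hx hy
    simp only [A, B, hJsymm y x]
    simp_rw [← hJdef] at h
    exact h
  have hAint : ENNReal.ofReal ((n : ℝ) ^ γ) *
      ∫⁻ x in Ioi (0 : ℝ), ∫⁻ y in Ioi (0 : ℝ), A x y ≤ ENNReal.ofReal (C₁ * D₁) := by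
    rw [ENNReal.ofReal_mul hC₁.le]
    refine le_trans ?_ (mul_le_mul_right (k₁ n hn) _)
    rw [mul_left_comm]
    refine mul_le_mul_right ?_ _
    rw [← lintegral_const_mul' _ _ ENNReal.ofReal_ne_top]
    refine setLIntegral_mono' measurableSet_Ioi fun x hx => ?_
    have hx : 0 < x := hx
    simp only [A]
    rw [lintegral_const_mul' _ _ ENNReal.ofReal_ne_top]
    refine (mul_le_mul_right (h₁ x hx) _).trans_eq ?_
    have := one_sub_exp_neg_half_pos hx
    rw [← ENNReal.ofReal_mul (by positivity), ← ENNReal.ofReal_mul (by positivity)]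
    congr 1
    rw [show γ + (1 - γ) - 1 = 0 by ring, Real.rpow_zero,
      show α - (2 + α - γ - 1) = -(1 - γ) by ring]
    ring
  have hBint : ENNReal.ofReal ((n : ℝ) ^ γ) *
      ∫⁻ x in Ioi (0 : ℝ), ∫⁻ y in Ioi (0 : ℝ), B x y ≤ ENNReal.ofReal (C₂ * D₂) := by
    rw [lintegral_lintegral_swap hBm.aemeasurable, ENNReal.ofReal_mul hC₂.le]
    refine le_trans ?_ (mul_le_mul_right (k₂ n hn) _)
    rw [mul_left_comm]
    refine mul_le_mul_right ?_ _
    rw [← lintegral_const_mul' _ _ ENNReal.ofReal_ne_top]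
    refine setLIntegral_mono' measurableSet_Ioi fun y hy => ?_
    have hy : 0 < y := hy
    simp only [B]
    rw [lintegral_const_mul' _ _ ENNReal.ofReal_ne_top]
    refine (mul_le_mul_right (h₂ y hy) _).trans_eq ?_
    have := one_sub_exp_neg_half_pos hy
    rw [← ENNReal.ofReal_mul (by positivity), ← ENNReal.ofReal_mul (by positivity)]
    congr 1
    rw [show γ + (α - γ) - 1 = α - 1 by ring, show 1 - (2 + α - γ - 1) = -(α - γ) by ring]
    ring
  calc _ ≤ ∫⁻ x in Ioi (0 : ℝ), ∫⁻ y in Ioi (0 : ℝ),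
          ENNReal.ofReal (4 * (n : ℝ) ^ γ) * (A x y + B x y) :=
        setLIntegral_mono' measurableSet_Ioi fun x hx =>
          setLIntegral_mono' measurableSet_Ioi fun y hy => hpt x hx y hy
    _ = ENNReal.ofReal 4 * (ENNReal.ofReal ((n : ℝ) ^ γ) *
          (∫⁻ x in Ioi (0 : ℝ), ∫⁻ y in Ioi (0 : ℝ), A x y) + ENNReal.ofReal ((n : ℝ) ^ γ) *
          ∫⁻ x in Ioi (0 : ℝ), ∫⁻ y in Ioi (0 : ℝ), B x y) := by
        simp_rw [lintegral_const_mul' _ _ ENNReal.ofReal_ne_top]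
        rw [← mul_add, ← mul_assoc, ← ENNReal.ofReal_mul (by norm_num)]
        congr 1
        rw [← lintegral_add_left hAm.lintegral_prod_right']
        refine lintegral_congr fun x => ?_
        exact lintegral_add_left (hAm.comp measurable_prodMk_left) _
    _ ≤ ENNReal.ofReal 4 * (ENNReal.ofReal (C₁ * D₁) + ENNReal.ofReal (C₂ * D₂)) := by gcongr
    _ = _ := by
        rw [← ENNReal.ofReal_add (by positivity) (by positivity),
          ← ENNReal.ofReal_mul (by norm_num)]

end MonomialEstimate

/-! ### The averaging error in logarithmic polar coordinates -/

section LogPolar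

/-- The point of the disc with logarithmic polar coordinates `(x, θ)`. -/
def logPolar (x θ : ℝ) : ℂ := circleMap 0 (Real.exp (-x / 2)) θ

theorem measurable_logPolar : Measurable fun q : ℝ × ℝ => logPolar q.1 q.2 := by
  unfold logPolar circleMap; fun_prop

theorem norm_logPolar (x θ : ℝ) : ‖logPolar x θ‖ = Real.exp (-x / 2) := by
  simp [logPolar, abs_of_pos (Real.exp_pos _)]

theorem logPolar_mem_ball {x : ℝ} (hx : 0 < x) (θ : ℝ) : logPolar x θ ∈ ball (0 : ℂ) 1 := by
  rw [mem_ball_zero_iff, norm_logPolar]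
  exact Real.exp_lt_one_iff.2 (by linarith)

theorem logPolar_periodic (x : ℝ) : Function.Periodic (logPolar x) (2 * π) :=
  periodic_circleMap 0 _

theorem logPolar_mul_conj (x y θ ψ : ℝ) : logPolar x θ * starRingEnd ℂ (logPolar y ψ) =
    circleMap 0 (Real.exp (-x / 2) * Real.exp (-y / 2)) (θ - ψ) := by
  simp only [logPolar, circleMap, zero_add, map_mul, Complex.conj_ofReal, ← Complex.exp_conj,
    Complex.conj_I, Complex.ofReal_mul, Complex.ofReal_sub, sub_mul, Complex.exp_sub]
  rw [mul_neg, Complex.exp_neg]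
  field_simp

theorem norm_one_sub_circleMap_neg (r θ : ℝ) :
    ‖1 - circleMap 0 r (-θ)‖ = ‖1 - circleMap 0 r θ‖ := by
  rw [← RCLike.norm_conj (1 - circleMap 0 r θ)]
  congr 1
  simp [circleMap, ← Complex.exp_conj]

/-- The measure `dy dm` in logarithmic polar coordinates. -/
def logPolarMeasure : Measure (ℝ × ℝ) := (volume.restrict (Ioi 0)).prod circleMeasure

theorem ae_logPolarMeasure_mem_Ioi : ∀ᵐ q ∂logPolarMeasure, q.1 ∈ Ioi (0 : ℝ) := by
  have h : ∀ᵐ x ∂(volume.restrict (Ioi (0 : ℝ))), x ∈ Ioi (0 : ℝ) :=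
    ae_restrict_mem measurableSet_Ioi
  exact Measure.quasiMeasurePreserving_fst.ae h

theorem lintegral_logPolarMeasure {F : ℝ × ℝ → ℝ≥0∞} (hF : Measurable F) :
    ∫⁻ p, F p ∂logPolarMeasure = ∫⁻ y in Ioi (0 : ℝ), ∫⁻ ψ, F (y, ψ) ∂circleMeasure :=
  lintegral_prod _ hF.aemeasurable

/-- Cauchy-Schwarz for the measure `k μ`, obtained by splitting `k` into two square roots. -/
theorem lintegral_mul_sq_le {Ω : Type*} [MeasurableSpace Ω] {μ : Measure Ω} {a k : Ω → ℝ≥0∞}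
    (ha : Measurable a) (hk : Measurable k) :
    (∫⁻ ω, a ω * k ω ∂μ) ^ 2 ≤ (∫⁻ ω, k ω ∂μ) * ∫⁻ ω, a ω ^ 2 * k ω ∂μ := by
  have hsq (t : ℝ≥0∞) : t ^ (1 / 2 : ℝ) * t ^ (1 / 2 : ℝ) = t := by
    rw [← ENNReal.rpow_add_of_nonneg _ _ (by norm_num) (by norm_num)]; norm_num
  have h := ENNReal.lintegral_mul_le_Lp_mul_Lq μ (p := 2) (q := 2)
    (f := fun ω => a ω * k ω ^ (1 / 2 : ℝ)) (g := fun ω => k ω ^ (1 / 2 : ℝ))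
    Real.HolderConjugate.two_two (by fun_prop) (by fun_prop)
  have h1 : (∫⁻ ω, a ω * k ω ∂μ) =
      ∫⁻ ω, ((fun ω => a ω * k ω ^ (1 / 2 : ℝ)) * fun ω => k ω ^ (1 / 2 : ℝ)) ω ∂μ :=
    lintegral_congr fun ω => by rw [Pi.mul_apply, mul_assoc, hsq]
  rw [h1]
  refine (pow_le_pow_left₀ zero_le h 2).trans_eq ?_
  have h2 (t : ℝ≥0∞) : (t ^ (1 / 2 : ℝ)) ^ 2 = t := by rw [sq, hsq]
  rw [mul_pow, h2, h2, mul_comm]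
  simp only [ENNReal.rpow_two, mul_pow, h2]

variable {H : Type*} [NormedAddCommGroup H] [InnerProductSpace ℂ H] [CompleteSpace H]

theorem measurable_hardySpace (f : HardySpace ℂ) : Measurable (f : ℂ → ℂ) := by
  refine measurable_of_restrict_of_restrict_compl (measurableSet_ball (x := (0 : ℂ)) (ε := 1))
    (continuousOn_iff_continuous_domRestrict.1 f.2.1.continuousOn).measurable ?_
  have h : (ball (0 : ℂ) 1)ᶜ.domRestrict (f : ℂ → ℂ) = fun _ => 0 :=
    funext fun z => f.2.2.1 z z.2
  exact h ▸ measurable_const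

/-- The absolute value of the reproducing kernel with its radial weight. -/
def errorKernel (α : ℝ) (z : ℂ) (y ψ : ℝ) : ℝ≥0∞ :=
  ENNReal.ofReal (y ^ (α - 1) * Real.exp (-y / 2) *
    ‖1 - z * starRingEnd ℂ (logPolar y ψ)‖ ^ (-(2 + α)))

theorem measurable_errorKernel (α : ℝ) :
    Measurable fun r : ℂ × (ℝ × ℝ) => errorKernel α r.1 r.2.1 r.2.2 := by
  have h : Measurable fun r : ℂ × (ℝ × ℝ) => logPolar r.2.1 r.2.2 :=
    measurable_logPolar.comp measurable_snd
  have h1 : Measurable fun r : ℂ × (ℝ × ℝ) => starRingEnd ℂ (logPolar r.2.1 r.2.2) :=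
    Complex.continuous_conj.measurable.comp h
  unfold errorKernel
  fun_prop

/-- The total mass of the kernel: the radial estimate with `a = α`, `p = 2+α` has exponent `-1`, the
growth that the Bergman weight can absorb. -/
theorem lintegral_errorKernel_le {α : ℝ} (hα : 0 < α) : ∃ C : ℝ, 0 < C ∧ ∀ x θ : ℝ, 0 < x →
    ∫⁻ p, errorKernel α (logPolar x θ) p.1 p.2 ∂logPolarMeasure ≤
      ENNReal.ofReal (C * (1 - Real.exp (-x / 2))⁻¹) := by
  obtain ⟨C, hC0, hC⟩ := lintegral_radial_kernel_le (a := α) (p := 2 + α) hα (by linarith)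
  refine ⟨C, hC0, fun x θ hx => ?_⟩
  have h := hC x hx
  rw [show α - (2 + α - 1) = -1 by ring, Real.rpow_neg_one] at h
  refine le_trans ?_ h
  have hm : Measurable fun p : ℝ × ℝ => errorKernel α (logPolar x θ) p.1 p.2 :=
    (measurable_errorKernel α).comp measurable_prodMk_left
  rw [lintegral_logPolarMeasure hm]
  refine setLIntegral_mono' measurableSet_Ioi fun y hy => ?_
  have hy : 0 < y := hy
  have hper : Function.Periodic (fun τ => ENNReal.ofReal
      (‖1 - circleMap 0 (Real.exp (-x / 2) * Real.exp (-y / 2)) τ‖ ^ (-(2 + α)))) (2 * π) :=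
    fun τ => by simp only [periodic_circleMap 0 _ τ]
  rw [← lintegral_circleMeasure_add_right hper (-θ),
    ← lintegral_const_mul' _ _ ENNReal.ofReal_ne_top]
  refine lintegral_mono fun ψ => ?_
  rw [errorKernel, logPolar_mul_conj, ← norm_one_sub_circleMap_neg, neg_sub,
    ← ENNReal.ofReal_mul (by positivity), ← sub_eq_add_neg]
  refine ENNReal.ofReal_le_ofReal ?_
  have : Real.exp (-y / 2) ≤ Real.exp (-y / 4) := Real.exp_le_exp.2 (by linarith)
  gcongr

/-- Angular averages of differences, by Parseval's identity. -/
theorem lintegral_enorm_sq_sub_logPolar (f : HardySpace ℂ) {x y : ℝ} (hx : 0 < x) (hy : 0 < y)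
    (τ : ℝ) :
    ∫⁻ ψ, ‖f (logPolar x (τ + ψ)) - f (logPolar y ψ)‖ₑ ^ 2 ∂circleMeasure =
      ∑' n, ‖taylorCoeff f n‖ₑ ^ 2 *
        ‖circleMap 0 (Real.exp (-x / 2)) τ ^ n - (Real.exp (-y / 2) : ℂ) ^ n‖ₑ ^ 2 := by
  set a := taylorCoeff f with ha
  have hd : DiscSummable 1 a := discSummable_taylorCoeff f.2.1
  have hr1 : Real.exp (-x / 2) < 1 := Real.exp_lt_one_iff.2 (by linarith)
  have hs1 : Real.exp (-y / 2) < 1 := Real.exp_lt_one_iff.2 (by linarith)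
  have hsum : Summable fun n =>
      ‖(circleMap 0 (Real.exp (-x / 2)) τ ^ n - (Real.exp (-y / 2) : ℂ) ^ n) * a n‖ := by
    refine Summable.of_nonneg_of_le (fun _ => norm_nonneg _) (fun n => ?_)
      ((hd _ (Real.exp_pos _).le hr1).add (hd _ (Real.exp_pos _).le hs1))
    rw [norm_mul, ← add_mul]
    refine mul_le_mul_of_nonneg_right ((norm_sub_le _ _).trans_eq ?_) (norm_nonneg _)
    rw [norm_pow, norm_pow, Complex.norm_of_nonneg (Real.exp_pos _).le]
    simp [abs_of_pos (Real.exp_pos _)]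
  have h := lintegral_enorm_sq_circle_series hsum
  simp_rw [enorm_mul, mul_pow] at h
  simp_rw [mul_comm (‖a _‖ₑ ^ 2)]
  rw [← h]
  refine lintegral_congr fun ψ => ?_
  congr 2
  have hz : logPolar x (τ + ψ) ∈ ball (0 : ℂ) 1 := logPolar_mem_ball hx _
  have hw : logPolar y ψ ∈ ball (0 : ℂ) 1 := logPolar_mem_ball hy _
  rw [← ((hasSum_taylorCoeff f.2.1 hz).sub (hasSum_taylorCoeff f.2.1 hw)).tsum_eq]
  refine tsum_congr fun n => ?_
  -- Both points are rotated by the common angle `ψ`, so the difference is a Fourier series in `ψ`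
  -- with coefficients `f̂(n) (zⁿ - sⁿ)`.
  have e1 : logPolar x (τ + ψ) = circleMap 0 1 ψ * circleMap 0 (Real.exp (-x / 2)) τ := by
    simp only [logPolar, circleMap, zero_add, Complex.ofReal_add, add_mul, Complex.exp_add,
      Complex.ofReal_one, one_mul]
    ring
  have e2 : logPolar y ψ = circleMap 0 1 ψ * (Real.exp (-y / 2) : ℂ) := by
    simp only [logPolar, circleMap, zero_add, Complex.ofReal_one, one_mul]
    ring
  rw [e1, e2, mul_pow, mul_pow]
  simp only [smul_eq_mul]
  ring

/-- The integral of the squared differences against the weighted kernel. -/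
theorem lintegral_sub_sq_errorKernel_le {α : ℝ} (hα : 0 < α) : ∃ C : ℝ, 0 < C ∧
    ∀ f : HardySpace ℂ, ∫⁻ q, ENNReal.ofReal (Real.exp (-q.1)) *
      ∫⁻ p, ‖f (logPolar q.1 q.2) - f (logPolar p.1 p.2)‖ₑ ^ 2 *
        errorKernel α (logPolar q.1 q.2) p.1 p.2 ∂logPolarMeasure ∂logPolarMeasure ≤
      ENNReal.ofReal (C * ‖f‖ ^ 2) := by
  obtain ⟨C, hC0, hC⟩ := lintegral_monomial_le hα
  refine ⟨C, hC0, fun f => ?_⟩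
  have hfm := measurable_hardySpace f
  obtain ⟨Q, hQ⟩ : ∃ Q : ℝ → ℝ → ℝ → ℝ → ℝ≥0∞, ∀ x θ y ψ, Q x θ y ψ =
      ENNReal.ofReal (Real.exp (-x)) * (‖f (logPolar x θ) - f (logPolar y ψ)‖ₑ ^ 2 *
        errorKernel α (logPolar x θ) y ψ) := ⟨_, fun _ _ _ _ => rfl⟩
  have hQm : Measurable fun r : (ℝ × ℝ) × (ℝ × ℝ) => Q r.1.1 r.1.2 r.2.1 r.2.2 := by
    simp_rw [hQ]
    have m1 : Measurable fun r : (ℝ × ℝ) × (ℝ × ℝ) => logPolar r.1.1 r.1.2 :=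
      measurable_logPolar.comp measurable_fst
    have m2 : Measurable fun r : (ℝ × ℝ) × (ℝ × ℝ) => logPolar r.2.1 r.2.2 :=
      measurable_logPolar.comp measurable_snd
    have m3 : Measurable fun r : (ℝ × ℝ) × (ℝ × ℝ) =>
        errorKernel α (logPolar r.1.1 r.1.2) r.2.1 r.2.2 :=
      (measurable_errorKernel α).comp (m1.prodMk measurable_snd)
    have m4 : Measurable fun r : (ℝ × ℝ) × (ℝ × ℝ) =>
        ‖f (logPolar r.1.1 r.1.2) - f (logPolar r.2.1 r.2.2)‖ₑ ^ 2 :=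
      (((hfm.comp m1).sub (hfm.comp m2)).enorm).pow_const 2
    have m5 : Measurable fun r : (ℝ × ℝ) × (ℝ × ℝ) => ENNReal.ofReal (Real.exp (-r.1.1)) := by
      fun_prop
    exact m5.mul (m4.mul m3)
  have hangle : ∀ x ∈ Ioi (0 : ℝ), ∀ y ∈ Ioi (0 : ℝ),
      ∫⁻ θ, ∫⁻ ψ, Q x θ y ψ ∂circleMeasure ∂circleMeasure = ∑' n, ‖taylorCoeff f n‖ₑ ^ 2 *
        ∫⁻ τ, ENNReal.ofReal
          (‖circleMap 0 (Real.exp (-x / 2)) τ ^ n - (Real.exp (-y / 2) : ℂ) ^ n‖ ^ 2 *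
          (Real.exp (-x) * (y ^ (α - 1) * Real.exp (-y / 2) *
          ‖1 - circleMap 0 (Real.exp (-x / 2) * Real.exp (-y / 2)) τ‖ ^ (-(2 + α)))))
          ∂circleMeasure := by
    intro x hx y hy
    have hx : 0 < x := hx
    have hy : 0 < y := hy
    have hm1 : Measurable fun r : ℝ × ℝ => Q x r.1 y r.2 :=
      hQm.comp ((measurable_const.prodMk measurable_fst).prodMk
        (measurable_const.prodMk measurable_snd))
    -- The kernel depends only on `θ - ψ`. After the substitution `θ = τ + ψ` the `ψ`-integral sees
    -- only `f`, and Parseval diagonalizes it.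
    rw [lintegral_lintegral_swap hm1.aemeasurable]
    have hshift (ψ : ℝ) : ∫⁻ θ, Q x θ y ψ ∂circleMeasure =
        ∫⁻ τ, Q x (τ + ψ) y ψ ∂circleMeasure := by
      refine (lintegral_circleMeasure_add_right (F := fun θ => Q x θ y ψ) (fun θ => ?_) ψ).symm
      simp only [hQ, logPolar_periodic x θ]
    simp_rw [hshift]
    have hm2 : Measurable fun r : ℝ × ℝ => Q x (r.2 + r.1) y r.1 :=
      hm1.comp ((measurable_snd.add measurable_fst).prodMk measurable_fst)
    rw [lintegral_lintegral_swap hm2.aemeasurable]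
    have hinner (τ : ℝ) : ∫⁻ ψ, Q x (τ + ψ) y ψ ∂circleMeasure = ∑' n, ‖taylorCoeff f n‖ₑ ^ 2 *
        ENNReal.ofReal
          (‖circleMap 0 (Real.exp (-x / 2)) τ ^ n - (Real.exp (-y / 2) : ℂ) ^ n‖ ^ 2 *
          (Real.exp (-x) * (y ^ (α - 1) * Real.exp (-y / 2) *
          ‖1 - circleMap 0 (Real.exp (-x / 2) * Real.exp (-y / 2)) τ‖ ^ (-(2 + α))))) := by
      have h1 (ψ : ℝ) : Q x (τ + ψ) y ψ = ENNReal.ofReal (Real.exp (-x) * (y ^ (α - 1) *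
          Real.exp (-y / 2) *
          ‖1 - circleMap 0 (Real.exp (-x / 2) * Real.exp (-y / 2)) τ‖ ^ (-(2 + α)))) *
          ‖f (logPolar x (τ + ψ)) - f (logPolar y ψ)‖ₑ ^ 2 := by
        rw [hQ, errorKernel, logPolar_mul_conj, add_sub_cancel_right,
          ENNReal.ofReal_mul (Real.exp_pos (-x)).le]
        ring
      simp_rw [h1]
      rw [lintegral_const_mul' _ _ ENNReal.ofReal_ne_top,
        lintegral_enorm_sq_sub_logPolar f hx hy, ← ENNReal.tsum_mul_left]
      refine tsum_congr fun n => ?_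
      rw [ENNReal.ofReal_mul (sq_nonneg ‖_‖), ENNReal.ofReal_pow (norm_nonneg _), ofReal_norm]
      ring
    simp_rw [hinner]
    rw [lintegral_tsum]
    · refine tsum_congr fun n => ?_
      rw [lintegral_const_mul' _ _ (by simp)]
    · intro n
      refine Measurable.aemeasurable (Measurable.const_mul ?_ _)
      unfold circleMap
      fun_prop
  obtain ⟨R, hR⟩ : ∃ R : ℕ → ℝ → ℝ → ℝ≥0∞, ∀ n x y, R n x y = ∫⁻ τ, ENNReal.ofReal
          (‖circleMap 0 (Real.exp (-x / 2)) τ ^ n - (Real.exp (-y / 2) : ℂ) ^ n‖ ^ 2 *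
          (Real.exp (-x) * (y ^ (α - 1) * Real.exp (-y / 2) *
          ‖1 - circleMap 0 (Real.exp (-x / 2) * Real.exp (-y / 2)) τ‖ ^ (-(2 + α)))))
          ∂circleMeasure := ⟨_, fun _ _ _ => rfl⟩
  have hRm (n : ℕ) : Measurable fun r : ℝ × ℝ => R n r.1 r.2 := by
    simp_rw [hR]
    refine Measurable.lintegral_prod_right' (f := fun r : (ℝ × ℝ) × ℝ => ENNReal.ofReal
          (‖circleMap 0 (Real.exp (-r.1.1 / 2)) r.2 ^ n - (Real.exp (-r.1.2 / 2) : ℂ) ^ n‖ ^ 2 *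
          (Real.exp (-r.1.1) * (r.1.2 ^ (α - 1) * Real.exp (-r.1.2 / 2) *
          ‖1 - circleMap 0 (Real.exp (-r.1.1 / 2) * Real.exp (-r.1.2 / 2)) r.2‖ ^
            (-(2 + α)))))) ?_
    unfold circleMap
    fun_prop
  simp_rw [← hR] at hangle hC
  calc _ = ∫⁻ q, ∫⁻ p, Q q.1 q.2 p.1 p.2 ∂logPolarMeasure ∂logPolarMeasure := by
        refine lintegral_congr fun q => ?_
        rw [← lintegral_const_mul' _ _ ENNReal.ofReal_ne_top]
        simp_rw [hQ]
    _ = ∫⁻ x in Ioi (0 : ℝ), ∫⁻ θ, (∫⁻ y in Ioi (0 : ℝ), ∫⁻ ψ, Q x θ y ψ ∂circleMeasure)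
          ∂circleMeasure := by
        have : SFinite logPolarMeasure := by unfold logPolarMeasure; infer_instance
        rw [lintegral_logPolarMeasure hQm.lintegral_prod_right']
        refine lintegral_congr fun x => ?_
        refine lintegral_congr fun θ => ?_
        have hc : Measurable fun p : ℝ × ℝ => ((x, θ), p) := measurable_const.prodMk measurable_id
        exact lintegral_logPolarMeasure (F := fun p => Q x θ p.1 p.2) (hQm.comp hc)
    _ = ∫⁻ x in Ioi (0 : ℝ), ∫⁻ y in Ioi (0 : ℝ), ∫⁻ θ, ∫⁻ ψ, Q x θ y ψ ∂circleMeasure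
          ∂circleMeasure := by
        refine lintegral_congr fun x => ?_
        have : Measurable fun r : ℝ × ℝ => ∫⁻ ψ, Q x r.1 r.2 ψ ∂circleMeasure := by
          refine Measurable.lintegral_prod_right' (f := fun s : (ℝ × ℝ) × ℝ => Q x s.1.1 s.1.2 s.2) ?_
          exact hQm.comp ((measurable_const.prodMk (measurable_fst.comp measurable_fst)).prodMk
            ((measurable_snd.comp measurable_fst).prodMk measurable_snd))
        exact lintegral_lintegral_swap (f := fun θ y => ∫⁻ ψ, Q x θ y ψ ∂circleMeasure)
          this.aemeasurable
    _ = ∫⁻ x in Ioi (0 : ℝ), ∫⁻ y in Ioi (0 : ℝ), ∑' n, ‖taylorCoeff f n‖ₑ ^ 2 * R n x y :=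
        setLIntegral_congr_fun measurableSet_Ioi fun x hx =>
          setLIntegral_congr_fun measurableSet_Ioi fun y hy => hangle x hx y hy
    _ = ∑' n, ‖taylorCoeff f n‖ₑ ^ 2 *
          ∫⁻ x in Ioi (0 : ℝ), ∫⁻ y in Ioi (0 : ℝ), R n x y := by
        have hx (x : ℝ) : ∫⁻ y in Ioi (0 : ℝ), ∑' n, ‖taylorCoeff f n‖ₑ ^ 2 * R n x y =
            ∑' n, ‖taylorCoeff f n‖ₑ ^ 2 * ∫⁻ y in Ioi (0 : ℝ), R n x y := by
          have hm (n : ℕ) : Measurable (R n x) := (hRm n).comp measurable_prodMk_left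
          rw [lintegral_tsum fun n => ((hm n).const_mul _).aemeasurable]
          exact tsum_congr fun n => lintegral_const_mul' _ _ (by simp)
        simp_rw [hx]
        rw [lintegral_tsum fun n => ((hRm n).lintegral_prod_right'.const_mul _).aemeasurable]
        exact tsum_congr fun n => lintegral_const_mul' _ _ (by simp)
    _ ≤ ∑' n, ‖taylorCoeff f n‖ₑ ^ 2 * ENNReal.ofReal C :=
        ENNReal.tsum_le_tsum fun n => mul_le_mul_right (hC n) _
    _ = ENNReal.ofReal (C * ‖f‖ ^ 2) := by
        rw [ENNReal.tsum_mul_right, ← ofReal_norm_sq_hardySpace,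
          ← ENNReal.ofReal_mul (by positivity), mul_comm]

/-- The error of the nonlinear averaging is bounded on the weighted Bergman space. -/
theorem lintegral_error_sq_le {α : ℝ} (hα : 0 < α) : ∃ C : ℝ, 0 < C ∧
    ∀ f : HardySpace ℂ, ∫⁻ q, ENNReal.ofReal (Real.exp (-q.1) * (1 - Real.exp (-q.1))) *
      (∫⁻ p, ‖f (logPolar q.1 q.2) - f (logPolar p.1 p.2)‖ₑ *
        errorKernel α (logPolar q.1 q.2) p.1 p.2 ∂logPolarMeasure) ^ 2 ∂logPolarMeasure ≤
      ENNReal.ofReal (C * ‖f‖ ^ 2) := by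
  obtain ⟨C, hC0, hC⟩ := lintegral_sub_sq_errorKernel_le hα
  obtain ⟨D, hD0, hD⟩ := lintegral_errorKernel_le hα
  refine ⟨2 * D * C, by positivity, fun f => ?_⟩
  have hfm := measurable_hardySpace f
  rw [mul_assoc, ENNReal.ofReal_mul (by positivity)]
  refine le_trans ?_ (mul_le_mul_right (hC f) _)
  rw [← lintegral_const_mul' _ _ ENNReal.ofReal_ne_top]
  refine lintegral_mono_ae ?_
  filter_upwards [ae_logPolarMeasure_mem_Ioi] with q hq
  have hq : 0 < q.1 := hq
  have hcs := lintegral_mul_sq_le (μ := logPolarMeasure)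
    (a := fun p : ℝ × ℝ => ‖f (logPolar q.1 q.2) - f (logPolar p.1 p.2)‖ₑ)
    (k := fun p => errorKernel α (logPolar q.1 q.2) p.1 p.2)
    (((hfm.comp measurable_logPolar).const_sub _).enorm)
    ((measurable_errorKernel α).comp measurable_prodMk_left)
  have h1 := one_sub_exp_neg_half_pos hq
  -- The Bergman weight `1 - |z|² = (1-|z|)(1+|z|)` cancels the kernel mass `(1-|z|)⁻¹`, leaving at
  -- most `2`.
  have h2 : Real.exp (-q.1) * (1 - Real.exp (-q.1)) * (D * (1 - Real.exp (-q.1 / 2))⁻¹) ≤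
      2 * D * Real.exp (-q.1) := by
    have h3 : Real.exp (-q.1) = Real.exp (-q.1 / 2) * Real.exp (-q.1 / 2) := by
      rw [← Real.exp_add]; congr 1; ring
    have h4 : 1 - Real.exp (-q.1) = (1 - Real.exp (-q.1 / 2)) * (1 + Real.exp (-q.1 / 2)) := by
      rw [h3]; ring
    calc _ = Real.exp (-q.1) * D * (1 + Real.exp (-q.1 / 2)) := by
          rw [h4]
          linear_combination Real.exp (-q.1) * D * (1 + Real.exp (-q.1 / 2)) *
            mul_inv_cancel₀ h1.ne'
      _ ≤ Real.exp (-q.1) * D * 2 := by gcongr; linarith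
      _ = _ := by ring
  have h5 : 0 ≤ Real.exp (-q.1) * (1 - Real.exp (-q.1)) := by
    have := Real.exp_le_one_iff.2 (show -q.1 ≤ 0 by linarith)
    exact mul_nonneg (Real.exp_pos _).le (by linarith)
  refine (mul_le_mul_right (hcs.trans (mul_le_mul_left (hD q.1 q.2 hq) _)) _).trans ?_
  rw [← mul_assoc, ← mul_assoc, ← ENNReal.ofReal_mul h5, ← ENNReal.ofReal_mul (by positivity)]
  exact mul_le_mul_left (ENNReal.ofReal_le_ofReal h2) _

end LogPolar

/-! ### The integral representation and the pointwise error -/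

section Reproducing

theorem hasSum_sum_antidiagonal {E : Type*} [NormedAddCommGroup E] {F : ℕ × ℕ → E} {s : E}
    (hF : HasSum F s) : HasSum (fun N => ∑ p ∈ Finset.HasAntidiagonal.antidiagonal N, F p) s := by
  refine ((Finset.HasAntidiagonal.sigmaAntidiagonalEquivProd.hasSum_iff (f := F)).2 hF).sigma
    fun N => ?_
  have h := hasSum_fintype fun p : Finset.HasAntidiagonal.antidiagonal N => F p
  rwa [Finset.sum_coe_sort (Finset.HasAntidiagonal.antidiagonal N) F] at h

variable {H : Type*} [NormedAddCommGroup H] [InnerProductSpace ℂ H] [CompleteSpace H]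

/-- The coefficients of the product of `∑ fₘ wᵐ` and `∑ (1 + n)^s zⁿ wⁿ`. -/
def kernelProductCoeff (s : ℝ) (f : ℕ → ℂ) (z : ℂ) (N : ℕ) : ℂ :=
  ∑ p ∈ Finset.HasAntidiagonal.antidiagonal N, f p.1 * (z ^ p.2 * (((1 + p.2 : ℝ) ^ s : ℝ) : ℂ))

theorem kernelProductCoeff_eq (s : ℝ) (f : ℕ → ℂ) (z w : ℂ) (N : ℕ) :
    w ^ N * kernelProductCoeff s f z N = ∑ p ∈ Finset.HasAntidiagonal.antidiagonal N,
      (w ^ p.1 • f p.1) * ((z * w) ^ p.2 • (((1 + p.2 : ℝ) ^ s : ℝ) : ℂ)) := by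
  rw [kernelProductCoeff, Finset.mul_sum]
  refine Finset.sum_congr rfl fun p hp => ?_
  rw [← Finset.HasAntidiagonal.mem_antidiagonal.1 hp, pow_add, mul_pow, smul_eq_mul, smul_eq_mul]
  ring

theorem discSummable_kernelProductCoeff (s : ℝ) {f : ℕ → ℂ} (hf : DiscSummable 1 f) {z : ℂ}
    (hz : ‖z‖ < 1) : DiscSummable 1 (kernelProductCoeff s f z) := by
  intro r h0 h1
  have hr : ‖(r : ℂ)‖ < 1 := by simpa [abs_of_nonneg h0]
  have hzr : ‖z * (r : ℂ)‖ < 1 := by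
    rw [norm_mul]; exact mul_lt_one_of_nonneg_of_lt_one_left (norm_nonneg _) hz hr.le
  have h := summable_norm_sum_mul_antidiagonal_of_summable_norm (hf.summable_norm hr)
    ((discSummable_rpow s).summable_norm hzr)
  refine h.congr fun N => ?_
  rw [← kernelProductCoeff_eq, norm_mul, norm_pow, Complex.norm_of_nonneg h0]

theorem powerSum_mul_fracKernel (s : ℝ) {f : ℕ → ℂ} (hf : DiscSummable 1 f) {z w : ℂ}
    (hz : ‖z‖ < 1) (hw : ‖w‖ < 1) :
    powerSum f w * fracKernel s (z * w) = ∑' N, w ^ N * kernelProductCoeff s f z N := by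
  have hzw : ‖z * w‖ < 1 := by
    rw [norm_mul]; exact mul_lt_one_of_nonneg_of_lt_one_left (norm_nonneg _) hz hw.le
  simp_rw [kernelProductCoeff_eq]
  exact tsum_mul_tsum_eq_tsum_sum_antidiagonal_of_summable_norm (hf.summable_norm hw)
    ((discSummable_rpow s).summable_norm hzw)

/-- The Hankel form as a single series over the total degree. -/
theorem hasSum_kernelProductCoeff_smul (s : ℝ) {a : ℕ → H} (ha : DiscSummable 1 a) {R : ℝ}
    (hR : 1 < R) {f : ℕ → ℂ} (hf : DiscSummable R f) {z : ℂ} (hz : ‖z‖ < 1) :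
    (Summable fun N => ‖kernelProductCoeff s f z N • a N‖) ∧
    HasSum (fun N => kernelProductCoeff s f z N • a N) (powerSum (fracHankelCoeff s a f) z) := by
  obtain ⟨r, hr, hr1⟩ := exists_between hz
  have hr0 : 0 < r := (norm_nonneg z).trans_lt hr
  obtain ⟨C, hC0, hC⟩ := exists_polynomial_geometric_bound s (q := ‖z‖ / r) (by positivity)
    ((div_lt_one hr0).2 hr)
  -- The double series in `(m, n)` converges absolutely, so it may be summed over `m` first, giving
  -- the Hankel coefficients, or along `m + n = N`.
  let F : ℕ × ℕ → H := fun p => (f p.1 * (z ^ p.2 * (((1 + p.2 : ℝ) ^ s : ℝ) : ℂ))) • a (p.1 + p.2)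
  have hFn (p : ℕ × ℕ) :
      ‖F p‖ = ‖f p.1‖ * (‖z‖ ^ p.2 * (1 + p.2 : ℝ) ^ s) * ‖a (p.1 + p.2)‖ := by
    simp only [F]
    rw [norm_smul, norm_mul, norm_mul, norm_pow, Complex.norm_of_nonneg (by positivity)]
  have hFsum : Summable fun p => ‖F p‖ := by
    rw [← (Equiv.prodComm ℕ ℕ).summable_iff]
    refine Summable.of_nonneg_of_le (fun _ => norm_nonneg _) (fun p => ?_)
      ((summable_hankel ha hR hf hr0.le hr1).mul_left C)
    obtain ⟨n, m⟩ := p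
    simp only [Function.comp, Equiv.prodComm_apply, Prod.swap_prod_mk]
    rw [hFn]
    dsimp only
    have h := hC n
    have h2 : ‖z‖ ^ n * (1 + n : ℝ) ^ s = ((1 + n : ℝ) ^ s * (‖z‖ / r) ^ n) * r ^ n := by
      rw [div_pow]; field_simp
    calc ‖f m‖ * (‖z‖ ^ n * (1 + n : ℝ) ^ s) * ‖a (m + n)‖
        = ((1 + n : ℝ) ^ s * (‖z‖ / r) ^ n) * (r ^ n * (‖f m‖ * ‖a (m + n)‖)) := by
          rw [h2]; ring
      _ ≤ _ := mul_le_mul_of_nonneg_right h (by positivity)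
  have hsum_eq (N : ℕ) : ∑ p ∈ Finset.HasAntidiagonal.antidiagonal N, F p =
      kernelProductCoeff s f z N • a N := by
    rw [kernelProductCoeff, Finset.sum_smul]
    refine Finset.sum_congr rfl fun p hp => ?_
    simp only [F]
    rw [Finset.HasAntidiagonal.mem_antidiagonal.1 hp]
  have htsum : ∑' p, F p = powerSum (fracHankelCoeff s a f) z := by
    rw [← (Equiv.prodComm ℕ ℕ).tsum_eq]
    have hF' : Summable fun p => F ((Equiv.prodComm ℕ ℕ) p) :=
      (Equiv.prodComm ℕ ℕ).summable_iff.2 hFsum.of_norm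
    rw [hF'.tsum_prod]
    refine tsum_congr fun n => ?_
    have h := (hasSum_hankelCoeff ha hR hf n).const_smul (z ^ n * (((1 + n : ℝ) ^ s : ℝ) : ℂ))
    rw [fracHankelCoeff, smul_smul, ← h.tsum_eq]
    refine tsum_congr fun m => ?_
    simp only [F, Equiv.prodComm_apply, Prod.swap_prod_mk]
    rw [smul_smul, mul_comm]
  constructor
  · have h := (hasSum_sum_antidiagonal hFsum.hasSum).summable
    refine Summable.of_nonneg_of_le (fun _ => norm_nonneg _) (fun N => ?_) h
    rw [← hsum_eq]
    exact norm_sum_le _ _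
  · simp_rw [← hsum_eq, ← htsum]
    exact hasSum_sum_antidiagonal hFsum.of_norm.hasSum

/-- The angular average of the product of the kernel and an analytic function. -/
theorem integral_kernel_smul_powerSum (s : ℝ) {f : ℕ → ℂ} (hf : DiscSummable 1 f) {z : ℂ}
    (hz : ‖z‖ < 1) {g : ℕ → H} (hg : DiscSummable 1 g) {y : ℝ} (hy : 0 < y) :
    ∫ ψ, (powerSum f (starRingEnd ℂ (logPolar y ψ)) *
        fracKernel s (z * starRingEnd ℂ (logPolar y ψ))) • powerSum g (logPolar y ψ)
        ∂circleMeasure =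
      ∑' k : ℕ, (Real.exp (-(k * y)) : ℂ) • kernelProductCoeff s f z k • g k := by
  set q := kernelProductCoeff s f z
  have hq : DiscSummable 1 q := discSummable_kernelProductCoeff s hf hz
  set ρ := Real.exp (-y / 2) with hρ
  have hρ0 : 0 < ρ := Real.exp_pos _
  have hρ1 : ρ < 1 := Real.exp_lt_one_iff.2 (by linarith)
  let c : ℕ × ℕ → H := fun p => ((ρ : ℂ) ^ p.1 * q p.1) • ((ρ : ℂ) ^ p.2 • g p.2)
  have hc : Summable fun p => ‖c p‖ := by
    refine ((hq ρ hρ0.le hρ1).mul_of_nonneg (hg ρ hρ0.le hρ1) (fun _ => by positivity)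
      fun _ => by positivity).congr fun p => ?_
    simp [c, norm_smul, abs_of_pos hρ0]
  have hlp (ψ : ℝ) : logPolar y ψ = (ρ : ℂ) * circleMap 0 1 ψ := by
    simp [logPolar, circleMap, hρ]
  have hint (ψ : ℝ) : (powerSum f (starRingEnd ℂ (logPolar y ψ)) *
        fracKernel s (z * starRingEnd ℂ (logPolar y ψ))) • powerSum g (logPolar y ψ) =
      ∑' p : ℕ × ℕ, ((starRingEnd ℂ (circleMap 0 1 ψ)) ^ p.1 * circleMap 0 1 ψ ^ p.2) • c p := by
    have hw : ‖logPolar y ψ‖ < 1 := by simpa using logPolar_mem_ball hy ψ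
    have hw' : ‖starRingEnd ℂ (logPolar y ψ)‖ < 1 := by rwa [RCLike.norm_conj]
    have hs1 : Summable fun j => starRingEnd ℂ (logPolar y ψ) ^ j * q j :=
      (hq.hasSum hw').summable
    have hs2 := (hg.hasSum hw).summable
    have heq (p : ℕ × ℕ) : (starRingEnd ℂ (logPolar y ψ) ^ p.1 * q p.1) •
        (logPolar y ψ ^ p.2 • g p.2) =
        ((starRingEnd ℂ (circleMap 0 1 ψ)) ^ p.1 * circleMap 0 1 ψ ^ p.2) • c p := by
      simp only [c]
      rw [hlp, map_mul, Complex.conj_ofReal, mul_pow, mul_pow]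
      simp only [smul_smul]
      congr 1
      ring
    have hs3 : Summable fun p : ℕ × ℕ => (starRingEnd ℂ (logPolar y ψ) ^ p.1 * q p.1) •
        (logPolar y ψ ^ p.2 • g p.2) := by
      simp_rw [heq]
      have hcn (p : ℕ × ℕ) :
          ‖((starRingEnd ℂ) (circleMap 0 1 ψ) ^ p.1 * circleMap 0 1 ψ ^ p.2) • c p‖ = ‖c p‖ := by
        generalize c p = v
        rw [norm_smul, norm_mul, norm_pow, norm_pow, RCLike.norm_conj, norm_circleMap_one, one_pow,
          one_pow, one_mul, one_mul]
      exact Summable.of_norm (hc.congr fun p => (hcn p).symm)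
    rw [powerSum_mul_fracKernel s hf hz hw', powerSum, tsum_smul_tsum hs1 hs2 hs3]
    exact tsum_congr heq
  simp_rw [hint]
  rw [integral_circleMeasure_double_series hc]
  refine tsum_congr fun k => ?_
  simp only [c]
  -- Orthogonality leaves `|w|^{2k}`, which is `e^{-ky}` in these coordinates.
  have hρ2 : Real.exp (-(k * y)) = ρ ^ k * ρ ^ k := by
    rw [hρ, ← Real.exp_nat_mul, ← Real.exp_add]; congr 1; ring
  rw [hρ2]
  simp only [smul_smul]
  congr 1
  push_cast
  ring

/-- The integral representation of `D^{1+α} Γ_φ f`. -/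
theorem integral_representation {α : ℝ} (hα : -1 < α) {a : ℕ → H} (ha : DiscSummable 1 a) {R : ℝ}
    (hR : 1 < R) {f : ℕ → ℂ} (hf : DiscSummable R f) {z : ℂ} (hz : ‖z‖ < 1) :
    ∫ y in Ioi (0 : ℝ), ((y ^ α * Real.exp (-y) : ℝ) : ℂ) •
      ∫ ψ, (powerSum f (starRingEnd ℂ (logPolar y ψ)) *
        fracKernel (1 + α) (z * starRingEnd ℂ (logPolar y ψ))) •
        powerSum (fun k : ℕ => (((1 + k : ℝ) ^ (1 + α) : ℝ) : ℂ) • a k) (logPolar y ψ)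
        ∂circleMeasure =
      (Real.Gamma (1 + α) : ℂ) • powerSum (fracHankelCoeff (1 + α) a f) z := by
  set q := kernelProductCoeff (1 + α) f z with hq
  obtain ⟨hsum, hhas⟩ := hasSum_kernelProductCoeff_smul (1 + α) ha hR hf hz
  have hα1 : 0 < 1 + α := by linarith
  have hk (k : ℕ) : (0 : ℝ) < 1 + k := by positivity
  have hGam (k : ℕ) : ∫ y in Ioi (0 : ℝ), y ^ α * Real.exp (-((1 + k : ℝ) * y)) =
      (1 / (1 + k : ℝ)) ^ (1 + α) * Real.Gamma (1 + α) := by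
    have := Real.integral_rpow_mul_exp_neg_mul_Ioi hα1 (hk k)
    rwa [add_sub_cancel_left] at this
  have hΓ := Real.Gamma_pos_of_pos hα1
  have hint (k : ℕ) : IntegrableOn (fun y : ℝ => y ^ α * Real.exp (-((1 + k : ℝ) * y)))
      (Ioi 0) := by
    by_contra h
    have h1 := hGam k
    rw [integral_undef h] at h1
    have : 0 < (1 / (1 + k : ℝ)) ^ (1 + α) * Real.Gamma (1 + α) := by have := hk k; positivity
    linarith
  -- The factor `(1+k)^{-(1+α)}` from the Gamma integral of `y^α e^{-(1+k)y}` undoes the derivative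
  -- `D^{1+α}` on the symbol.
  have hinv (k : ℕ) : (1 / (1 + k : ℝ)) ^ (1 + α) * (1 + k : ℝ) ^ (1 + α) = 1 := by
    rw [← Real.mul_rpow (by have := hk k; positivity) (hk k).le, one_div_mul_cancel (hk k).ne',
      Real.one_rpow]
  let v (k : ℕ) : H := (((1 + k : ℝ) ^ (1 + α) : ℝ) : ℂ) • (q k • a k)
  let F (k : ℕ) (y : ℝ) : H := ((y ^ α * Real.exp (-((1 + k : ℝ) * y)) : ℝ) : ℂ) • v k
  have hFint (k : ℕ) : IntegrableOn (F k) (Ioi 0) := (hint k).ofReal.smul_const _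
  have hFval (k : ℕ) : ∫ y in Ioi 0, F k y = (Real.Gamma (1 + α) : ℂ) • (q k • a k) := by
    simp only [F, v]
    rw [integral_smul_const, integral_complex_ofReal, hGam, smul_smul, ← Complex.ofReal_mul,
      mul_right_comm, hinv, one_mul]
  have hFnorm (k : ℕ) : ∫ y in Ioi 0, ‖F k y‖ = Real.Gamma (1 + α) * ‖q k • a k‖ := by
    have h1 : ∀ y ∈ Ioi (0 : ℝ), ‖F k y‖ = (y ^ α * Real.exp (-((1 + k : ℝ) * y))) * ‖v k‖ := by
      intro y hy
      have hy : 0 < y := hy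
      simp only [F]
      rw [norm_smul, Complex.norm_of_nonneg (by positivity)]
    rw [setIntegral_congr_fun measurableSet_Ioi h1, integral_mul_const, hGam]
    simp only [v]
    rw [norm_smul, Complex.norm_of_nonneg (by positivity)]
    linear_combination Real.Gamma (1 + α) * ‖q k • a k‖ * hinv k
  have hswap := hasSum_integral_of_summable_integral_norm (μ := volume.restrict (Ioi (0 : ℝ)))
    (F := F) hFint (by
      simp_rw [hFnorm]
      exact hsum.mul_left _)
  simp_rw [hFval] at hswap
  rw [← (hhas.const_smul (Real.Gamma (1 + α) : ℂ)).unique hswap |>.symm]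
  refine setIntegral_congr_fun measurableSet_Ioi fun y hy => ?_
  have hy : 0 < y := hy
  rw [integral_kernel_smul_powerSum (1 + α) (hf.mono hR.le) hz (ha.rpow_smul (1 + α)) hy,
    ← tsum_const_smul'']
  refine tsum_congr fun k => ?_
  simp only [F, v]
  have : Real.exp (-((1 + k : ℝ) * y)) = Real.exp (-y) * Real.exp (-(k * y)) := by
    rw [← Real.exp_add]; congr 1; ring
  rw [this]
  simp only [smul_smul]
  congr 1
  push_cast
  ring

/-- Equivalent to `t ≤ sinh t` at `t = y/2`. It trades the factor `y` of the representation for the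
Bloch weight `1 - |w|²`. -/
theorem mul_exp_neg_half_le {y : ℝ} (hy : 0 ≤ y) : y * Real.exp (-y / 2) ≤ 1 - Real.exp (-y) := by
  have h := Real.self_le_sinh_iff.2 (show 0 ≤ y / 2 by positivity)
  rw [Real.sinh_eq] at h
  have h1 : Real.exp (-y / 2) * Real.exp (y / 2) = 1 := by
    rw [← Real.exp_add, show -y / 2 + y / 2 = 0 by ring, Real.exp_zero]
  have h2 : Real.exp (-y / 2) * Real.exp (-(y / 2)) = Real.exp (-y) := by
    rw [← Real.exp_add]; congr 1; ring
  nlinarith [Real.exp_pos (-y / 2)]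

/-- The pointwise error between `\bar g D^{1+α} φ` and the Hankel operator, under a Bloch bound. -/
theorem enorm_conj_smul_sub_le {α : ℝ} (hα : 0 < α) : ∃ C : ℝ, 0 < C ∧
    ∀ (H : Type*) [NormedAddCommGroup H] [InnerProductSpace ℂ H] [CompleteSpace H] (a : ℕ → H),
      DiscSummable 1 a → ∀ B : ℝ, 0 ≤ B →
      (∀ w ∈ ball (0 : ℂ) 1,
        ‖powerSum (fun k : ℕ => (((1 + k : ℝ) ^ (1 + α) : ℝ) : ℂ) • a k) w‖ * (1 - ‖w‖ ^ 2) ≤ B) →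
      ∀ g : HardySpace ℂ, g.ExtendsAnalytically → ∀ z ∈ ball (0 : ℂ) 1,
      ‖starRingEnd ℂ (g z) • powerSum (fun k : ℕ => (((1 + k : ℝ) ^ (1 + α) : ℝ) : ℂ) • a k) z -
        powerSum (fracHankelCoeff (1 + α) a (fun m => starRingEnd ℂ (taylorCoeff g m))) z‖ₑ ≤
      ENNReal.ofReal (C * B) *
        ∫⁻ p, ‖g z - g (logPolar p.1 p.2)‖ₑ * errorKernel α z p.1 p.2 ∂logPolarMeasure := by
  obtain ⟨C, hC0, hC⟩ := norm_fracKernel_le (α := α) (by linarith)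
  have hΓ := Real.Gamma_pos_of_pos (show 0 < 1 + α by linarith)
  refine ⟨(Real.Gamma (1 + α))⁻¹ * C, by positivity, ?_⟩
  intro H _ _ _ a ha B hB hG g hg z hz
  obtain ⟨R, hR, hgR⟩ := hg.exists_discSummable
  have hz1 : ‖z‖ < 1 := by simpa using hz
  set G := powerSum (fun k : ℕ => (((1 + k : ℝ) ^ (1 + α) : ℝ) : ℂ) • a k) with hGdef
  set f : ℕ → ℂ := fun m => starRingEnd ℂ (taylorCoeff g m) with hfdef
  have hf : DiscSummable R f := hgR.of_norm_le 1 fun n => by simp [hfdef]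
  -- `δ` is the constant function `1`, for which the Hankel operator returns the symbol. Applying
  -- the representation to `p = conj g(z) δ - f` produces the difference to be estimated, and
  -- `p(w̄)` is the conjugate of `g(z) - g(w)`.
  let δ : ℕ → ℂ := fun m => if m = 0 then 1 else 0
  have hδ : DiscSummable R δ :=
    DiscSummable.of_finite_support (N := 0) (fun n hn => if_neg hn.ne') R
  let p : ℕ → ℂ := starRingEnd ℂ (g z) • δ + (-1 : ℂ) • f
  have hp : DiscSummable R p := (hδ.const_smul _).add (hf.const_smul _)
  have hδval (w : ℂ) : powerSum δ w = 1 := by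
    rw [powerSum, tsum_eq_single 0 (fun n hn => by simp [δ, hn])]
    simp [δ]
  have hfval (w : ℂ) (hw : w ∈ ball (0 : ℂ) 1) :
      powerSum f (starRingEnd ℂ w) = starRingEnd ℂ (g w) := by
    rw [eqOn_powerSum_taylorCoeff g.2.1 hw, powerSum, powerSum, Complex.conj_tsum]
    refine tsum_congr fun n => ?_
    simp [hfdef]
  have hpval (w : ℂ) (hw : w ∈ ball (0 : ℂ) 1) :
      powerSum p (starRingEnd ℂ w) = starRingEnd ℂ (g z - g w) := by
    have hw' : ‖starRingEnd ℂ w‖ < R := by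
      rw [RCLike.norm_conj]; exact (mem_ball_zero_iff.1 hw).trans hR
    simp only [p]
    rw [powerSum_add (hδ.const_smul _) (hf.const_smul _) hw', powerSum_smul, powerSum_smul, hδval,
      hfval w hw, map_sub]
    simp [sub_eq_add_neg]
  have hδH (n : ℕ) : hankelCoeff a δ n = a n := by
    rw [hankelCoeff, tsum_eq_single 0 (fun m hm => by simp [δ, hm])]
    simp [δ]
  have hcoef : fracHankelCoeff (1 + α) a p = starRingEnd ℂ (g z) •
      (fun k : ℕ => (((1 + k : ℝ) ^ (1 + α) : ℝ) : ℂ) • a k) +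
      (-1 : ℂ) • fracHankelCoeff (1 + α) a f := by
    funext n
    simp only [fracHankelCoeff, p, Pi.add_apply, Pi.smul_apply]
    rw [hankelCoeff_add ha hR (hδ.const_smul _) (hf.const_smul _), hankelCoeff_smul,
      hankelCoeff_smul, hδH, smul_add, smul_comm _ (starRingEnd ℂ (g z)), smul_comm _ (-1 : ℂ)]
  have hVp : powerSum (fracHankelCoeff (1 + α) a p) z = starRingEnd ℂ (g z) • G z -
      powerSum (fracHankelCoeff (1 + α) a f) z := by
    rw [hcoef, powerSum_add ((ha.rpow_smul _).const_smul _)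
      ((discSummable_fracHankelCoeff _ ha hR hf).const_smul _) hz1, powerSum_smul, powerSum_smul]
    simp [hGdef, sub_eq_add_neg]
  have hrep := integral_representation (α := α) (by linarith) ha hR hp hz1
  rw [hVp] at hrep
  have hrep' : starRingEnd ℂ (g z) • G z - powerSum (fracHankelCoeff (1 + α) a f) z =
      ((Real.Gamma (1 + α) : ℂ))⁻¹ • ∫ y in Ioi (0 : ℝ), ((y ^ α * Real.exp (-y) : ℝ) : ℂ) •
      ∫ ψ, (powerSum p (starRingEnd ℂ (logPolar y ψ)) *
        fracKernel (1 + α) (z * starRingEnd ℂ (logPolar y ψ))) • G (logPolar y ψ)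
        ∂circleMeasure := by
    rw [hrep, smul_smul, inv_mul_cancel₀ (by exact_mod_cast hΓ.ne'), one_smul]
  have hm : Measurable fun p : ℝ × ℝ =>
      ‖g z - g (logPolar p.1 p.2)‖ₑ * errorKernel α z p.1 p.2 :=
    ((((measurable_hardySpace g).comp measurable_logPolar).const_sub _).enorm).mul
      ((measurable_errorKernel α).comp (measurable_const.prodMk measurable_id))
  rw [hrep', enorm_smul, lintegral_logPolarMeasure hm, mul_assoc,
    ENNReal.ofReal_mul (by positivity)]
  have hinv : ‖((Real.Gamma (1 + α) : ℂ))⁻¹‖ₑ = ENNReal.ofReal (Real.Gamma (1 + α))⁻¹ := by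
    rw [← ofReal_norm, norm_inv, Complex.norm_of_nonneg hΓ.le]
  rw [hinv, mul_assoc]
  refine mul_le_mul_right ?_ _
  refine (enorm_integral_le_lintegral_enorm _).trans ?_
  rw [← lintegral_const_mul' _ _ ENNReal.ofReal_ne_top]
  refine setLIntegral_mono' measurableSet_Ioi fun y hy => ?_
  have hy : 0 < y := hy
  rw [enorm_smul, ← ofReal_norm, Complex.norm_of_nonneg (by positivity)]
  refine (mul_le_mul_right (enorm_integral_le_lintegral_enorm _) _).trans ?_
  rw [← lintegral_const_mul' _ _ ENNReal.ofReal_ne_top,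
    ← lintegral_const_mul' _ _ ENNReal.ofReal_ne_top]
  refine lintegral_mono fun ψ => ?_
  have hw : logPolar y ψ ∈ ball (0 : ℂ) 1 := logPolar_mem_ball hy ψ
  have hwn := norm_logPolar y ψ
  rw [hpval _ hw, enorm_smul, enorm_mul, mul_assoc, mul_left_comm]
  rw [mul_left_comm (ENNReal.ofReal (C * B))]
  rw [← ofReal_norm (starRingEnd ℂ (g z - g (logPolar y ψ))), RCLike.norm_conj, ofReal_norm]
  refine mul_le_mul_right ?_ _
  set w := logPolar y ψ with hwdef
  rw [errorKernel, ← hwdef, ← ofReal_norm, ← ofReal_norm, ← ENNReal.ofReal_mul (norm_nonneg _),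
    ← ENNReal.ofReal_mul (by positivity), ← ENNReal.ofReal_mul (by positivity)]
  refine ENNReal.ofReal_le_ofReal ?_
  have hzw : ‖z * starRingEnd ℂ w‖ < 1 := by
    rw [norm_mul, RCLike.norm_conj]
    exact mul_lt_one_of_nonneg_of_lt_one_left (norm_nonneg _) hz1 (mem_ball_zero_iff.1 hw).le
  have hK := hC _ hzw
  have hGw := hG w hw
  have hsq : ‖w‖ ^ 2 = Real.exp (-y) := by
    rw [hwn, ← Real.exp_nat_mul]; congr 1; push_cast; ring
  rw [hsq] at hGw
  have hye := mul_exp_neg_half_le hy.le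
  -- One power of `y` and half of the exponential pay for the growth of `G`; the remaining `y^{α-1}
  -- e^{-y/2}` is the weight in `errorKernel`.
  have hrad : y ^ α * Real.exp (-y) * ‖G w‖ ≤ B * (y ^ (α - 1) * Real.exp (-y / 2)) := by
    have h1 : y ^ α = y ^ (α - 1) * y := by
      rw [← Real.rpow_add_one hy.ne']; congr 1; ring
    have h2 : Real.exp (-y) = Real.exp (-y / 2) * Real.exp (-y / 2) := by
      rw [← Real.exp_add]; congr 1; ring
    calc y ^ α * Real.exp (-y) * ‖G w‖
        = y ^ (α - 1) * Real.exp (-y / 2) * (‖G w‖ * (y * Real.exp (-y / 2))) := by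
          rw [h1, h2]; ring
      _ ≤ y ^ (α - 1) * Real.exp (-y / 2) * (‖G w‖ * (1 - Real.exp (-y))) := by gcongr
      _ ≤ y ^ (α - 1) * Real.exp (-y / 2) * B := by gcongr
      _ = _ := by ring
  calc y ^ α * Real.exp (-y) * (‖fracKernel (1 + α) (z * starRingEnd ℂ w)‖ * ‖G w‖)
      = (y ^ α * Real.exp (-y) * ‖G w‖) * ‖fracKernel (1 + α) (z * starRingEnd ℂ w)‖ := by ring
    _ ≤ (B * (y ^ (α - 1) * Real.exp (-y / 2))) *
        (C * ‖1 - z * starRingEnd ℂ w‖ ^ (-(2 + α))) := by gcongr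
    _ = _ := by ring

end Reproducing

/-! ### Area integrals and the weighted Bergman norm -/

section AreaIntegral

/-- Integration over the disc in logarithmic polar coordinates. -/
theorem lintegral_ball_eq_lintegral_logPolar {F : ℂ → ℝ≥0∞} (hF : ContinuousOn F (ball 0 1)) :
    ∫⁻ z in ball (0 : ℂ) 1, F z = ENNReal.ofReal π * ∫⁻ x in Ioi (0 : ℝ),
      ENNReal.ofReal (Real.exp (-x)) * ∫⁻ θ, F (logPolar x θ) ∂circleMeasure := by
  classical
  set G : ℂ → ℝ≥0∞ := (ball (0 : ℂ) 1).indicator F with hG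
  have hGm : Measurable G := by
    rw [hG, ← piecewise_eq_indicator]
    exact hF.measurable_piecewise continuousOn_const measurableSet_ball
  have hsymm (p : ℝ × ℝ) : Complex.polarCoord.symm p = circleMap 0 p.1 p.2 := by
    rw [Complex.polarCoord_symm_apply, circleMap, Complex.exp_mul_I]
    simp
  have hcm : Measurable fun p : ℝ × ℝ => G (circleMap 0 p.1 p.2) :=
    hGm.comp (by unfold circleMap; fun_prop)
  rw [← lintegral_indicator measurableSet_ball, ← hG, ← Complex.lintegral_comp_polarCoord_symm]
  have h1 : ∫⁻ p in polarCoord.target, ENNReal.ofReal p.1 • G (Complex.polarCoord.symm p) =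
      ∫⁻ r in Ioi (0 : ℝ), ENNReal.ofReal r *
        (ENNReal.ofReal (2 * π) * ∫⁻ θ, G (circleMap 0 r θ) ∂circleMeasure) := by
    have htarget : polarCoord.target = Ioi (0 : ℝ) ×ˢ Ioo (-π) π := rfl
    simp_rw [hsymm]
    rw [htarget, Measure.volume_eq_prod, ← Measure.prod_restrict, lintegral_prod]
    · refine lintegral_congr fun r => ?_
      simp only [smul_eq_mul]
      rw [lintegral_const_mul' _ _ ENNReal.ofReal_ne_top, lintegral_circleMeasure_eq_Ioo]
      exact (circleMap_zero_periodic r).comp G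
    · exact ((measurable_fst.ennreal_ofReal).mul hcm).aemeasurable
  rw [h1]
  have h2 : ∫⁻ r in Ioi (0 : ℝ), ENNReal.ofReal r *
        (ENNReal.ofReal (2 * π) * ∫⁻ θ, G (circleMap 0 r θ) ∂circleMeasure) =
      ∫⁻ r in Ioo (0 : ℝ) 1, ENNReal.ofReal r *
        (ENNReal.ofReal (2 * π) * ∫⁻ θ, F (circleMap 0 r θ) ∂circleMeasure) := by
    rw [← lintegral_indicator measurableSet_Ioi, ← lintegral_indicator measurableSet_Ioo]
    refine lintegral_congr fun r => ?_
    by_cases hr0 : 0 < r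
    · rw [indicator_of_mem (show r ∈ Ioi (0 : ℝ) from hr0)]
      by_cases hr1 : r < 1
      · rw [indicator_of_mem (show r ∈ Ioo (0 : ℝ) 1 from ⟨hr0, hr1⟩)]
        congr 2
        exact lintegral_congr fun θ =>
          indicator_of_mem (circleMap_mem_unit_ball ⟨r, hr0, hr1⟩ θ) _
      · rw [indicator_of_notMem (fun h => hr1 h.2)]
        have : ∀ θ, G (circleMap 0 r θ) = 0 := fun θ =>
          indicator_of_notMem (by simpa [abs_of_pos hr0] using hr1) _
        simp [this]
    · rw [indicator_of_notMem (s := Ioi (0 : ℝ)) hr0,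
        indicator_of_notMem (s := Ioo (0 : ℝ) 1) (fun h => hr0 h.1)]
  have himage : (fun x : ℝ => Real.exp (-x / 2)) '' Ioi 0 = Ioo 0 1 := by
    ext r
    simp only [mem_image, mem_Ioi, mem_Ioo]
    constructor
    · rintro ⟨x, hx, rfl⟩
      exact ⟨Real.exp_pos _, Real.exp_lt_one_iff.2 (by linarith)⟩
    · rintro ⟨h0, h1⟩
      refine ⟨-2 * Real.log r, by have := Real.log_neg h0 h1; linarith, ?_⟩
      rw [show -(-2 * Real.log r) / 2 = Real.log r by ring, Real.exp_log h0]
  -- With `r = e^{-x/2}`, `r dr` becomes `e^{-x} dx / 2`; together with `dθ = 2π dm` this gives the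
  -- factor `π e^{-x}`.
  rw [h2, ← himage, lintegral_image_eq_lintegral_abs_deriv_mul (s := Ioi 0)
    (f := fun x : ℝ => Real.exp (-x / 2)) (f' := fun x => Real.exp (-x / 2) * (-1 / 2))
    measurableSet_Ioi
    (fun x _ => ((((hasDerivAt_id x).neg).div_const 2).exp).hasDerivWithinAt)
    (fun x _ y _ h => by have := Real.exp_injective h; linarith),
    ← lintegral_const_mul' _ _ ENNReal.ofReal_ne_top]
  refine lintegral_congr fun x => ?_
  have he : Real.exp (-x) = Real.exp (-x / 2) * Real.exp (-x / 2) := by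
    rw [← Real.exp_add]; congr 1; ring
  rw [← mul_assoc, ← mul_assoc, ← mul_assoc, ← ENNReal.ofReal_mul (abs_nonneg _),
    ← ENNReal.ofReal_mul (by positivity), ← ENNReal.ofReal_mul (by positivity)]
  congr 2
  rw [abs_mul, abs_of_pos (Real.exp_pos _), he]
  norm_num
  ring

theorem lintegral_ball_eq_lintegral_logPolarMeasure {F : ℂ → ℝ≥0∞}
    (hF : ContinuousOn F (ball 0 1)) :
    ∫⁻ z in ball (0 : ℂ) 1, F z = ENNReal.ofReal π * ∫⁻ q,
      ENNReal.ofReal (Real.exp (-q.1)) * F (logPolar q.1 q.2) ∂logPolarMeasure := by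
  classical
  have hm : Measurable ((ball (0 : ℂ) 1).indicator F) := by
    rw [← piecewise_eq_indicator]
    exact hF.measurable_piecewise continuousOn_const measurableSet_ball
  rw [lintegral_ball_eq_lintegral_logPolar hF]
  congr 1
  have h1 : ∫⁻ q, ENNReal.ofReal (Real.exp (-q.1)) * F (logPolar q.1 q.2) ∂logPolarMeasure =
      ∫⁻ q, ENNReal.ofReal (Real.exp (-q.1)) *
        (ball (0 : ℂ) 1).indicator F (logPolar q.1 q.2) ∂logPolarMeasure := by
    refine lintegral_congr_ae ?_
    filter_upwards [ae_logPolarMeasure_mem_Ioi] with q hq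
    rw [indicator_of_mem (logPolar_mem_ball hq q.2)]
  have h2 : Measurable fun q : ℝ × ℝ => ENNReal.ofReal (Real.exp (-q.1)) *
        (ball (0 : ℂ) 1).indicator F (logPolar q.1 q.2) :=
    (by fun_prop : Measurable fun q : ℝ × ℝ => ENNReal.ofReal (Real.exp (-q.1))).mul
      (hm.comp measurable_logPolar)
  rw [h1, lintegral_logPolarMeasure h2]
  refine setLIntegral_congr_fun measurableSet_Ioi fun x hx => ?_
  rw [← lintegral_const_mul' _ _ ENNReal.ofReal_ne_top]
  exact lintegral_congr fun θ => by
    dsimp only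
    rw [indicator_of_mem (logPolar_mem_ball hx θ)]

/-- The integrand is `e^{-(n+1)x} - e^{-(n+2)x}`; the integral is the squared norm of `zⁿ` for the
weight `1 - |z|²`, up to `π`. -/
theorem lintegral_exp_mul_one_sub_exp (n : ℕ) :
    ∫⁻ x in Ioi (0 : ℝ), ENNReal.ofReal (Real.exp (-x) * (1 - Real.exp (-x)) *
      Real.exp (-x / 2) ^ (2 * n)) = ENNReal.ofReal (1 / ((n + 1) * (n + 2))) := by
  have h (x : ℝ) : Real.exp (-x) * (1 - Real.exp (-x)) * Real.exp (-x / 2) ^ (2 * n) =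
      Real.exp (-(n + 1 : ℝ) * x) - Real.exp (-(n + 2 : ℝ) * x) := by
    rw [mul_sub, ← Real.exp_nat_mul, mul_one, sub_mul, ← Real.exp_add, ← Real.exp_add,
      ← Real.exp_add]
    push_cast
    congr 2 <;> ring
  have hi1 := integrableOn_exp_mul_Ioi (a := -(n + 1 : ℝ)) (by linarith) 0
  have hi2 := integrableOn_exp_mul_Ioi (a := -(n + 2 : ℝ)) (by linarith) 0
  rw [← ofReal_integral_eq_lintegral_ofReal]
  · congr 1
    simp_rw [h]
    rw [integral_sub hi1 hi2, integral_exp_mul_Ioi (by linarith),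
      integral_exp_mul_Ioi (by linarith)]
    have h1 : (n + 1 : ℝ) ≠ 0 := by positivity
    have h2 : (n + 2 : ℝ) ≠ 0 := by positivity
    simp only [mul_zero, Real.exp_zero]
    field_simp
    ring
  · simp_rw [h]; exact hi1.sub hi2
  · refine (ae_restrict_mem measurableSet_Ioi).mono fun x hx => ?_
    have hx : 0 < x := hx
    have := Real.exp_le_one_iff.2 (show -x ≤ 0 by linarith)
    exact mul_nonneg (mul_nonneg (Real.exp_pos _).le (by linarith)) (by positivity)

theorem continuousOn_enorm_sq_mul {E : Type*} [NormedAddCommGroup E] {F : ℂ → E}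
    (hF : ContinuousOn F (ball 0 1)) :
    ContinuousOn (fun z => ‖F z‖ₑ ^ 2 * ENNReal.ofReal (1 - ‖z‖ ^ 2)) (ball 0 1) := by
  have h1 : ContinuousOn (fun z => ENNReal.ofReal (‖F z‖ ^ 2 * (1 - ‖z‖ ^ 2)))
      (ball 0 1) := ENNReal.continuous_ofReal.comp_continuousOn
      ((hF.norm.pow 2).mul (by fun_prop))
  refine h1.congr fun z _ => ?_
  dsimp only
  rw [ENNReal.ofReal_mul (by positivity), ENNReal.ofReal_pow (norm_nonneg _), ofReal_norm]

variable {H : Type*} [NormedAddCommGroup H] [InnerProductSpace ℂ H] [CompleteSpace H]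

/-- The weighted Bergman norm in terms of the coefficients. -/
theorem lintegral_enorm_sq_powerSum_ball {b : ℕ → H} (hb : DiscSummable 1 b) :
    ∫⁻ z in ball (0 : ℂ) 1, ‖powerSum b z‖ₑ ^ 2 * ENNReal.ofReal (1 - ‖z‖ ^ 2) =
      ∑' n : ℕ, ENNReal.ofReal (π / ((n + 1) * (n + 2))) * ‖b n‖ₑ ^ 2 := by
  rw [lintegral_ball_eq_lintegral_logPolar
    (continuousOn_enorm_sq_mul hb.differentiableOn.continuousOn)]
  have h1 : ∀ x ∈ Ioi (0 : ℝ), ENNReal.ofReal (Real.exp (-x)) *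
      ∫⁻ θ, ‖powerSum b (logPolar x θ)‖ₑ ^ 2 * ENNReal.ofReal (1 - ‖logPolar x θ‖ ^ 2)
        ∂circleMeasure =
      ∑' n : ℕ, ENNReal.ofReal (Real.exp (-x) * (1 - Real.exp (-x)) *
        Real.exp (-x / 2) ^ (2 * n)) * ‖b n‖ₑ ^ 2 := by
    intro x hx
    have hx : 0 < x := hx
    have hle := Real.exp_le_one_iff.2 (show -x ≤ 0 by linarith)
    have he : Real.exp (-x / 2) ^ 2 = Real.exp (-x) := by
      rw [← Real.exp_nat_mul]; congr 1; push_cast; ring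
    simp_rw [norm_logPolar, he]
    rw [lintegral_mul_const' _ _ ENNReal.ofReal_ne_top]
    simp only [logPolar]
    rw [lintegral_enorm_sq_powerSum_circleMap hb (Real.exp_pos _).le
      (Real.exp_lt_one_iff.2 (by linarith)), mul_comm (∑' _, _), ← mul_assoc,
      ← ENNReal.ofReal_mul (Real.exp_pos _).le, ← ENNReal.tsum_mul_left]
    refine tsum_congr fun n => ?_
    rw [← mul_assoc, ← ENNReal.ofReal_mul (mul_nonneg (Real.exp_pos _).le (by linarith))]
  rw [setLIntegral_congr_fun measurableSet_Ioi h1, lintegral_tsum (fun n => by fun_prop),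
    ← ENNReal.tsum_mul_left]
  refine tsum_congr fun n => ?_
  rw [lintegral_mul_const _ (by fun_prop), lintegral_exp_mul_one_sub_exp, ← mul_assoc,
    ← ENNReal.ofReal_mul (by positivity), mul_one_div]

/-- The weighted Bergman norm of `D^{1+α} Γ f` is comparable with the Hardy norm of `D^α Γ f`. -/
theorem lintegral_powerSum_fracHankelCoeff_le {α : ℝ} {a : ℕ → H} {f : ℕ → ℂ}
    (h : DiscSummable 1 (fracHankelCoeff (1 + α) a f)) :
    ∫⁻ z in ball (0 : ℂ) 1, ‖powerSum (fracHankelCoeff (1 + α) a f) z‖ₑ ^ 2 *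
        ENNReal.ofReal (1 - ‖z‖ ^ 2) ≤
      ENNReal.ofReal π * ∑' n, ‖fracHankelCoeff α a f n‖ₑ ^ 2 := by
  rw [lintegral_enorm_sq_powerSum_ball h, ← ENNReal.tsum_mul_left]
  refine ENNReal.tsum_le_tsum fun n => ?_
  simp only [fracHankelCoeff, ← ofReal_norm, norm_ofReal_rpow_smul]
  rw [← ENNReal.ofReal_pow (by positivity), ← ENNReal.ofReal_pow (by positivity),
    ← ENNReal.ofReal_mul (by positivity), ← ENNReal.ofReal_mul (by positivity)]
  refine ENNReal.ofReal_le_ofReal ?_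
  rw [Real.rpow_add (by positivity), Real.rpow_one, div_mul_eq_mul_div, div_le_iff₀ (by positivity)]
  have : π * ((1 + n : ℝ) ^ α * ‖hankelCoeff a f n‖) ^ 2 * (1 + n) ≥ 0 := by positivity
  nlinarith

/-- Converse comparison: the two weights have ratio `π (n+1)/(n+2)`, which is at least `π/2`. -/
theorem le_lintegral_powerSum_fracHankelCoeff {α : ℝ} {a : ℕ → H} {f : ℕ → ℂ}
    (h : DiscSummable 1 (fracHankelCoeff (1 + α) a f)) :
    ∑' n, ‖fracHankelCoeff α a f n‖ₑ ^ 2 ≤ ENNReal.ofReal (2 / π) *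
      ∫⁻ z in ball (0 : ℂ) 1, ‖powerSum (fracHankelCoeff (1 + α) a f) z‖ₑ ^ 2 *
        ENNReal.ofReal (1 - ‖z‖ ^ 2) := by
  rw [lintegral_enorm_sq_powerSum_ball h, ← ENNReal.tsum_mul_left]
  refine ENNReal.tsum_le_tsum fun n => ?_
  simp only [fracHankelCoeff, ← ofReal_norm, norm_ofReal_rpow_smul]
  rw [← ENNReal.ofReal_pow (by positivity), ← ENNReal.ofReal_pow (by positivity),
    ← ENNReal.ofReal_mul (by positivity), ← ENNReal.ofReal_mul (by positivity)]
  refine ENNReal.ofReal_le_ofReal ?_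
  rw [Real.rpow_add (by positivity), Real.rpow_one]
  set t := (1 + n : ℝ) ^ α * ‖hankelCoeff a f n‖ with ht
  have h1 : 2 / π * (π / ((n + 1) * (n + 2)) *
      ((1 + n : ℝ) * (1 + n : ℝ) ^ α * ‖hankelCoeff a f n‖) ^ 2) =
      2 * (1 + n : ℝ) * t ^ 2 / (n + 2) := by
    rw [mul_assoc (1 + n : ℝ), ← ht]
    have := Real.pi_pos
    field_simp
    ring
  rw [h1, le_div_iff₀ (by positivity)]
  have : t ^ 2 * n ≥ 0 := by positivity
  nlinarith

end AreaIntegral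

/-! ### Bloch bounds from Szegő kernels -/

section Bloch

theorem ENNReal.tsum_mul_sq_le (u v : ℕ → ℝ≥0∞) :
    (∑' n, u n * v n) ^ 2 ≤ (∑' n, u n ^ 2) * ∑' n, v n ^ 2 := by
  have h := ENNReal.lintegral_mul_le_Lp_mul_Lq Measure.count Real.HolderConjugate.two_two
    (measurable_of_countable u).aemeasurable (measurable_of_countable v).aemeasurable
  simp only [lintegral_count, Pi.mul_apply, ENNReal.rpow_two] at h
  refine (pow_le_pow_left₀ zero_le h 2).trans_eq ?_
  have h2 (t : ℝ≥0∞) : (t ^ (1 / 2 : ℝ)) ^ 2 = t := by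
    rw [← ENNReal.rpow_two, ← ENNReal.rpow_mul]; norm_num
  rw [mul_pow, h2, h2]

theorem tsum_ofReal_pow_sq {x : ℝ} (h0 : 0 ≤ x) (h1 : x < 1) :
    ∑' n : ℕ, ENNReal.ofReal (x ^ n) ^ 2 = ENNReal.ofReal (1 - x ^ 2)⁻¹ := by
  have hx : x ^ 2 < 1 := by nlinarith
  rw [← tsum_geometric_of_lt_one (by positivity) hx,
    ENNReal.ofReal_tsum_of_nonneg (fun n => by positivity)
    (summable_geometric_of_lt_one (by positivity) hx)]
  exact tsum_congr fun n => by rw [← ENNReal.ofReal_pow (by positivity)]; congr 1; ring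

/-- The reproducing kernel `∑ vⁿ zⁿ` of the Hardy space. -/
def szegoKernel (v : ℂ) (hv : ‖v‖ < 1) : HardySpace ℂ :=
  hardyOfCoeff (fun n => v ^ n) (by
    have h : ‖v‖ ^ 2 < 1 := by nlinarith [norm_nonneg v]
    refine (summable_geometric_of_lt_one (by positivity) h).congr fun n => ?_
    rw [norm_pow]; ring)

theorem taylorCoeff_szegoKernel (v : ℂ) (hv : ‖v‖ < 1) :
    taylorCoeff (szegoKernel v hv) = fun n => v ^ n := taylorCoeff_hardyOfCoeff _ _

theorem exists_discSummable_pow {v : ℂ} (hv : ‖v‖ < 1) :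
    ∃ R > (1 : ℝ), DiscSummable R fun n => v ^ n := by
  refine ⟨2 / (1 + ‖v‖), by rw [gt_iff_lt, lt_div_iff₀ (by positivity)]; linarith, ?_⟩
  intro r h0 h1
  rw [lt_div_iff₀ (by positivity)] at h1
  have h2 : r * ‖v‖ < 1 := by nlinarith [norm_nonneg v]
  refine (summable_geometric_of_lt_one (by positivity) h2).congr fun n => ?_
  rw [norm_pow, mul_pow]

theorem szegoKernel_extendsAnalytically (v : ℂ) (hv : ‖v‖ < 1) :
    (szegoKernel v hv).ExtendsAnalytically := by
  rw [hardySpace_extendsAnalytically_iff, taylorCoeff_szegoKernel]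
  exact exists_discSummable_pow hv

theorem norm_sq_szegoKernel (v : ℂ) (hv : ‖v‖ < 1) :
    ‖szegoKernel v hv‖ ^ 2 = (1 - ‖v‖ ^ 2)⁻¹ := by
  have hx : ‖v‖ ^ 2 < 1 := by nlinarith [norm_nonneg v]
  rw [norm_sq_hardySpace, taylorCoeff_szegoKernel, ← tsum_geometric_of_lt_one (by positivity) hx]
  exact tsum_congr fun n => by rw [norm_pow]; ring

theorem szegoKernel_apply (v : ℂ) (hv : ‖v‖ < 1) {z : ℂ} (hz : z ∈ ball (0 : ℂ) 1) :
    szegoKernel v hv z = (1 - z * v)⁻¹ := by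
  have h : ‖z * v‖ < 1 := by
    rw [norm_mul]
    exact mul_lt_one_of_nonneg_of_lt_one_left (norm_nonneg _) (mem_ball_zero_iff.1 hz) hv.le
  rw [szegoKernel, eqOn_hardyOfCoeff _ _ hz, powerSum, ← tsum_geometric_of_norm_lt_one h]
  exact tsum_congr fun n => by rw [smul_eq_mul, mul_pow]

/-- Bernoulli's inequality for `(1 - 1/(1+n))^{1+α}`, multiplied by `(1+n)^{1+α}`. -/
theorem rpow_one_add_sub_le {α : ℝ} (hα : 0 < α) (n : ℕ) :
    |(1 + n : ℝ) ^ (1 + α) - (n : ℝ) ^ (1 + α)| ≤ (1 + α) * (1 + n : ℝ) ^ α := by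
  have hn : (0 : ℝ) < 1 + n := by positivity
  have hmono : (n : ℝ) ^ (1 + α) ≤ (1 + n : ℝ) ^ (1 + α) :=
    Real.rpow_le_rpow (by positivity) (by linarith) (by linarith)
  rw [abs_of_nonneg (by linarith)]
  have h := one_add_mul_self_le_rpow_one_add (s := -(1 + n : ℝ)⁻¹) (by
    rw [neg_le_neg_iff]; exact inv_le_one_of_one_le₀ (by simp)) (p := 1 + α) (by linarith)
  have h1 : 1 + -(1 + n : ℝ)⁻¹ = n / (1 + n) := by field_simp; ring
  rw [h1, Real.div_rpow (by positivity) hn.le, le_div_iff₀ (by positivity)] at h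
  have h2 : (1 + n : ℝ) ^ (1 + α) = (1 + n) * (1 + n : ℝ) ^ α := by
    rw [Real.rpow_add hn, Real.rpow_one]
  rw [h2] at h ⊢
  have h3 : (1 + (1 + α) * -(1 + n : ℝ)⁻¹) * ((1 + n) * (1 + n : ℝ) ^ α) =
      (1 + n) * (1 + n : ℝ) ^ α - (1 + α) * (1 + n : ℝ) ^ α := by
    field_simp
    ring
  linarith

variable {H : Type*} [NormedAddCommGroup H] [InnerProductSpace ℂ H] [CompleteSpace H]

/-- Summation by parts for the values of `D^{1+α} φ` in terms of the Hankel coefficients. -/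
theorem powerSum_rpow_smul_eq_tsum {α : ℝ} (hα : 0 < α) {a : ℕ → H} (ha : DiscSummable 1 a)
    {w : ℂ} (hw : ‖w‖ < 1) :
    powerSum (fun k : ℕ => (((1 + k : ℝ) ^ (1 + α) : ℝ) : ℂ) • a k) w =
      ∑' n : ℕ, (((1 + n : ℝ) ^ (1 + α) - (n : ℝ) ^ (1 + α) : ℝ) : ℂ) •
        (w ^ n • hankelCoeff a (fun m => w ^ m) n) := by
  obtain ⟨R, hR, hf⟩ := exists_discSummable_pow hw
  set A := hankelCoeff a (fun m => w ^ m) with hA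
  -- On a geometric sequence the Hankel coefficients satisfy a first-order recursion. It expresses
  -- `aₙ` through `Aₙ` and `Aₙ₊₁` and turns the series for `D^{1+α} φ` into a telescoped one.
  have hrec (n : ℕ) : A n = a n + w • A (n + 1) := by
    have h := hasSum_hankelCoeff ha hR hf n
    rw [hA, ← h.tsum_eq, h.summable.tsum_eq_zero_add, hankelCoeff, ← tsum_const_smul'']
    simp only [pow_zero, one_smul, zero_add]
    congr 1
    refine tsum_congr fun m => ?_
    rw [smul_smul, pow_succ', add_right_comm, add_assoc]
  let u (n : ℕ) : H := (((1 + n : ℝ) ^ (1 + α) : ℝ) : ℂ) • (w ^ n • A n)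
  let v (n : ℕ) : H := (((n : ℝ) ^ (1 + α) : ℝ) : ℂ) • (w ^ n • A n)
  have hu : Summable u := by
    refine ((discSummable_fracHankelCoeff (1 + α) ha hR hf).hasSum hw).summable.congr fun n => ?_
    simp only [u, fracHankelCoeff]
    rw [smul_comm]
  have hvsucc (n : ℕ) : v (n + 1) = u n - w ^ n • (((1 + n : ℝ) ^ (1 + α) : ℝ) : ℂ) • a n := by
    simp only [u, v]
    rw [hrec n, smul_comm (w ^ n), smul_add, smul_add, add_sub_cancel_left, pow_succ, mul_smul,
      Nat.cast_add_one, add_comm (n : ℝ)]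
  have hv0 : v 0 = 0 := by
    simp only [v]
    rw [Nat.cast_zero, Real.zero_rpow (by linarith)]
    simp
  have hG := (ha.rpow_smul (1 + α)).hasSum hw
  have hv1 : Summable fun n => v (n + 1) := by
    simp_rw [hvsucc]
    exact hu.sub hG.summable
  have hv : Summable v := (summable_nat_add_iff 1).1 hv1
  have h1 : ∑' n, v n = ∑' n, u n - powerSum
      (fun k : ℕ => (((1 + k : ℝ) ^ (1 + α) : ℝ) : ℂ) • a k) w := by
    rw [hv.tsum_eq_zero_add, hv0, zero_add]
    simp_rw [hvsucc]
    rw [hu.tsum_sub hG.summable, powerSum]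
  have h2 : ∑' n, (u n - v n) = ∑' n, u n - ∑' n, v n := hu.tsum_sub hv
  rw [h1, sub_sub_cancel] at h2
  rw [← h2]
  refine tsum_congr fun n => ?_
  simp only [u, v]
  rw [← sub_smul, Complex.ofReal_sub]

/-- A bound of the Hankel operator on reproducing kernels controls the Bloch norm. -/
theorem norm_powerSum_mul_le_of_hankel {α : ℝ} (hα : 0 < α) {a : ℕ → H} (ha : DiscSummable 1 a)
    {M : ℝ} (hM : 0 ≤ M) (h : ∀ f : HardySpace ℂ, f.ExtendsAnalytically →
      ∑' n, ‖fracHankelCoeff α a (taylorCoeff f) n‖ₑ ^ 2 ≤ ENNReal.ofReal (M ^ 2 * ‖f‖ ^ 2))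
    {w : ℂ} (hw : w ∈ ball (0 : ℂ) 1) :
    ‖powerSum (fun k : ℕ => (((1 + k : ℝ) ^ (1 + α) : ℝ) : ℂ) • a k) w‖ * (1 - ‖w‖ ^ 2) ≤
      (1 + α) * M := by
  have hw1 : ‖w‖ < 1 := mem_ball_zero_iff.1 hw
  have hx : 0 < 1 - ‖w‖ ^ 2 := by nlinarith [norm_nonneg w]
  have hT := h _ (szegoKernel_extendsAnalytically w hw1)
  rw [norm_sq_szegoKernel, taylorCoeff_szegoKernel] at hT
  set G := powerSum (fun k : ℕ => (((1 + k : ℝ) ^ (1 + α) : ℝ) : ℂ) • a k) w with hG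
  set B := fracHankelCoeff α a (fun m => w ^ m) with hB
  have h1 : ‖G‖ₑ ≤ ENNReal.ofReal (1 + α) * ∑' n, ENNReal.ofReal (‖w‖ ^ n) * ‖B n‖ₑ := by
    rw [hG, powerSum_rpow_smul_eq_tsum hα ha hw1, ← ENNReal.tsum_mul_left]
    refine enorm_tsum_le_tsum_enorm.trans (ENNReal.tsum_le_tsum fun n => ?_)
    rw [← ofReal_norm, ← ofReal_norm, ← ENNReal.ofReal_mul (by positivity),
      ← ENNReal.ofReal_mul (by positivity)]
    refine ENNReal.ofReal_le_ofReal ?_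
    rw [hB, fracHankelCoeff, norm_ofReal_rpow_smul, norm_smul, norm_smul, norm_pow,
      Complex.norm_real, Real.norm_eq_abs]
    refine (mul_le_mul_of_nonneg_right (rpow_one_add_sub_le hα n) (by positivity)).trans_eq ?_
    ring
  -- Cauchy-Schwarz gives one factor `(1-|w|²)⁻¹` from `∑ |w|^{2n}` and one from the squared norm of
  -- the Szegő kernel.
  have h2 : ‖G‖ₑ ^ 2 ≤ ENNReal.ofReal (((1 + α) * M * (1 - ‖w‖ ^ 2)⁻¹) ^ 2) := by
    refine (pow_le_pow_left₀ zero_le h1 2).trans ?_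
    rw [mul_pow]
    refine (mul_le_mul_right ((ENNReal.tsum_mul_sq_le _ _).trans (mul_le_mul_right hT _))
      _).trans ?_
    rw [tsum_ofReal_pow_sq (norm_nonneg _) hw1, ← ENNReal.ofReal_mul (by positivity),
      ← ENNReal.ofReal_pow (by positivity), ← ENNReal.ofReal_mul (by positivity)]
    refine ENNReal.ofReal_le_ofReal (le_of_eq ?_)
    ring
  rw [← ofReal_norm, ← ENNReal.ofReal_pow (norm_nonneg _),
    ENNReal.ofReal_le_ofReal_iff (by positivity)] at h2
  have h3 := (sq_le_sq₀ (norm_nonneg _) (by positivity)).1 h2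
  rwa [← div_eq_mul_inv, le_div_iff₀ hx] at h3

/-- The diagonal of the Bergman kernel for the weight `1 - |z|²`: the reciprocal weights are
`(n+1)(n+2)/π = (2/π) C(n+2, 2)`. -/
theorem tsum_inv_mul_pow_sq {x : ℝ} (h0 : 0 ≤ x) (h1 : x < 1) :
    ∑' n : ℕ, ENNReal.ofReal ((√(π / ((n + 1) * (n + 2))))⁻¹ * x ^ n) ^ 2 =
      ENNReal.ofReal (2 / π * (1 - x ^ 2)⁻¹ ^ 3) := by
  have hx : ‖x ^ 2‖ < 1 := by rw [Real.norm_of_nonneg (by positivity)]; nlinarith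
  have h := (hasSum_choose_mul_geometric_of_norm_lt_one (𝕜 := ℝ) 2 hx).mul_left (2 / π)
  have hs : HasSum (fun n : ℕ => ((√(π / ((n + 1) * (n + 2))))⁻¹ * x ^ n) ^ 2)
      (2 / π * (1 - x ^ 2)⁻¹ ^ 3) := by
    rw [show 2 / π * (1 - x ^ 2)⁻¹ ^ 3 = 2 / π * (1 / (1 - x ^ 2) ^ (2 + 1)) by simp]
    refine h.congr_fun fun n => ?_
    rw [mul_pow, inv_pow, Real.sq_sqrt (by positivity), Nat.cast_choose_two]
    have := Real.pi_pos
    push_cast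
    field_simp
    ring
  rw [← hs.tsum_eq, ENNReal.ofReal_tsum_of_nonneg (fun n => by positivity) hs.summable]
  exact tsum_congr fun n => by rw [← ENNReal.ofReal_pow (by positivity)]

/-- Point evaluation on the weighted Bergman space. -/
theorem enorm_sq_powerSum_le {b : ℕ → H} (hb : DiscSummable 1 b) {w : ℂ} (hw : ‖w‖ < 1) :
    ‖powerSum b w‖ₑ ^ 2 ≤ ENNReal.ofReal (2 / π * (1 - ‖w‖ ^ 2)⁻¹ ^ 3) *
      ∫⁻ z in ball (0 : ℂ) 1, ‖powerSum b z‖ₑ ^ 2 * ENNReal.ofReal (1 - ‖z‖ ^ 2) := by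
  rw [lintegral_enorm_sq_powerSum_ball hb, ← tsum_inv_mul_pow_sq (norm_nonneg w) hw]
  have h (n : ℕ) : ENNReal.ofReal (π / ((n + 1) * (n + 2))) * ‖b n‖ₑ ^ 2 =
      (ENNReal.ofReal √(π / ((n + 1) * (n + 2))) * ‖b n‖ₑ) ^ 2 := by
    rw [mul_pow, ← ENNReal.ofReal_pow (by positivity), Real.sq_sqrt (by positivity)]
  simp_rw [h]
  refine le_trans (pow_le_pow_left₀ zero_le ?_ 2) (ENNReal.tsum_mul_sq_le _ _)
  refine enorm_tsum_le_tsum_enorm.trans (ENNReal.tsum_le_tsum fun n => le_of_eq ?_)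
  rw [← mul_assoc, ← ENNReal.ofReal_mul (by positivity), enorm_smul, enorm_pow, mul_right_comm,
    inv_mul_cancel₀ (by have := Real.pi_pos; positivity), one_mul,
    ENNReal.ofReal_pow (norm_nonneg _), ofReal_norm]

/-- The Carleson condition on reproducing kernels controls the Bloch norm. -/
theorem norm_mul_le_of_carleson {G : ℂ → H} (hG : DifferentiableOn ℂ G (ball 0 1)) {K : ℝ}
    (hK : 0 ≤ K) (h : ∀ f : HardySpace ℂ, f.ExtendsAnalytically →
      ∫⁻ z in ball (0 : ℂ) 1, ENNReal.ofReal (‖f z‖ ^ 2 * ‖G z‖ ^ 2 * (1 - ‖z‖ ^ 2)) ≤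
        ENNReal.ofReal (K ^ 2 * ‖f‖ ^ 2))
    {w : ℂ} (hw : w ∈ ball (0 : ℂ) 1) : ‖G w‖ * (1 - ‖w‖ ^ 2) ≤ K := by
  have hw1 : ‖w‖ < 1 := mem_ball_zero_iff.1 hw
  have hx : 0 < 1 - ‖w‖ ^ 2 := by nlinarith [norm_nonneg w]
  have hcw : ‖starRingEnd ℂ w‖ < 1 := by rwa [RCLike.norm_conj]
  -- The conjugate makes `f(z) = (1 - z w̄)⁻¹`, the kernel reproducing at `w`, so that `f(w) = ‖f‖²
  -- = (1-|w|²)⁻¹`. Point evaluation of `f G` at `w` then costs the third power of this number.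
  set f := szegoKernel (starRingEnd ℂ w) hcw with hf
  have hS := h f (szegoKernel_extendsAnalytically _ hcw)
  rw [hf, norm_sq_szegoKernel, ← hf, RCLike.norm_conj] at hS
  have hP : DifferentiableOn ℂ (fun z => f z • G z) (ball 0 1) := f.2.1.smul hG
  have hPeq := eqOn_powerSum_taylorCoeff hP
  have h1 := enorm_sq_powerSum_le (discSummable_taylorCoeff hP) hw1
  have hint : ∫⁻ z in ball (0 : ℂ) 1, ‖powerSum (taylorCoeff fun z => f z • G z) z‖ₑ ^ 2 *
      ENNReal.ofReal (1 - ‖z‖ ^ 2) =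
      ∫⁻ z in ball (0 : ℂ) 1, ENNReal.ofReal (‖f z‖ ^ 2 * ‖G z‖ ^ 2 * (1 - ‖z‖ ^ 2)) := by
    refine setLIntegral_congr_fun measurableSet_ball fun z hz => ?_
    rw [← hPeq hz, ← ofReal_norm, norm_smul, ← ENNReal.ofReal_pow (by positivity),
      ← ENNReal.ofReal_mul (by positivity), mul_pow]
  rw [hint, ← hPeq hw] at h1
  replace h1 := h1.trans (mul_le_mul_right hS _)
  have hfw : ‖f w‖ = (1 - ‖w‖ ^ 2)⁻¹ := by
    rw [hf, szegoKernel_apply _ _ hw, Complex.mul_conj', norm_inv]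
    congr 1
    rw [← Complex.ofReal_pow, ← Complex.ofReal_one, ← Complex.ofReal_sub, Complex.norm_real,
      Real.norm_of_nonneg hx.le]
  rw [← ofReal_norm, norm_smul, hfw, ← ENNReal.ofReal_pow (by positivity),
    ← ENNReal.ofReal_mul (by positivity), ENNReal.ofReal_le_ofReal_iff (by positivity)] at h1
  -- Dropping `2/π` leaves the clean bound `K`.
  have hπ : 2 / π ≤ 1 := (div_le_one Real.pi_pos).2 Real.two_le_pi
  set y := (1 - ‖w‖ ^ 2)⁻¹ with hy
  have hy0 : 0 < y := inv_pos.2 hx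
  have h2 : (y * ‖G w‖) ^ 2 ≤ (y ^ 2 * K) ^ 2 := by
    calc (y * ‖G w‖) ^ 2 ≤ 2 / π * y ^ 3 * (K ^ 2 * y) := h1
      _ ≤ 1 * y ^ 3 * (K ^ 2 * y) := by gcongr
      _ = _ := by ring
  have h3 := (sq_le_sq₀ (by positivity) (by positivity)).1 h2
  have h4 : ‖G w‖ ≤ y * K := by
    refine le_of_mul_le_mul_left (h3.trans_eq ?_) hy0
    ring
  rw [hy, mul_comm, ← div_eq_mul_inv, le_div_iff₀ hx] at h4
  exact h4

end Bloch

/-! ### Comparison of the Carleson integral with the Hankel operator -/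

section Comparison

/-- The function with conjugate Taylor coefficients. -/
def hardyConj (f : HardySpace ℂ) : HardySpace ℂ :=
  hardyOfCoeff (fun n => starRingEnd ℂ (taylorCoeff f n))
    ((summable_sq_taylorCoeff f).congr fun n => by rw [RCLike.norm_conj])

theorem taylorCoeff_hardyConj (f : HardySpace ℂ) :
    taylorCoeff (hardyConj f) = fun n => starRingEnd ℂ (taylorCoeff f n) :=
  taylorCoeff_hardyOfCoeff _ _

theorem norm_hardyConj (f : HardySpace ℂ) : ‖hardyConj f‖ = ‖f‖ := by
  refine (sq_eq_sq₀ (norm_nonneg _) (norm_nonneg _)).1 ?_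
  rw [norm_sq_hardySpace, norm_sq_hardySpace, taylorCoeff_hardyConj]
  simp

theorem hardyConj_extendsAnalytically {f : HardySpace ℂ} (hf : f.ExtendsAnalytically) :
    (hardyConj f).ExtendsAnalytically := by
  obtain ⟨R, hR, h⟩ := hf.exists_discSummable
  rw [hardySpace_extendsAnalytically_iff, taylorCoeff_hardyConj]
  exact ⟨R, hR, h.of_norm_le 1 fun n => by simp⟩

theorem enorm_sq_le_two_mul_add {E : Type*} [NormedAddCommGroup E] (x y : E) :
    ‖x‖ₑ ^ 2 ≤ 2 * ‖y‖ₑ ^ 2 + 2 * ‖x - y‖ₑ ^ 2 := by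
  have h : ‖x‖ ≤ ‖y‖ + ‖x - y‖ := by simpa using norm_add_le y (x - y)
  have h2 : ENNReal.ofReal (‖x‖ ^ 2) ≤ ENNReal.ofReal (2 * ‖y‖ ^ 2 + 2 * ‖x - y‖ ^ 2) := by
    refine ENNReal.ofReal_le_ofReal ?_
    nlinarith [norm_nonneg x, sq_nonneg (‖y‖ - ‖x - y‖)]
  rw [ENNReal.ofReal_add (by positivity) (by positivity), ENNReal.ofReal_mul zero_le_two,
    ENNReal.ofReal_mul zero_le_two, ENNReal.ofReal_pow (norm_nonneg _),
    ENNReal.ofReal_pow (norm_nonneg _), ENNReal.ofReal_pow (norm_nonneg _)] at h2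
  simpa using h2

theorem lintegral_enorm_sq_le_two_mul_add {E : Type*} [NormedAddCommGroup E] {F G : ℂ → E}
    (hG : ContinuousOn G (ball 0 1)) :
    ∫⁻ z in ball (0 : ℂ) 1, ‖F z‖ₑ ^ 2 * ENNReal.ofReal (1 - ‖z‖ ^ 2) ≤
      2 * (∫⁻ z in ball (0 : ℂ) 1, ‖G z‖ₑ ^ 2 * ENNReal.ofReal (1 - ‖z‖ ^ 2)) +
      2 * ∫⁻ z in ball (0 : ℂ) 1, ‖F z - G z‖ₑ ^ 2 * ENNReal.ofReal (1 - ‖z‖ ^ 2) := by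
  have hGm := (continuousOn_enorm_sq_mul hG).aemeasurable (μ := volume) measurableSet_ball
  rw [← lintegral_const_mul' _ _ ENNReal.ofNat_ne_top,
    ← lintegral_const_mul' _ _ ENNReal.ofNat_ne_top, ← lintegral_add_left' (hGm.const_mul 2)]
  refine lintegral_mono fun z => ?_
  rw [← mul_assoc, ← mul_assoc, ← add_mul]
  exact mul_le_mul_left (enorm_sq_le_two_mul_add _ _) _

/-- Under a Bloch bound, `\bar g D^{1+α} φ` and `D^{1+α} Γ_φ` differ by a bounded error. -/
theorem lintegral_conj_smul_sub_le {α : ℝ} (hα : 0 < α) : ∃ C : ℝ, 0 < C ∧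
    ∀ (H : Type*) [NormedAddCommGroup H] [InnerProductSpace ℂ H] [CompleteSpace H] (a : ℕ → H),
      DiscSummable 1 a → ∀ B : ℝ, 0 ≤ B →
      (∀ w ∈ ball (0 : ℂ) 1,
        ‖powerSum (fun k : ℕ => (((1 + k : ℝ) ^ (1 + α) : ℝ) : ℂ) • a k) w‖ *
          (1 - ‖w‖ ^ 2) ≤ B) →
      ∀ g : HardySpace ℂ, g.ExtendsAnalytically →
      ∫⁻ z in ball (0 : ℂ) 1, ‖starRingEnd ℂ (g z) •
        powerSum (fun k : ℕ => (((1 + k : ℝ) ^ (1 + α) : ℝ) : ℂ) • a k) z -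
        powerSum (fracHankelCoeff (1 + α) a (taylorCoeff (hardyConj g))) z‖ₑ ^ 2 *
          ENNReal.ofReal (1 - ‖z‖ ^ 2) ≤ ENNReal.ofReal (C * B ^ 2 * ‖g‖ ^ 2) := by
  obtain ⟨C₁, hC₁, h₁⟩ := enorm_conj_smul_sub_le hα
  obtain ⟨C₂, hC₂, h₂⟩ := lintegral_error_sq_le hα
  refine ⟨π * C₁ ^ 2 * C₂, by positivity, ?_⟩
  intro H _ _ _ a ha B hB hG g hg
  obtain ⟨R, hR, hgR⟩ := (hardyConj_extendsAnalytically hg).exists_discSummable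
  have hEc : ContinuousOn (fun z => starRingEnd ℂ (g z) •
        powerSum (fun k : ℕ => (((1 + k : ℝ) ^ (1 + α) : ℝ) : ℂ) • a k) z -
        powerSum (fracHankelCoeff (1 + α) a (taylorCoeff (hardyConj g))) z) (ball 0 1) :=
    ((Complex.continuous_conj.comp_continuousOn g.2.1.continuousOn).smul
      (ha.rpow_smul (1 + α)).differentiableOn.continuousOn).sub
      (discSummable_fracHankelCoeff (1 + α) ha hR hgR).differentiableOn.continuousOn
  rw [lintegral_ball_eq_lintegral_logPolarMeasure (continuousOn_enorm_sq_mul hEc)]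
  have h3 : ∫⁻ q, ENNReal.ofReal (Real.exp (-q.1)) * (‖starRingEnd ℂ (g (logPolar q.1 q.2)) •
        powerSum (fun k : ℕ => (((1 + k : ℝ) ^ (1 + α) : ℝ) : ℂ) • a k) (logPolar q.1 q.2) -
        powerSum (fracHankelCoeff (1 + α) a (taylorCoeff (hardyConj g)))
          (logPolar q.1 q.2)‖ₑ ^ 2 * ENNReal.ofReal (1 - ‖logPolar q.1 q.2‖ ^ 2))
        ∂logPolarMeasure ≤
      ENNReal.ofReal ((C₁ * B) ^ 2) * ENNReal.ofReal (C₂ * ‖g‖ ^ 2) := by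
    refine le_trans ?_ (mul_le_mul_right (h₂ g) _)
    rw [← lintegral_const_mul' _ _ ENNReal.ofReal_ne_top]
    refine lintegral_mono_ae ?_
    filter_upwards [ae_logPolarMeasure_mem_Ioi] with q hq
    have he : ‖logPolar q.1 q.2‖ ^ 2 = Real.exp (-q.1) := by
      rw [norm_logPolar, ← Real.exp_nat_mul]; congr 1; push_cast; ring
    have h := h₁ H a ha B hB hG g hg _ (logPolar_mem_ball hq q.2)
    rw [← taylorCoeff_hardyConj] at h
    rw [he, mul_left_comm, ← ENNReal.ofReal_mul (Real.exp_pos _).le, mul_comm,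
      mul_left_comm (ENNReal.ofReal ((C₁ * B) ^ 2)), ENNReal.ofReal_pow (by positivity), ← mul_pow]
    exact mul_le_mul_right (pow_le_pow_left₀ zero_le h 2) _
  refine (mul_le_mul_right h3 _).trans_eq ?_
  rw [← ENNReal.ofReal_mul (by positivity), ← ENNReal.ofReal_mul (by positivity)]
  congr 1
  ring

/-- The Carleson integral and the weighted Bergman norm of the Hankel operator agree up to the
Bloch norm of the symbol. -/
theorem lintegral_carleson_comparison {α : ℝ} (hα : 0 < α) : ∃ C : ℝ, 0 < C ∧
    ∀ (H : Type*) [NormedAddCommGroup H] [InnerProductSpace ℂ H] [CompleteSpace H] (a : ℕ → H),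
      DiscSummable 1 a → ∀ B : ℝ, 0 ≤ B →
      (∀ w ∈ ball (0 : ℂ) 1,
        ‖powerSum (fun k : ℕ => (((1 + k : ℝ) ^ (1 + α) : ℝ) : ℂ) • a k) w‖ *
          (1 - ‖w‖ ^ 2) ≤ B) →
      ∀ g : HardySpace ℂ, g.ExtendsAnalytically →
      ∫⁻ z in ball (0 : ℂ) 1, ENNReal.ofReal (‖g z‖ ^ 2 *
        ‖powerSum (fun k : ℕ => (((1 + k : ℝ) ^ (1 + α) : ℝ) : ℂ) • a k) z‖ ^ 2 *
          (1 - ‖z‖ ^ 2)) ≤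
        ENNReal.ofReal (2 * π) *
          ∑' n, ‖fracHankelCoeff α a (taylorCoeff (hardyConj g)) n‖ₑ ^ 2 +
          ENNReal.ofReal (C * B ^ 2 * ‖g‖ ^ 2) ∧
      ∑' n, ‖fracHankelCoeff α a (taylorCoeff (hardyConj g)) n‖ₑ ^ 2 ≤
        ENNReal.ofReal (2 / π) * (2 * (∫⁻ z in ball (0 : ℂ) 1, ENNReal.ofReal (‖g z‖ ^ 2 *
          ‖powerSum (fun k : ℕ => (((1 + k : ℝ) ^ (1 + α) : ℝ) : ℂ) • a k) z‖ ^ 2 *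
          (1 - ‖z‖ ^ 2))) + ENNReal.ofReal (C * B ^ 2 * ‖g‖ ^ 2)) := by
  obtain ⟨C, hC, h⟩ := lintegral_conj_smul_sub_le hα
  refine ⟨2 * C, by positivity, ?_⟩
  intro H _ _ _ a ha B hB hG g hg
  have hE := h H a ha B hB hG g hg
  obtain ⟨R, hR, hgR⟩ := (hardyConj_extendsAnalytically hg).exists_discSummable
  have hV := discSummable_fracHankelCoeff (1 + α) ha hR hgR
  have hVc := hV.differentiableOn.continuousOn
  set G := powerSum (fun k : ℕ => (((1 + k : ℝ) ^ (1 + α) : ℝ) : ℂ) • a k) with hGdef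
  have hPc : ContinuousOn (fun z => starRingEnd ℂ (g z) • G z) (ball 0 1) :=
    (Complex.continuous_conj.comp_continuousOn g.2.1.continuousOn).smul
      (ha.rpow_smul (1 + α)).differentiableOn.continuousOn
  have hP : ∫⁻ z in ball (0 : ℂ) 1, ENNReal.ofReal (‖g z‖ ^ 2 * ‖G z‖ ^ 2 * (1 - ‖z‖ ^ 2)) =
      ∫⁻ z in ball (0 : ℂ) 1,
        ‖starRingEnd ℂ (g z) • G z‖ₑ ^ 2 * ENNReal.ofReal (1 - ‖z‖ ^ 2) := by
    refine lintegral_congr fun z => ?_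
    rw [← ofReal_norm (_ • _), norm_smul, RCLike.norm_conj, ← ENNReal.ofReal_pow (by positivity),
      ← ENNReal.ofReal_mul (by positivity), mul_pow]
  have h2 : ENNReal.ofReal (2 * C * B ^ 2 * ‖g‖ ^ 2) =
      2 * ENNReal.ofReal (C * B ^ 2 * ‖g‖ ^ 2) := by
    rw [mul_assoc 2, mul_assoc 2, ENNReal.ofReal_mul zero_le_two, ENNReal.ofReal_ofNat]
  -- Both inequalities are `‖x‖² ≤ 2‖y‖² + 2‖x-y‖²` with the roles of `conj g · G` and `D^{1+α} Γ_φ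
  -- f` exchanged; hence the error constant `2C`.
  rw [hP, h2]
  constructor
  · refine (lintegral_enorm_sq_le_two_mul_add hVc).trans (add_le_add ?_ (by gcongr))
    rw [ENNReal.ofReal_mul zero_le_two, ENNReal.ofReal_ofNat, mul_assoc]
    exact mul_le_mul_right (lintegral_powerSum_fracHankelCoeff_le hV) _
  · refine (le_lintegral_powerSum_fracHankelCoeff hV).trans (mul_le_mul_right ?_ _)
    refine (lintegral_enorm_sq_le_two_mul_add hPc).trans (add_le_add le_rfl ?_)
    refine mul_le_mul_right ?_ _
    simp_rw [enorm_sub_rev (powerSum (fracHankelCoeff _ _ _) _)]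
    exact hE

/-- Homogeneity: normalizing `f` removes the restriction to the unit sphere. The zero function is
treated apart. -/
theorem lintegral_le_of_carlesonSup_lt_top {H : Type*} [NormedAddCommGroup H] [NormedSpace ℂ H]
    {α : ℝ} {φ : ℂ → H} (hS : carlesonSup α φ < ∞)
    {f : HardySpace ℂ} (hf : f.ExtendsAnalytically) :
    ∫⁻ z in ball (0 : ℂ) 1, ENNReal.ofReal (‖f z‖ ^ 2 * ‖fracDiff (1 + α) φ z‖ ^ 2 *
      (1 - ‖z‖ ^ 2)) ≤ ENNReal.ofReal ((carlesonSup α φ).toReal * ‖f‖ ^ 2) := by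
  by_cases h0 : f = 0
  · have h (z : ℂ) : f z = 0 := by rw [h0]; rfl
    simp [h]
  have hn : 0 < ‖f‖ := norm_pos_iff.2 h0
  set c : ℂ := ((‖f‖⁻¹ : ℝ) : ℂ) with hc
  have hcn : ‖c‖ = ‖f‖⁻¹ := by rw [hc, Complex.norm_of_nonneg (by positivity)]
  have hfc : (c • f).ExtendsAnalytically := (analyticSubmodule ℂ).smul_mem c hf
  have hfn : ‖c • f‖ = 1 := by rw [norm_smul, hcn, inv_mul_cancel₀ hn.ne']
  have h1 : ∫⁻ z in ball (0 : ℂ) 1, ENNReal.ofReal (‖(c • f) z‖ ^ 2 *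
      ‖fracDiff (1 + α) φ z‖ ^ 2 * (1 - ‖z‖ ^ 2)) ≤ carlesonSup α φ :=
    le_iSup₂_of_le (c • f) ⟨hfc, hfn⟩ le_rfl
  rw [mul_comm, ENNReal.ofReal_mul (by positivity), ENNReal.ofReal_toReal hS.ne]
  refine le_trans (le_of_eq ?_) (mul_le_mul_right h1 _)
  rw [← lintegral_const_mul' _ _ ENNReal.ofReal_ne_top]
  refine lintegral_congr fun z => ?_
  rw [← ENNReal.ofReal_mul (by positivity)]
  congr 1
  have hz : (c • f) z = c * f z := rfl
  rw [hz, norm_mul, hcn]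
  field_simp

end Comparison

/-! ### The equivalence and the norm comparison -/

theorem mainTheorem6 (α : ℝ) (hα : 0 < α) :
    ∃ c C : ℝ, 0 < c ∧ 0 < C ∧
      ∀ (H : Type*) [NormedAddCommGroup H] [InnerProductSpace ℂ H] [CompleteSpace H]
        [TopologicalSpace.SeparableSpace H] (φ : ℂ → H),
        DifferentiableOn ℂ φ (ball 0 1) →
          ((∃ T : HardySpace ℂ →L[ℂ] HardySpace H, ExtendsFracHankel α φ T) ↔
            carlesonSup α φ < ∞) ∧
          ∀ T : HardySpace ℂ →L[ℂ] HardySpace H, ExtendsFracHankel α φ T →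
            ENNReal.ofReal (c * ‖T‖ ^ 2) ≤ carlesonSup α φ ∧
              carlesonSup α φ ≤ ENNReal.ofReal (C * ‖T‖ ^ 2) := by
  obtain ⟨C, hC0, hcomp⟩ := lintegral_carleson_comparison hα
  -- With `S` the Carleson supremum, the reverse comparison bounds the squared Hardy norm by
  -- `(2/π)(2S + C B²) ‖f‖²`, and `B² = S` is admissible; hence `D`. The other constant comes from
  -- the direct comparison with `B = (1+α)‖T‖`.
  set D : ℝ := 2 / π * (2 + C) with hD
  have hD0 : 0 < D := by positivity
  refine ⟨D⁻¹, 2 * π + C * (1 + α) ^ 2, by positivity, by positivity, ?_⟩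
  intro H _ _ _ _ φ hφ
  have ha := discSummable_taylorCoeff hφ
  have hcomp' := hcomp H (taylorCoeff φ) ha
  have hbound_T (T : HardySpace ℂ →L[ℂ] HardySpace H) (hT : ExtendsFracHankel α φ T)
      (f : HardySpace ℂ) (hf : f.ExtendsAnalytically) :
      ∑' n, ‖fracHankelCoeff α (taylorCoeff φ) (taylorCoeff f) n‖ₑ ^ 2 ≤
        ENNReal.ofReal (‖T‖ ^ 2 * ‖f‖ ^ 2) := by
    rw [← hT.ofReal_norm_sq hφ hf, ← mul_pow]
    exact ENNReal.ofReal_le_ofReal (pow_le_pow_left₀ (norm_nonneg _) (T.le_opNorm f) 2)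
  have hupper (T : HardySpace ℂ →L[ℂ] HardySpace H) (hT : ExtendsFracHankel α φ T) :
      carlesonSup α φ ≤ ENNReal.ofReal ((2 * π + C * (1 + α) ^ 2) * ‖T‖ ^ 2) := by
    refine iSup₂_le fun g hg => ?_
    obtain ⟨hg, hg1⟩ := hg
    rw [fracDiff_eq_powerSum]
    refine (hcomp' ((1 + α) * ‖T‖) (by positivity) (fun w hw =>
      norm_powerSum_mul_le_of_hankel hα ha (norm_nonneg T) (hbound_T T hT) hw) g hg).1.trans ?_
    refine (add_le_add (mul_le_mul_right (hbound_T T hT _ (hardyConj_extendsAnalytically hg)) _)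
      le_rfl).trans_eq ?_
    rw [norm_hardyConj, hg1, ← ENNReal.ofReal_mul (by positivity),
      ← ENNReal.ofReal_add (by positivity) (by positivity)]
    congr 1
    ring
  have hlower (hS : carlesonSup α φ < ∞) (f : HardySpace ℂ) (hf : f.ExtendsAnalytically) :
      ∑' n, ‖fracHankelCoeff α (taylorCoeff φ) (taylorCoeff f) n‖ₑ ^ 2 ≤
        ENNReal.ofReal (√(D * (carlesonSup α φ).toReal) ^ 2 * ‖f‖ ^ 2) := by
    set S := (carlesonSup α φ).toReal with hSdef
    have hS0 : 0 ≤ S := ENNReal.toReal_nonneg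
    have hcarl (g : HardySpace ℂ) (hg : g.ExtendsAnalytically) :=
      lintegral_le_of_carlesonSup_lt_top hS hg
    rw [fracDiff_eq_powerSum, ← hSdef] at hcarl
    have hBloch (w : ℂ) (hw : w ∈ ball (0 : ℂ) 1) := norm_mul_le_of_carleson
      (ha.rpow_smul (1 + α)).differentiableOn (Real.sqrt_nonneg S)
      (fun g hg => (hcarl g hg).trans_eq (by rw [Real.sq_sqrt hS0])) hw
    -- The comparison concerns the conjugate of `g`; taking for `g` the conjugate of `f` reaches
    -- every `f ∈ 𝒪`.
    have hconj : taylorCoeff (hardyConj (hardyConj f)) = taylorCoeff f := by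
      rw [taylorCoeff_hardyConj, taylorCoeff_hardyConj]
      simp
    have hgf := hardyConj_extendsAnalytically hf
    have h := (hcomp' (√S) (Real.sqrt_nonneg S) hBloch _ hgf).2
    rw [hconj] at h
    refine h.trans ((mul_le_mul_right (add_le_add (mul_le_mul_right (hcarl _ hgf) _) le_rfl)
      _).trans_eq ?_)
    rw [norm_hardyConj, Real.sq_sqrt hS0, Real.sq_sqrt (by positivity),
      ← ENNReal.ofReal_ofNat 2, ← ENNReal.ofReal_mul zero_le_two,
      ← ENNReal.ofReal_add (by positivity) (by positivity), ← ENNReal.ofReal_mul (by positivity)]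
    congr 1
    rw [hD]
    ring
  refine ⟨⟨fun ⟨T, hT⟩ => (hupper T hT).trans_lt ENNReal.ofReal_lt_top, fun hS =>
    exists_extendsFracHankel (Real.sqrt_nonneg _) hφ (hlower hS)⟩, fun T hT => ⟨?_, hupper T hT⟩⟩
  have hS : carlesonSup α φ < ∞ := (hupper T hT).trans_lt ENNReal.ofReal_lt_top
  -- The norm of `T` is determined on the dense subspace `𝒪`, where `T` is given by the Hankel
  -- coefficients.
  have hnorm : ‖T‖ ≤ √(D * (carlesonSup α φ).toReal) := by
    refine norm_le_of_extendsAnalytically (Real.sqrt_nonneg _) fun f hf => ?_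
    have h := hlower hS f hf
    rw [← hT.ofReal_norm_sq hφ hf, ENNReal.ofReal_le_ofReal_iff (by positivity), ← mul_pow] at h
    exact (sq_le_sq₀ (norm_nonneg _) (by positivity)).1 h
  have h2 := pow_le_pow_left₀ (norm_nonneg T) hnorm 2
  rw [Real.sq_sqrt (by positivity)] at h2
  rw [← ENNReal.ofReal_toReal hS.ne]
  refine ENNReal.ofReal_le_ofReal ?_
  rwa [inv_mul_le_iff₀ hD0]

end
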